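/- Let $S$ be the four-holed sphere, presented as a closed round disk in the oriented plane with three open round holes in a row from left to right. Let $a,b,c$ be curves parallel to the boundaries of the first, second and third hole, $d$ a curve parallel to the outer boundary, $e$ a round curve enclosing exactly the first two holes, and $f$ a round curve enclosing exactly the last two holes. Write $\tau_x\in \mathrm{Map}(S,\partial S)$ for the right-handed Dehn twist about $x$; in a product the left factor is applied first. Let $\sigma_1,\sigma_2$ be the standard generators of the braid group on three strands, where $\sigma_i$ is a right-handed half twist of the strands $i$ and $i+1$, so that $(\sigma_2\sigma_1\sigma_2)^2$ is the full right-handed twist. Let $\alpha,\beta,\gamma,\delta$ be integers, $k\ge 0$, and $\epsilon_1,\eta_1,\dots,\epsilon_k,\eta_k$ integers, with $\epsilon=\sum_{i=1}^k\epsilon_i$ and $\eta=\sum_{i=1}^k\eta_i$. Let $\phi$ be a homeomorphism of $S$ fixing $\partial S$ pointwise whose mapping class relative to the boundary is $$\tau_a^{\alpha}\tau_b^{\beta}\tau_c^{\gamma}\tau_d^{\delta}\,\tau_e^{\epsilon_1}\tau_f^{\eta_1}\cdots\tau_e^{\epsilon_k}\tau_f^{\eta_k}.$$ Let $Y$ be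 the closed oriented 3-manifold given by the open book $(S,\phi)$, that is, the quotient of $S\times[0,1]$ by $(x,1)\sim(\phi(x),0)$ for $x\in S$ and $(x,s)\sim(x,t)$ for $x\in\partial S$ and $s,t\in[0,1]$, with the product orientation. Then the braid $$(\sigma_2\sigma_1\sigma_2)^{2\delta}\,\sigma_1^{2\epsilon_1}\sigma_2^{2\eta_1}\cdots\sigma_1^{2\epsilon_k}\sigma_2^{2\eta_k}$$ is pure, and $Y$ is obtained, up to orientation-preserving homeomorphism, by integral Dehn surgery in $S^3$ on its braid closure (the closure of any geometric pure braid representing it), where the components that come from the first, second and third strand have the surgery coefficients $$(\alpha+\delta+\epsilon,\ \ \beta+\delta+\epsilon+\eta,\ \ \gamma+\delta+\eta)$$ with respect to the Seifert framings. -/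

import Mathlib

open scoped unitInterval

noncomputable section

namespace OpenBookSurgery

/-! ### Mapping class groups of planar surfaces and open books -/

/-- Self-homeomorphisms of a planar region `S` that fix the boundary `∂S` pointwise. -/
def RelHomeo (S : Set ℂ) : Subgroup (S ≃ₜ S) where
  carrier := {f | ∀ x : S, (x : ℂ) ∈ frontier S → f x = x}
  one_mem' := fun _ _ => rfl
  mul_mem' := by
    intro f g hf hg x hx
    change f (g x) = x
    rw [hg x hx, hf x hx]
  inv_mem' := by
    intro f hf x hx
    change f.symm x = x
    rw [Homeomorph.symm_apply_eq]
    exact (hf x hx).symm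

/-- Isotopy relative to the boundary: a jointly continuous family of homeomorphisms fixing `∂S`. -/
def IsotopicRel (S : Set ℂ) (f g : RelHomeo S) : Prop :=
  ∃ F : I → RelHomeo S, Continuous (fun p : I × S => (F p.1 : S ≃ₜ S) p.2) ∧ F 0 = f ∧ F 1 = g

/-- The identity component: homeomorphisms isotopic to the identity relative to the boundary. -/
def IsotopicToId (S : Set ℂ) : Subgroup (RelHomeo S) where
  carrier := {f | IsotopicRel S 1 f}
  one_mem' := ⟨fun _ => 1, continuous_snd, rfl, rfl⟩
  mul_mem' := by
    rintro f g ⟨F, hF, hF0, hF1⟩ ⟨G, hG, hG0, hG1⟩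
    refine ⟨fun t => F t * G t, ?_, by simp [hF0, hG0], by simp [hF1, hG1]⟩
    exact hF.comp (continuous_fst.prodMk hG)
  inv_mem' := by
    rintro f ⟨F, hF, hF0, hF1⟩
    refine ⟨fun t => F (unitInterval.symm t) * f⁻¹, ?_, by simp [hF1], by simp [hF0]⟩
    exact hF.comp ((unitInterval.continuous_symm.comp continuous_fst).prodMk
      ((f⁻¹ : RelHomeo S).1.continuous.comp continuous_snd))

instance (S : Set ℂ) : (IsotopicToId S).Normal where
  conj_mem := by
    rintro f ⟨F, hF, hF0, hF1⟩ g
    refine ⟨fun t => g * F t * g⁻¹, ?_, by simp [hF0], by simp [hF1]⟩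
    exact (g.1.continuous.comp hF).comp (continuous_fst.prodMk
      ((g⁻¹ : RelHomeo S).1.continuous.comp continuous_snd))

/-- The mapping class group `Map(S, ∂S)`. The opposite multiplication implements the braid
convention for compositions: in `f * g` the class `f` is applied first. -/
abbrev MappingClassGroup (S : Set ℂ) := (RelHomeo S ⧸ IsotopicToId S)ᵐᵒᵖ

/-- The mapping class of a homeomorphism. -/
def mappingClass {S : Set ℂ} (f : RelHomeo S) : MappingClassGroup S :=
  MulOpposite.op (QuotientGroup.mk f)

/-- The identifications defining the manifold of the open book `(S, φ)`: the top `S × {1}` is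
glued to the bottom by `φ`, and each circle over a boundary point of the page is collapsed. -/
inductive OpenBookRel {S : Set ℂ} (φ : RelHomeo S) : S × I → S × I → Prop
  | glue (x : S) : OpenBookRel φ (x, 1) ((φ : S ≃ₜ S) x, 0)
  | collapse (x : S) (hx : (x : ℂ) ∈ frontier S) (s t : I) : OpenBookRel φ (x, s) (x, t)

/-- The 3-manifold given by the abstract open book `(S, φ)`. -/
def OpenBook {S : Set ℂ} (φ : RelHomeo S) : Type := Quot (OpenBookRel φ)

instance {S : Set ℂ} (φ : RelHomeo S) : TopologicalSpace (OpenBook φ) :=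
  inferInstanceAs (TopologicalSpace (Quot (OpenBookRel φ)))

/-! ### Dehn twists and the four-holed sphere -/

/-- The angle function of a twist: `2π` for `r ≤ r₁`, `0` for `r ≥ r₂`, linear in between. -/
def twistAngle (r₁ r₂ r : ℝ) : ℝ := 2 * Real.pi * max 0 (min 1 ((r₂ - r) / (r₂ - r₁)))

/-- Rotation of the circle of radius `r` about `c` by the angle `s * twistAngle r₁ r₂ r`. -/
def twistMap (c : ℂ) (r₁ r₂ s : ℝ) (z : ℂ) : ℂ :=
  c + (z - c) * Complex.exp ((s * twistAngle r₁ r₂ ‖z - c‖ : ℝ) * Complex.I)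

lemma norm_twistMap_sub (c : ℂ) (r₁ r₂ s : ℝ) (z : ℂ) :
    ‖twistMap c r₁ r₂ s z - c‖ = ‖z - c‖ := by
  simp only [twistMap, add_sub_cancel_left, norm_mul, Complex.norm_exp_ofReal_mul_I, mul_one]

lemma twistMap_twistMap (c : ℂ) (r₁ r₂ s : ℝ) (z : ℂ) :
    twistMap c r₁ r₂ (-s) (twistMap c r₁ r₂ s z) = z := by
  have h := norm_twistMap_sub c r₁ r₂ s z
  rw [twistMap, h]
  simp only [twistMap, add_sub_cancel_left, mul_assoc, ← Complex.exp_add]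
  simp

lemma continuous_twistMap (c : ℂ) (r₁ r₂ s : ℝ) : Continuous (twistMap c r₁ r₂ s) := by
  unfold twistMap twistAngle
  fun_prop

lemma twistMap_eq_self {c : ℂ} {r₁ r₂ s : ℝ} (hs : s = 1 ∨ s = -1) (hr : r₁ < r₂) {z : ℂ}
    (hz : ¬ (r₁ < ‖z - c‖ ∧ ‖z - c‖ < r₂)) : twistMap c r₁ r₂ s z = z := by
  have hpos : 0 < r₂ - r₁ := sub_pos.2 hr
  suffices h : Complex.exp ((s * twistAngle r₁ r₂ ‖z - c‖ : ℝ) * Complex.I) = 1 by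
    rw [twistMap, h, mul_one, add_sub_cancel]
  by_cases h1 : r₁ < ‖z - c‖
  · have h2 : r₂ ≤ ‖z - c‖ := by
      by_contra h
      exact hz ⟨h1, not_le.1 h⟩
    have h3 : (r₂ - ‖z - c‖) / (r₂ - r₁) ≤ 0 := div_nonpos_of_nonpos_of_nonneg (by linarith) hpos.le
    have h4 : twistAngle r₁ r₂ ‖z - c‖ = 0 := by
      rw [twistAngle, min_eq_right (by linarith), max_eq_left h3, mul_zero]
    simp [h4]
  · have h3 : 1 ≤ (r₂ - ‖z - c‖) / (r₂ - r₁) := by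
      rw [le_div_iff₀ hpos]
      linarith
    have h4 : twistAngle r₁ r₂ ‖z - c‖ = 2 * Real.pi := by
      rw [twistAngle, min_eq_left h3, max_eq_right zero_le_one, mul_one]
    rw [h4]
    rcases hs with rfl | rfl
    · simp
    · have := Complex.exp_neg (2 * Real.pi * Complex.I)
      rw [Complex.exp_two_pi_mul_I] at this
      simpa using this

lemma twistMap_mem {S : Set ℂ} {c : ℂ} {r₁ r₂ s : ℝ} (hs : s = 1 ∨ s = -1) (hr : r₁ < r₂)
    (hS : ∀ z, r₁ < ‖z - c‖ → ‖z - c‖ < r₂ → z ∈ S) {z : ℂ} (hz : z ∈ S) :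
    twistMap c r₁ r₂ s z ∈ S := by
  by_cases h : r₁ < ‖z - c‖ ∧ ‖z - c‖ < r₂
  · rw [← norm_twistMap_sub c r₁ r₂ s z] at h
    exact hS _ h.1 h.2
  · rwa [twistMap_eq_self hs hr h]

/-- The right-handed Dehn twist of `S` supported in the round annulus `r₁ < ‖z - c‖ < r₂`
contained in `S`, that is, the twist about the core circle of this annulus. An arc that crosses
the annulus turns to the right: the image of a radial ray leaving the inner circle turns clockwise
by `2π` until it reaches the outer circle. -/
def dehnTwist (S : Set ℂ) (c : ℂ) (r₁ r₂ : ℝ) (hr : r₁ < r₂)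
    (hS : ∀ z, r₁ < ‖z - c‖ → ‖z - c‖ < r₂ → z ∈ S) : RelHomeo S :=
  ⟨{ toFun := fun x => ⟨twistMap c r₁ r₂ 1 x, twistMap_mem (Or.inl rfl) hr hS x.2⟩
     invFun := fun x => ⟨twistMap c r₁ r₂ (-1) x, twistMap_mem (Or.inr rfl) hr hS x.2⟩
     left_inv := fun x => Subtype.ext (twistMap_twistMap c r₁ r₂ 1 x)
     right_inv := fun x => Subtype.ext (by simpa using twistMap_twistMap c r₁ r₂ (-1) x)
     continuous_toFun :=
       ((continuous_twistMap c r₁ r₂ 1).comp continuous_subtype_val).subtype_mk _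
     continuous_invFun :=
       ((continuous_twistMap c r₁ r₂ (-1)).comp continuous_subtype_val).subtype_mk _ }, by
    intro x hx
    refine Subtype.ext (twistMap_eq_self (Or.inl rfl) hr fun h => ?_)
    have ho : IsOpen {z : ℂ | r₁ < ‖z - c‖ ∧ ‖z - c‖ < r₂} :=
      IsOpen.and (isOpen_lt continuous_const (continuous_id.sub continuous_const).norm)
        (isOpen_lt (continuous_id.sub continuous_const).norm continuous_const)
    exact hx.2 (mem_interior.2 ⟨_, fun z hz => hS z hz.1 hz.2, ho, h⟩)⟩

/-- The four-holed sphere, as a disk with three round holes in a row. -/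
def fourHoledSphere : Set ℂ := {z | ‖z‖ ≤ 10 ∧ 1 ≤ ‖z + 4‖ ∧ 1 ≤ ‖z‖ ∧ 1 ≤ ‖z - 4‖}

lemma annulus_subset {c : ℝ} {r₁ r₂ : ℝ} (h0 : |c| + r₂ ≤ 10)
    (h1 : |c + 4| + 1 ≤ r₁ ∨ r₂ + 1 ≤ |c + 4|) (h2 : |c| + 1 ≤ r₁ ∨ r₂ + 1 ≤ |c|)
    (h3 : |c - 4| + 1 ≤ r₁ ∨ r₂ + 1 ≤ |c - 4|) (z : ℂ) (hz₁ : r₁ < ‖z - c‖)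
    (hz₂ : ‖z - c‖ < r₂) : z ∈ fourHoledSphere := by
  have key : ∀ p : ℝ, (|c - p| + 1 ≤ r₁ ∨ r₂ + 1 ≤ |c - p|) → 1 ≤ ‖z - p‖ := by
    intro p hp
    have e : ‖(c : ℂ) - p‖ = |c - p| := by
      rw [← Complex.ofReal_sub, Complex.norm_real, Real.norm_eq_abs]
    have t1 := norm_sub_le_norm_sub_add_norm_sub z (p : ℂ) (c : ℂ)
    have t2 := norm_sub_le_norm_sub_add_norm_sub (c : ℂ) z (p : ℂ)
    rw [norm_sub_rev (p : ℂ) c] at t1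
    rw [norm_sub_rev (c : ℂ) z] at t2
    rcases hp with hp | hp <;> linarith
  have ec : ‖(c : ℂ)‖ = |c| := by rw [Complex.norm_real, Real.norm_eq_abs]
  have t := norm_add_le (z - c) (c : ℂ)
  rw [sub_add_cancel] at t
  refine ⟨by linarith, ?_, ?_, ?_⟩
  · simpa using key (-4) (by simpa using h1)
  · simpa using key 0 (by simpa using h2)
  · simpa using key 4 (by simpa using h3)

/-- The mapping class of the right-handed Dehn twist of the four-holed sphere about the core of the
annulus `r₁ < ‖z - c‖ < r₂` with real centre `c`. -/
def twistClass (c r₁ r₂ : ℝ) (hr : r₁ < r₂) (h0 : |c| + r₂ ≤ 10)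
    (h1 : |c + 4| + 1 ≤ r₁ ∨ r₂ + 1 ≤ |c + 4|) (h2 : |c| + 1 ≤ r₁ ∨ r₂ + 1 ≤ |c|)
    (h3 : |c - 4| + 1 ≤ r₁ ∨ r₂ + 1 ≤ |c - 4|) : MappingClassGroup fourHoledSphere :=
  mappingClass (dehnTwist fourHoledSphere c r₁ r₂ hr (annulus_subset h0 h1 h2 h3))

/-- The twist about `a`, parallel to the boundary of the first hole. -/
def τa : MappingClassGroup fourHoledSphere :=
  twistClass (-4) 1 2 (by norm_num) (by norm_num [abs_of_nonpos]) (by norm_num)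
    (by norm_num [abs_of_nonpos]) (by norm_num [abs_of_nonpos])

/-- The twist about `b`, parallel to the boundary of the second hole. -/
def τb : MappingClassGroup fourHoledSphere :=
  twistClass 0 1 2 (by norm_num) (by norm_num) (by norm_num) (by norm_num) (by norm_num)

/-- The twist about `c`, parallel to the boundary of the third hole. -/
def τc : MappingClassGroup fourHoledSphere :=
  twistClass 4 1 2 (by norm_num) (by norm_num) (by norm_num) (by norm_num) (by norm_num)

/-- The twist about `d`, parallel to the outer boundary. -/
def τd : MappingClassGroup fourHoledSphere :=
  twistClass 0 9 10 (by norm_num) (by norm_num) (by norm_num) (by norm_num) (by norm_num)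

/-- The twist about `e`, which encloses the first and the second hole. -/
def τe : MappingClassGroup fourHoledSphere :=
  twistClass (-2) 3 4 (by norm_num) (by norm_num) (by norm_num) (by norm_num) (by norm_num)

/-- The twist about `f`, which encloses the second and the third hole. -/
def τf : MappingClassGroup fourHoledSphere :=
  twistClass 2 3 4 (by norm_num) (by norm_num) (by norm_num) (by norm_num) (by norm_num)

/-! ### Braids on three strands -/

/-- Ordered triples of distinct points of the plane. -/
abbrev Conf : Type := {x : Fin 3 → ℂ // Function.Injective x}

/-- Two ordered triples are equivalent if they have the same underlying set. -/
def confSetoid : Setoid Conf where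
  r x y := Set.range x.1 = Set.range y.1
  iseqv := ⟨fun _ => rfl, fun h => h.symm, fun h h' => h.trans h'⟩

/-- Unordered triples of distinct points of the plane. -/
abbrev UConf : Type := Quotient confSetoid

/-- Forgetting the order. -/
def forgetOrder : C(Conf, UConf) := ⟨Quotient.mk confSetoid, continuous_quot_mk⟩

/-- The base configuration: the centres of the three holes, from left to right. -/
def basePoint : Conf := ⟨![-4, 0, 4], by
  intro i j h
  fin_cases i <;> fin_cases j <;> first | rfl | (exfalso; norm_num at h)⟩

/-- The braid group on three strands. The opposite multiplication makes the product `x * y` the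
braid `x` followed by the braid `y`. -/
abbrev BraidGroup : Type := (FundamentalGroup UConf (forgetOrder basePoint))ᵐᵒᵖ

/-- The braid of a loop of unordered configurations. -/
def braidOfLoop (γ : Path (forgetOrder basePoint) (forgetOrder basePoint)) : BraidGroup :=
  MulOpposite.op (FundamentalGroup.fromPath (Path.Homotopic.Quotient.mk γ))

lemma exp_pi_ne {t : ℝ} {a : ℂ} (ha : ‖a‖ ≠ 1) : Complex.exp ((Real.pi * t : ℝ) * Complex.I) ≠ a :=
  fun h => ha (by rw [← h, Complex.norm_exp_ofReal_mul_I])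

/-- The first two points are interchanged by a counterclockwise half rotation about `-2`. -/
def halfTwist₁ (t : ℝ) : Conf :=
  ⟨![-2 - 2 * Complex.exp ((Real.pi * t : ℝ) * Complex.I),
    -2 + 2 * Complex.exp ((Real.pi * t : ℝ) * Complex.I), 4], by
    have h0 := exp_pi_ne (t := t) (a := 0) (by norm_num)
    have h3 := exp_pi_ne (t := t) (a := 3) (by norm_num)
    have h3' := exp_pi_ne (t := t) (a := -3) (by norm_num)
    generalize Complex.exp ((Real.pi * t : ℝ) * Complex.I) = w at *
    intro i j h
    fin_cases i <;> fin_cases j <;> first | rfl | (exfalso; simp at h; grind)⟩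

/-- The last two points are interchanged by a counterclockwise half rotation about `2`. -/
def halfTwist₂ (t : ℝ) : Conf :=
  ⟨![-4, 2 - 2 * Complex.exp ((Real.pi * t : ℝ) * Complex.I),
    2 + 2 * Complex.exp ((Real.pi * t : ℝ) * Complex.I)], by
    have h0 := exp_pi_ne (t := t) (a := 0) (by norm_num)
    have h3 := exp_pi_ne (t := t) (a := 3) (by norm_num)
    have h3' := exp_pi_ne (t := t) (a := -3) (by norm_num)
    generalize Complex.exp ((Real.pi * t : ℝ) * Complex.I) = w at *
    intro i j h
    fin_cases i <;> fin_cases j <;> first | rfl | (exfalso; simp at h; grind)⟩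

lemma continuous_halfTwist₁ : Continuous halfTwist₁ := by
  refine Continuous.subtype_mk (continuous_pi fun i => ?_) _
  fin_cases i <;> simp <;> fun_prop

lemma continuous_halfTwist₂ : Continuous halfTwist₂ := by
  refine Continuous.subtype_mk (continuous_pi fun i => ?_) _
  fin_cases i <;> simp <;> fun_prop

/-- The generator `σ₁`: the first two strands make a right-handed half twist. -/
def σ₁ : BraidGroup := braidOfLoop
  { toFun := fun t => forgetOrder (halfTwist₁ t)
    continuous_toFun :=
      forgetOrder.continuous.comp (continuous_halfTwist₁.comp continuous_subtype_val)
    source' := by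
      congr 1
      apply Subtype.ext
      norm_num [halfTwist₁, basePoint]
    target' := by
      apply Quotient.sound
      change Set.range _ = Set.range _
      norm_num [halfTwist₁, basePoint]
      grind }

/-- The generator `σ₂`: the last two strands make a right-handed half twist. -/
def σ₂ : BraidGroup := braidOfLoop
  { toFun := fun t => forgetOrder (halfTwist₂ t)
    continuous_toFun :=
      forgetOrder.continuous.comp (continuous_halfTwist₂.comp continuous_subtype_val)
    source' := by
      congr 1
      apply Subtype.ext
      norm_num [halfTwist₂, basePoint]
    target' := by
      apply Quotient.sound
      change Set.range _ = Set.range _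
      norm_num [halfTwist₂, basePoint]
      grind }

/-- A geometric pure braid, given by the motion of its three strands. -/
abbrev PureBraid : Type := Path basePoint basePoint

/-- The class of a geometric pure braid in the braid group. -/
def PureBraid.toBraid (b : PureBraid) : BraidGroup := braidOfLoop (b.map forgetOrder.continuous)

/-! ### The three-sphere, braid closures and orientations -/

/-- The unit sphere of `ℂ²`. -/
abbrev S3 : Type := Metric.sphere (0 : EuclideanSpace ℂ (Fin 2)) 1

/-- The map `ℂ × ℝ → S³`, `(z, θ) ↦ (z, exp (iθ)) / √(1 + |z|²)`. It identifies `ℂ × ℝ / 2πℤ` with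
the complement of the unknotted circle on which the second coordinate vanishes (the braid axis),
and it carries the orientation of `ℂ × ℝ` to the orientation of `S³` as the boundary of the ball. -/
def sphereCoord (p : ℂ × ℝ) : S3 :=
  ⟨((Real.sqrt (1 + ‖p.1‖ ^ 2))⁻¹ : ℝ) • !₂[p.1, Complex.exp (p.2 * Complex.I)], by
    have h : 0 < Real.sqrt (1 + ‖p.1‖ ^ 2) := Real.sqrt_pos.2 (by positivity)
    rw [mem_sphere_zero_iff_norm, norm_smul, EuclideanSpace.norm_eq]
    simp only [Fin.sum_univ_two, Matrix.cons_val_zero, Matrix.cons_val_one,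
      Complex.norm_exp_ofReal_mul_I, one_pow]
    rw [add_comm (‖p.1‖ ^ 2) 1, Real.norm_of_nonneg (inv_nonneg.2 h.le), inv_mul_cancel₀ h.ne']⟩

/-- The `i`-th component of the closure of a pure braid. -/
def PureBraid.closure (b : PureBraid) (i : Fin 3) : Set S3 :=
  Set.range fun t : I => sphereCoord ((b t).1 i, 2 * Real.pi * t)

/-- The germ of `f` at `p` has local degree one: near `p`, the map `f` is homotopic, as a map of
pairs `(U, U ∖ {p}) → (V, V ∖ {f p})`, to a translation. A local homeomorphism has this property
if and only if it preserves the orientation at `p`. -/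
def HasLocalDegreeOne (f : ℂ × ℝ → ℂ × ℝ) (p : ℂ × ℝ) : Prop :=
  ∃ r > 0, ∃ H : ℝ × (ℂ × ℝ) → ℂ × ℝ,
    ContinuousOn H (Set.Icc 0 1 ×ˢ Metric.ball p r) ∧
    (∀ q ∈ Metric.ball p r, H (0, q) = f q) ∧
    (∀ q ∈ Metric.ball p r, H (1, q) = f p + (q - p)) ∧
    (∀ s ∈ Set.Icc (0 : ℝ) 1, ∀ q ∈ Metric.ball p r, H (s, q) = f p ↔ q = p)

/-- Let the 3-manifolds `M` and `N` be oriented by local coordinates in `ℂ × ℝ` (`R q m` says that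
`m` is the point with coordinates `q`). An open embedding `h` of a connected `M` in `N` preserves
the orientation if it does so at one point, when read in the coordinates. -/
def PreservesOrientation {M N : Type} (R : ℂ × ℝ → M → Prop) (R' : ℂ × ℝ → N → Prop)
    (h : M → N) : Prop :=
  ∃ (p : ℂ × ℝ) (f : ℂ × ℝ → ℂ × ℝ),
    (∀ᶠ q in nhds p, ∃ m, R q m ∧ R' (f q) (h m)) ∧ HasLocalDegreeOne f p

/-- Coordinates of the open solid torus `S¹ × ℂ`. -/
def torusCoord (q : ℂ × ℝ) (m : Circle × ℂ) : Prop := m = (Circle.exp q.2, q.1)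

/-- Coordinates of the three-sphere. -/
def s3Coord (q : ℂ × ℝ) (x : S3) : Prop := x = sphereCoord q

/-- Coordinates of an open book: the product of the interior of the page and the open interval. -/
def openBookCoord {S : Set ℂ} (φ : RelHomeo S) (q : ℂ × ℝ) (y : OpenBook φ) : Prop :=
  ∃ (x : S) (t : I), (x : ℂ) ∈ interior S ∧ 0 < t ∧ t < 1 ∧ q = ((x : ℂ), (t : ℝ)) ∧
    y = Quot.mk _ (x, t)

/-! ### Dehn surgery -/

/-- An oriented tubular neighbourhood of a knot `K` in the three-sphere, with a product structure:
an orientation-preserving open embedding of `S¹ × ℂ` that carries `S¹ × {0}` onto `K`. -/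
structure Tube (K : Set S3) where
  toFun : Circle × ℂ → S3
  isOpenEmbedding : Topology.IsOpenEmbedding toFun
  core : K = Set.range fun u => toFun (u, 0)
  orientation : PreservesOrientation torusCoord s3Coord toFun

namespace Tube

variable {K : Set S3} (e : Tube K)

lemma notMem (u : Circle) {w : ℂ} (hw : w ≠ 0) : e.toFun (u, w) ∉ K := by
  intro h
  obtain ⟨v, hv⟩ := e.core.subset h
  exact hw (congrArg Prod.snd (e.isOpenEmbedding.injective hv)).symm

/-- A common base point of the longitude and the meridian. -/
def base : {x : S3 // x ∉ K} := ⟨e.toFun (1, 1), e.notMem 1 one_ne_zero⟩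

/-- The longitude `S¹ × {1}` of the tube, a parallel copy of the knot. -/
def longitude : Path e.base e.base where
  toFun t := ⟨e.toFun (Circle.exp (2 * Real.pi * t), 1), e.notMem _ one_ne_zero⟩
  continuous_toFun :=
    (e.isOpenEmbedding.continuous.comp (by fun_prop)).subtype_mk _
  source' := by simp [base]
  target' := by simp [base]

/-- The meridian `{1} × S¹` of the tube. -/
def meridian : Path e.base e.base where
  toFun t := ⟨e.toFun (1, (Circle.exp (2 * Real.pi * t) : ℂ)), e.notMem _ (Circle.coe_ne_zero _)⟩
  continuous_toFun :=
    (e.isOpenEmbedding.continuous.comp (by fun_prop)).subtype_mk _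
  source' := by simp [base]
  target' := by simp [base]

/-- The class of a loop in the first homology group of the knot complement, the abelianized
fundamental group. -/
def homologyClass (γ : Path e.base e.base) :
    Abelianization (FundamentalGroup {x : S3 // x ∉ K} e.base) :=
  Abelianization.of (FundamentalGroup.fromPath (Path.Homotopic.Quotient.mk γ))

/-- The longitude of the tube has linking number `n` with the knot: in the homology of the knot
complement it is `n` times the meridian. Equivalently, it has slope `n` with respect to the
meridian and the null-homologous (Seifert) longitude. -/
def HasFraming (n : ℤ) : Prop := e.homologyClass e.longitude = e.homologyClass e.meridian ^ n

end Tube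

/-- The exterior of a link: the open solid tori `S¹ × {‖w‖ < 1}` are removed. -/
def Exterior {n : ℕ} {K : Fin n → Set S3} (e : ∀ i, Tube (K i)) : Type :=
  {x : S3 // ∀ i u w, ‖w‖ < 1 → (e i).toFun (u, w) ≠ x}

instance {n : ℕ} {K : Fin n → Set S3} (e : ∀ i, Tube (K i)) : TopologicalSpace (Exterior e) :=
  inferInstanceAs (TopologicalSpace {x : S3 // ∀ i u w, ‖w‖ < 1 → (e i).toFun (u, w) ≠ x})

/-- One solid torus `D² × S¹` for each component is glued to the exterior. The point `(u, v)` of the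
boundary torus is glued to the point `(u, v)` of the boundary of the `i`-th tube, so the meridian
`∂D² × {v}` is glued to a longitude of the tube. -/
inductive SurgeryRel {n : ℕ} {K : Fin n → Set S3} (e : ∀ i, Tube (K i)) :
    Exterior e ⊕ (Fin n × Metric.closedBall (0 : ℂ) 1 × Circle) →
      Exterior e ⊕ (Fin n × Metric.closedBall (0 : ℂ) 1 × Circle) → Prop
  | glue (i : Fin n) (d : Metric.closedBall (0 : ℂ) 1) (u v : Circle) (x : Exterior e)
      (hd : (d : ℂ) = u) (hx : x.1 = (e i).toFun (u, (v : ℂ))) :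
      SurgeryRel e (Sum.inr (i, d, v)) (Sum.inl x)

/-- The result of Dehn surgery along the longitudes of the tubes. -/
def Surgery {n : ℕ} {K : Fin n → Set S3} (e : ∀ i, Tube (K i)) : Type := Quot (SurgeryRel e)

instance {n : ℕ} {K : Fin n → Set S3} (e : ∀ i, Tube (K i)) : TopologicalSpace (Surgery e) :=
  inferInstanceAs (TopologicalSpace (Quot (SurgeryRel e)))

/-- Coordinates of the surgered manifold: those of the three-sphere, in the interior of the link
exterior. -/
def surgeryCoord {n : ℕ} {K : Fin n → Set S3} (e : ∀ i, Tube (K i)) (q : ℂ × ℝ)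
    (y : Surgery e) : Prop :=
  ∃ x : Exterior e, (∀ i u w, ‖w‖ ≤ 1 → (e i).toFun (u, w) ≠ x.1) ∧ s3Coord q x.1 ∧
    y = Quot.mk _ (Sum.inl x)

/-- The manifold `Y`, oriented by the coordinates `R`, is obtained by Dehn surgery on the link in
the three-sphere with components `K i` and with (integral) surgery coefficients `c i`: there is an
orientation-preserving homeomorphism of `Y` with the result of the surgery. -/
def IsDehnSurgery (Y : Type) [TopologicalSpace Y] (R : ℂ × ℝ → Y → Prop) {n : ℕ}
    (K : Fin n → Set S3) (c : Fin n → ℤ) : Prop :=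
  ∃ e : ∀ i, Tube (K i),
    (∀ i j, i ≠ j → Disjoint (Set.range (e i).toFun) (Set.range (e j).toFun)) ∧
    (∀ i, (e i).HasFraming (c i)) ∧
    ∃ h : Y ≃ₜ Surgery e, PreservesOrientation R (surgeryCoord e) h

end OpenBookSurgery

end

/-!
A motion of the plane that carries the three holes rigidly and returns them to their places induces
a homeomorphism of `S`; it traces a pure braid and has, for each hole, a total number of turns.
Motions that rotate a disk around one, two or three holes realize the Dehn twists: their braids are
trivial, the full twists `σ₁²` and `σ₂²` of two strands, and the full twist of all three, and each
enclosed hole makes one turn.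
So the given monodromy is the end of a motion whose braid is the given one and whose numbers of
turns are the surgery coefficients.

The motion straightens the mapping torus of its end into the complement of the moving holes in the
solid torus, hence in the three-sphere once the outer boundary is collapsed. A fixed point on the
boundary of a hole sweeps out a longitude of the corresponding component of the closed braid, whose
linking number with it is the number of turns of the hole, and collapsing the boundary circles of
the open book glues in solid tori in which these longitudes bound. Finally, homotopic braids
are joined by small moves of the strands, each of which extends to the three-sphere, so that the
surgery depends only on the class of the braid.
-/

open scoped unitInterval

noncomputable section

namespace OpenBookSurgery

/-! ### Pure braids and braids -/

lemma exists_perm_comp_eq_of_range_eq {ι X : Type*} {x y : ι → X} (hx : Function.Injective x)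
    (hy : Function.Injective y) (h : Set.range x = Set.range y) :
    ∃ e : Equiv.Perm ι, y ∘ e = x := by
  refine ⟨(Equiv.ofInjective x hx).trans
    ((Equiv.setCongr h).trans (Equiv.ofInjective y hy).symm), funext fun i => ?_⟩
  exact Equiv.apply_ofInjective_symm hy ⟨x i, h ▸ Set.mem_range_self i⟩

lemma isOpen_setOf_injective {ι X : Type*} [Finite ι] [TopologicalSpace X] [T2Space X] :
    IsOpen {x : ι → X | Function.Injective x} := by
  have h : {x : ι → X | Function.Injective x} = ⋂ (i) (j) (_ : i ≠ j), {x | x i ≠ x j} := by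
    ext x
    simp only [Set.mem_ofPred_eq, Set.mem_iInter, Function.Injective]
    grind
  rw [h]
  exact isOpen_iInter_of_finite fun i => isOpen_iInter_of_finite fun j =>
    isOpen_iInter_of_finite fun _ => isOpen_ne_fun (continuous_apply i) (continuous_apply j)

/-- Permutations act on ordered configurations by relabelling the points. -/
instance : MulAction (Equiv.Perm (Fin 3)) Conf where
  smul g x := ⟨fun i => x.1 (g⁻¹ i), x.2.comp (g⁻¹).injective⟩
  one_smul _ := rfl
  mul_smul g h x := by
    refine Subtype.ext (funext fun i => ?_)
    change x.1 ((g * h)⁻¹ i) = x.1 (h⁻¹ (g⁻¹ i))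
    rw [mul_inv_rev, Equiv.Perm.mul_apply]

lemma conf_smul_apply (g : Equiv.Perm (Fin 3)) (x : Conf) (i : Fin 3) :
    (g • x).1 i = x.1 (g⁻¹ i) := rfl

lemma continuous_conf_apply (i : Fin 3) : Continuous fun x : Conf => x.1 i :=
  (continuous_apply i).comp continuous_subtype_val

instance : ContinuousConstSMul (Equiv.Perm (Fin 3)) Conf where
  continuous_const_smul g :=
    Continuous.subtype_mk (continuous_pi fun i => continuous_conf_apply (g⁻¹ i)) _

instance : IsCancelSMul (Equiv.Perm (Fin 3)) Conf :=
  isCancelSMul_iff_eq_one_of_smul_eq.2 fun _ x h => inv_eq_one.1 <| Equiv.ext fun i =>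
    x.2 (congrFun (congrArg Subtype.val h) i)

instance : LocallyCompactSpace Conf :=
  isOpen_setOf_injective.isOpenEmbedding_subtypeVal.locallyCompactSpace

lemma forgetOrder_eq_iff {x y : Conf} :
    forgetOrder x = forgetOrder y ↔ Set.range x.1 = Set.range y.1 :=
  Quotient.eq (r := confSetoid)

lemma forgetOrder_eq_iff_mem_orbit {x y : Conf} :
    forgetOrder x = forgetOrder y ↔ x ∈ MulAction.orbit (Equiv.Perm (Fin 3)) y := by
  rw [forgetOrder_eq_iff]
  constructor
  · intro h
    obtain ⟨e, he⟩ := exists_perm_comp_eq_of_range_eq x.2 y.2 h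
    refine ⟨e⁻¹, Subtype.ext (funext fun i => ?_)⟩
    rw [conf_smul_apply, inv_inv, ← he, Function.comp_apply]
  · rintro ⟨g, rfl⟩
    exact (g⁻¹).surjective.range_comp y.1

lemma forgetOrder_smul (g : Equiv.Perm (Fin 3)) (x : Conf) :
    forgetOrder (g • x) = forgetOrder x :=
  forgetOrder_eq_iff_mem_orbit.2 ⟨g, rfl⟩

lemma isQuotientCoveringMap_forgetOrder :
    IsQuotientCoveringMap forgetOrder (Equiv.Perm (Fin 3)) :=
  isQuotientMap_quot_mk.isQuotientCoveringMap_of_properlyDiscontinuousSMul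
    forgetOrder_eq_iff_mem_orbit

/-- The pure braid group, with the product `x * y` being `x` followed by `y`. -/
abbrev PureBraidGroup : Type := (FundamentalGroup Conf basePoint)ᵐᵒᵖ

/-- The class of a geometric pure braid in the pure braid group. -/
def PureBraid.toPure (b : PureBraid) : PureBraidGroup :=
  MulOpposite.op (FundamentalGroup.fromPath (Path.Homotopic.Quotient.mk b))

/-- The inclusion of the pure braid group in the braid group. -/
def pureToBraid : PureBraidGroup →* BraidGroup :=
  MonoidHom.op (FundamentalGroup.map forgetOrder basePoint)

lemma pureToBraid_toPure (b : PureBraid) : pureToBraid b.toPure = b.toBraid := rfl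

lemma pureToBraid_injective : Function.Injective pureToBraid := fun _ _ h =>
  MulOpposite.unop_injective
    (isQuotientCoveringMap_forgetOrder.isCoveringMap.injective_path_homotopic_map
      basePoint basePoint (MulOpposite.op_injective h))

lemma toPure_trans (b b' : PureBraid) : PureBraid.toPure (b.trans b') = b.toPure * b'.toPure := rfl

lemma toPure_symm (b : PureBraid) : PureBraid.toPure (Path.symm b) = b.toPure⁻¹ := rfl

lemma toPure_eq_iff {b b' : PureBraid} : b.toPure = b'.toPure ↔ Path.Homotopic b b' :=
  ⟨fun h => Path.Homotopic.Quotient.exact (MulOpposite.op_injective h),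
    fun h => MulOpposite.unop_injective (Path.Homotopic.Quotient.eq.2 h)⟩

lemma toBraid_eq_iff {b b' : PureBraid} : b.toBraid = b'.toBraid ↔ Path.Homotopic b b' := by
  rw [← pureToBraid_toPure, ← pureToBraid_toPure, pureToBraid_injective.eq_iff, toPure_eq_iff]

lemma braidOfLoop_trans (p q : Path (forgetOrder basePoint) (forgetOrder basePoint)) :
    braidOfLoop (p.trans q) = braidOfLoop p * braidOfLoop q := rfl

lemma braidOfLoop_eq {p q : Path (forgetOrder basePoint) (forgetOrder basePoint)}
    (h : Path.Homotopic p q) : braidOfLoop p = braidOfLoop q :=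
  MulOpposite.unop_injective (Path.Homotopic.Quotient.eq.2 h)

/-! ### Half twists and full twists of the strands -/

lemma forall_fin_three {P : Fin 3 → Prop} (h0 : P 0) (h1 : P 1) (h2 : P 2) (i : Fin 3) : P i := by
  fin_cases i
  exacts [h0, h1, h2]

lemma lt_cases_fin_three {i j : Fin 3} (h : i < j) :
    (i = 0 ∧ j = 1) ∨ (i = 0 ∧ j = 2) ∨ (i = 1 ∧ j = 2) := by
  revert i j
  decide

lemma conf_ext {x y : Conf} (h0 : x.1 0 = y.1 0) (h1 : x.1 1 = y.1 1) (h2 : x.1 2 = y.1 2) :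
    x = y :=
  Subtype.ext (funext (forall_fin_three h0 h1 h2))

lemma basePoint_zero : basePoint.1 0 = -4 := rfl
lemma basePoint_one : basePoint.1 1 = 0 := rfl
lemma basePoint_two : basePoint.1 2 = 4 := rfl

lemma exp_pi_mul_add_one (t : ℝ) : Complex.exp ((Real.pi * (t + 1) : ℝ) * Complex.I) =
    -Complex.exp ((Real.pi * t : ℝ) * Complex.I) := by
  rw [mul_add, mul_one, Complex.ofReal_add, add_mul, Complex.exp_add, Complex.exp_pi_mul_I,
    mul_neg_one]

lemma exp_pi_mul_zero : Complex.exp ((Real.pi * (0 : ℝ) : ℝ) * Complex.I) = 1 := by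
  rw [mul_zero, Complex.ofReal_zero, zero_mul, Complex.exp_zero]

lemma halfTwist₁_zero : halfTwist₁ 0 = basePoint := by
  refine conf_ext ?_ ?_ rfl <;>
    simp only [halfTwist₁, exp_pi_mul_zero, basePoint, Matrix.cons_val] <;> ring

lemma halfTwist₂_zero : halfTwist₂ 0 = basePoint := by
  refine conf_ext rfl ?_ ?_ <;>
    simp only [halfTwist₂, exp_pi_mul_zero, basePoint, Matrix.cons_val] <;> ring

lemma halfTwist₁_add_one (t : ℝ) :
    halfTwist₁ (t + 1) = Equiv.swap (0 : Fin 3) 1 • halfTwist₁ t := by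
  refine conf_ext ?_ ?_ rfl
  · change -2 - 2 * Complex.exp _ = -2 + 2 * Complex.exp _
    rw [exp_pi_mul_add_one]
    ring
  · change -2 + 2 * Complex.exp _ = -2 - 2 * Complex.exp _
    rw [exp_pi_mul_add_one]
    ring

lemma halfTwist₂_add_one (t : ℝ) :
    halfTwist₂ (t + 1) = Equiv.swap (1 : Fin 3) 2 • halfTwist₂ t := by
  refine conf_ext rfl ?_ ?_
  · change 2 - 2 * Complex.exp _ = 2 + 2 * Complex.exp _
    rw [exp_pi_mul_add_one]
    ring
  · change 2 + 2 * Complex.exp _ = 2 - 2 * Complex.exp _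
    rw [exp_pi_mul_add_one]
    ring

/-- The base configuration rotated about the origin by the angle `π t`. -/
def rotation (t : ℝ) : Conf :=
  ⟨fun i => Complex.exp ((Real.pi * t : ℝ) * Complex.I) * basePoint.1 i,
    fun _ _ h => basePoint.2 (mul_left_cancel₀ (Complex.exp_ne_zero _) h)⟩

lemma rotation_apply (t : ℝ) (i : Fin 3) :
    (rotation t).1 i = Complex.exp ((Real.pi * t : ℝ) * Complex.I) * basePoint.1 i := rfl

lemma continuous_rotation : Continuous rotation :=
  Continuous.subtype_mk (continuous_pi fun i => by fun_prop) _

lemma rotation_zero : rotation 0 = basePoint :=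
  Subtype.ext (funext fun i => by rw [rotation_apply, exp_pi_mul_zero, one_mul])

lemma rotation_add_one (t : ℝ) : rotation (t + 1) = Equiv.swap (0 : Fin 3) 2 • rotation t := by
  refine conf_ext ?_ ?_ ?_ <;>
    simp only [conf_smul_apply, Equiv.swap_inv, Equiv.swap_apply_left, Equiv.swap_apply_right,
      rotation_apply, exp_pi_mul_add_one]
  · simp only [basePoint_zero, basePoint_two, neg_mul_neg]
  · rw [Equiv.swap_apply_of_ne_of_ne (by decide) (by decide), basePoint_one, mul_zero,
      mul_zero]
  · simp only [basePoint_zero, basePoint_two, neg_mul, mul_neg]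

section TwoTurns

variable {f : ℝ → Conf} {g : Equiv.Perm (Fin 3)}

/-- The pure braid traced by two turns of a motion `f`, each of which permutes the points of the
base configuration by the same involution. -/
def twoTurns (hf : Continuous f) (h0 : f 0 = basePoint) (hg : g * g = 1)
    (hfg : ∀ t, f (t + 1) = g • f t) : PureBraid where
  toFun t := f (2 * t)
  continuous_toFun := hf.comp (by fun_prop)
  source' := by rw [Set.Icc.coe_zero, mul_zero, h0]
  target' := by
    rw [Set.Icc.coe_one, mul_one, ← one_add_one_eq_two, hfg, ← zero_add (1 : ℝ), hfg, smul_smul,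
      hg, one_smul, h0]

lemma toBraid_twoTurns (hf : Continuous f) (h0 : f 0 = basePoint) (hg : g * g = 1)
    (hfg : ∀ t, f (t + 1) = g • f t) {q : Path (forgetOrder basePoint) (forgetOrder basePoint)}
    (hq : ∀ t : I, q t = forgetOrder (f t)) :
    (twoTurns hf h0 hg hfg).toBraid = braidOfLoop q ^ 2 := by
  suffices h : Path.map (twoTurns hf h0 hg hfg) forgetOrder.continuous = q.trans q by
    rw [PureBraid.toBraid, h, braidOfLoop_trans, pow_two]
  ext t
  rw [Path.trans_apply]
  split_ifs with h
  · rw [hq]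
    rfl
  · rw [hq]
    change forgetOrder (f (2 * t)) = forgetOrder (f (2 * t - 1))
    rw [← forgetOrder_smul g (f (2 * t - 1)), ← hfg, sub_add_cancel]

end TwoTurns

/-- The pure braid in which the first two points make a full counterclockwise rotation. -/
def fullTwist₁ : PureBraid :=
  twoTurns continuous_halfTwist₁ halfTwist₁_zero (Equiv.swap_mul_self _ _) halfTwist₁_add_one

/-- The pure braid in which the last two points make a full counterclockwise rotation. -/
def fullTwist₂ : PureBraid :=
  twoTurns continuous_halfTwist₂ halfTwist₂_zero (Equiv.swap_mul_self _ _) halfTwist₂_add_one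

/-- The pure braid in which all three points make a full counterclockwise rotation. -/
def fullTwist : PureBraid :=
  twoTurns continuous_rotation rotation_zero (Equiv.swap_mul_self _ _) rotation_add_one

lemma toBraid_fullTwist₁ : fullTwist₁.toBraid = σ₁ ^ 2 :=
  toBraid_twoTurns _ _ _ _ fun _ => rfl

lemma toBraid_fullTwist₂ : fullTwist₂.toBraid = σ₂ ^ 2 :=
  toBraid_twoTurns _ _ _ _ fun _ => rfl

/-! ### The half rotation of three strands -/

lemma segment_ne_zero {c a b : ℂ} (s : I) (ha : 0 ≤ (c * a).re) (hb : 0 < (c * b).re)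
    (ha' : a ≠ 0) : (1 - s : ℂ) * a + s * b ≠ 0 := by
  intro h
  have hre : (1 - s : ℝ) * (c * a).re + s * (c * b).re = 0 := by
    have h' : ((1 - s : ℝ) : ℂ) * (c * a) + ((s : ℝ) : ℂ) * (c * b) = 0 := by
      push_cast
      linear_combination c * h
    simpa only [Complex.add_re, Complex.re_ofReal_mul, Complex.zero_re] using
      congrArg Complex.re h'
  have hs : (s : ℝ) = 0 := by
    have h1 : 0 ≤ (1 - s : ℝ) * (c * a).re := mul_nonneg (sub_nonneg.2 s.2.2) ha
    have h2 : 0 ≤ (s : ℝ) * (c * b).re := mul_nonneg s.2.1 hb.le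
    exact (mul_eq_zero.1 (by linarith)).resolve_right hb.ne'
  rw [hs, Complex.ofReal_zero, sub_zero, one_mul, zero_mul, add_zero] at h
  exact ha' h

/-- For any two indices the difference vectors of the two configurations lie in a common half-plane
(closed for `x`, open for `y`), so that the points stay distinct on the segment from `x` to `y`. -/
def InCommonHalfPlane (x y : Conf) : Prop :=
  ∀ i j, i < j → ∃ c : ℂ, 0 ≤ (c * (x.1 j - x.1 i)).re ∧ 0 < (c * (y.1 j - y.1 i)).re

lemma InCommonHalfPlane.refl (x : Conf) : InCommonHalfPlane x x := by
  intro i j hij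
  have h : 0 < Complex.normSq (x.1 j - x.1 i) :=
    Complex.normSq_pos.2 (sub_ne_zero.2 (x.2.ne hij.ne'))
  refine ⟨starRingEnd ℂ (x.1 j - x.1 i), ?_⟩
  rw [← Complex.normSq_eq_conj_mul_self, Complex.ofReal_re]
  exact ⟨h.le, h⟩

lemma InCommonHalfPlane.injective_segment {x y : Conf} (h : InCommonHalfPlane x y) (s : I) :
    Function.Injective fun i => (1 - s : ℂ) * x.1 i + s * y.1 i := by
  have hlt : ∀ i j, i < j →
      (1 - s : ℂ) * x.1 i + s * y.1 i ≠ (1 - s : ℂ) * x.1 j + s * y.1 j := by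
    intro i j hij heq
    obtain ⟨c, hx, hy⟩ := h i j hij
    exact segment_ne_zero s hx hy (sub_ne_zero.2 (x.2.ne hij.ne')) (by linear_combination -heq)
  intro i j hij
  by_contra hne
  rcases lt_or_gt_of_ne hne with h' | h'
  exacts [hlt i j h' hij, hlt j i h' hij.symm]

lemma homotopic_of_inCommonHalfPlane {x y : Conf} (p q : Path x y)
    (h : ∀ t, InCommonHalfPlane (p t) (q t)) : Path.Homotopic p q := by
  have hcont (r : Path x y) (i : Fin 3) : Continuous fun st : I × I => (r st.2).1 i :=
    (continuous_conf_apply i).comp (r.continuous.comp continuous_snd)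
  have hs : Continuous fun st : I × I => ((st.1 : ℝ) : ℂ) := by fun_prop
  refine ⟨{
    toFun := fun st => ⟨_, (h st.2).injective_segment st.1⟩
    continuous_toFun := Continuous.subtype_mk (continuous_pi fun i =>
      ((continuous_const.sub hs).mul (hcont p i)).add (hs.mul (hcont q i))) _
    map_zero_left := fun t => Subtype.ext (funext fun i => by simp)
    map_one_left := fun t => Subtype.ext (funext fun i => by simp)
    prop' := ?_ }⟩
  rintro s t (rfl | rfl) <;> exact Subtype.ext (funext fun i => by simp [← add_mul])

lemma re_exp_pi (t : ℝ) :
    (Complex.exp ((Real.pi * t : ℝ) * Complex.I)).re = Real.cos (Real.pi * t) :=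
  Complex.exp_ofReal_mul_I_re _

lemma im_exp_pi (t : ℝ) :
    (Complex.exp ((Real.pi * t : ℝ) * Complex.I)).im = Real.sin (Real.pi * t) :=
  Complex.exp_ofReal_mul_I_im _

lemma sin_pi_nonneg {t : ℝ} (h0 : 0 ≤ t) (h1 : t ≤ 1) : 0 ≤ Real.sin (Real.pi * t) :=
  Real.sin_nonneg_of_nonneg_of_le_pi (by positivity) (by nlinarith [Real.pi_pos])

lemma sin_pi_pos {t : ℝ} (h0 : 0 < t) (h1 : t < 1) : 0 < Real.sin (Real.pi * t) :=
  Real.sin_pos_of_pos_of_lt_pi (by positivity) (by nlinarith [Real.pi_pos])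

lemma re_mul_rotation_sub_pos {c : ℂ} {t : ℝ} {i j : Fin 3} (hij : i < j)
    (hc : 0 < (c * Complex.exp ((Real.pi * t : ℝ) * Complex.I)).re) :
    0 < (c * ((rotation t).1 j - (rotation t).1 i)).re := by
  obtain ⟨k, hk0, hk⟩ : ∃ k : ℝ, 0 < k ∧ basePoint.1 j - basePoint.1 i = k := by
    rcases lt_cases_fin_three hij with ⟨rfl, rfl⟩ | ⟨rfl, rfl⟩ | ⟨rfl, rfl⟩
    · exact ⟨4, by norm_num, by norm_num [basePoint_zero, basePoint_one]⟩
    · exact ⟨8, by norm_num, by norm_num [basePoint_zero, basePoint_two]⟩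
    · exact ⟨4, by norm_num, by norm_num [basePoint_one, basePoint_two]⟩
  have h : c * ((rotation t).1 j - (rotation t).1 i) =
      (k : ℂ) * (c * Complex.exp ((Real.pi * t : ℝ) * Complex.I)) := by
    rw [rotation_apply, rotation_apply, ← hk]
    ring
  rw [h, Complex.re_ofReal_mul]
  exact mul_pos hk0 hc

section CommonHalfPlane

variable {x : Conf} {t : ℝ} {i j : Fin 3}

lemma exists_halfPlane_of_im_nonneg (hij : i < j) (h0 : 0 < t) (h1 : t < 1)
    (h : 0 ≤ (x.1 j - x.1 i).im) :
    ∃ c : ℂ, 0 ≤ (c * (x.1 j - x.1 i)).re ∧ 0 < (c * ((rotation t).1 j - (rotation t).1 i)).re := by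
  have hre (z : ℂ) : (-Complex.I * z).re = z.im := by
    rw [neg_mul, Complex.neg_re, Complex.I_mul_re, neg_neg]
  refine ⟨-Complex.I, by rwa [hre], re_mul_rotation_sub_pos hij ?_⟩
  rw [hre, im_exp_pi]
  exact sin_pi_pos h0 h1

lemma exists_halfPlane_of_re_nonneg (hij : i < j) (h0 : 0 < t) (h1 : t < 1 / 2)
    (h : 0 ≤ (x.1 j - x.1 i).re) :
    ∃ c : ℂ, 0 ≤ (c * (x.1 j - x.1 i)).re ∧ 0 < (c * ((rotation t).1 j - (rotation t).1 i)).re := by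
  refine ⟨1, by rwa [one_mul], re_mul_rotation_sub_pos hij ?_⟩
  rw [one_mul, re_exp_pi]
  exact Real.cos_pos_of_mem_Ioo ⟨by nlinarith [Real.pi_pos], by nlinarith [Real.pi_pos]⟩

lemma exists_halfPlane_of_re_nonpos (hij : i < j) (h0 : 1 / 2 < t) (h1 : t < 1)
    (h : (x.1 j - x.1 i).re ≤ 0) :
    ∃ c : ℂ, 0 ≤ (c * (x.1 j - x.1 i)).re ∧ 0 < (c * ((rotation t).1 j - (rotation t).1 i)).re := by
  refine ⟨-1, by rwa [neg_one_mul, Complex.neg_re, neg_nonneg], re_mul_rotation_sub_pos hij ?_⟩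
  rw [neg_one_mul, Complex.neg_re, re_exp_pi, neg_pos]
  exact Real.cos_neg_of_pi_div_two_lt_of_lt (by nlinarith [Real.pi_pos])
    (by nlinarith [Real.pi_pos])

end CommonHalfPlane

lemma swap_smul_halfTwist₁ (t : ℝ) : (Equiv.swap (1 : Fin 3) 2 • halfTwist₁ t).1 =
    ![-2 - 2 * Complex.exp ((Real.pi * t : ℝ) * Complex.I), 4,
      -2 + 2 * Complex.exp ((Real.pi * t : ℝ) * Complex.I)] :=
  funext (forall_fin_three rfl rfl rfl)

lemma finRotate_inv_smul_halfTwist₂ (t : ℝ) : ((finRotate 3)⁻¹ • halfTwist₂ t).1 =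
    ![2 - 2 * Complex.exp ((Real.pi * t : ℝ) * Complex.I),
      2 + 2 * Complex.exp ((Real.pi * t : ℝ) * Complex.I), -4] :=
  funext (forall_fin_three rfl rfl rfl)

lemma halfTwist₂_apply (t : ℝ) : (halfTwist₂ t).1 =
    ![-4, 2 - 2 * Complex.exp ((Real.pi * t : ℝ) * Complex.I),
      2 + 2 * Complex.exp ((Real.pi * t : ℝ) * Complex.I)] := rfl

lemma inCommonHalfPlane_halfTwist₂ {r t : ℝ} (hr : r ∈ Set.Icc 0 1) (h0 : 0 < t)
    (h1 : t < 1 / 2) : InCommonHalfPlane (halfTwist₂ r) (rotation t) := by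
  have hsin := im_exp_pi r ▸ sin_pi_nonneg hr.1 hr.2
  have hcos := re_exp_pi r ▸ Real.cos_le_one (Real.pi * r)
  intro i j hij
  rcases lt_cases_fin_three hij with ⟨rfl, rfl⟩ | ⟨rfl, rfl⟩ | ⟨rfl, rfl⟩
  on_goal 1 => refine exists_halfPlane_of_re_nonneg hij h0 h1 ?_
  on_goal 2 => refine exists_halfPlane_of_im_nonneg hij h0 (by linarith) ?_
  on_goal 3 => refine exists_halfPlane_of_im_nonneg hij h0 (by linarith) ?_
  all_goals
    rw [halfTwist₂_apply]
    generalize Complex.exp ((Real.pi * r : ℝ) * Complex.I) = w at *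
    simp only [Matrix.cons_val]
    norm_num
    linarith

lemma inCommonHalfPlane_swap_smul_halfTwist₁ {r t : ℝ} (hr : r ∈ Set.Icc 0 1) (h0 : 0 < t)
    (h1 : t < 1) : InCommonHalfPlane (Equiv.swap (1 : Fin 3) 2 • halfTwist₁ r) (rotation t) := by
  have hsin := im_exp_pi r ▸ sin_pi_nonneg hr.1 hr.2
  intro i j hij
  refine exists_halfPlane_of_im_nonneg hij h0 h1 ?_
  rw [swap_smul_halfTwist₁]
  generalize Complex.exp ((Real.pi * r : ℝ) * Complex.I) = w at *
  rcases lt_cases_fin_three hij with ⟨rfl, rfl⟩ | ⟨rfl, rfl⟩ | ⟨rfl, rfl⟩ <;>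
    simp only [Matrix.cons_val] <;> norm_num <;> linarith

lemma inCommonHalfPlane_finRotate_inv_smul_halfTwist₂ {r t : ℝ} (hr : r ∈ Set.Icc 0 1)
    (h0 : 1 / 2 < t) (h1 : t < 1) :
    InCommonHalfPlane ((finRotate 3)⁻¹ • halfTwist₂ r) (rotation t) := by
  have hsin := im_exp_pi r ▸ sin_pi_nonneg hr.1 hr.2
  have hcos := re_exp_pi r ▸ Real.neg_one_le_cos (Real.pi * r)
  intro i j hij
  rcases lt_cases_fin_three hij with ⟨rfl, rfl⟩ | ⟨rfl, rfl⟩ | ⟨rfl, rfl⟩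
  on_goal 1 => refine exists_halfPlane_of_im_nonneg hij (by linarith) h1 ?_
  on_goal 2 => refine exists_halfPlane_of_im_nonneg hij (by linarith) h1 ?_
  on_goal 3 => refine exists_halfPlane_of_re_nonpos hij h0 h1 ?_
  all_goals
    rw [finRotate_inv_smul_halfTwist₂]
    generalize Complex.exp ((Real.pi * r : ℝ) * Complex.I) = w at *
    simp only [Matrix.cons_val]
    norm_num
    linarith

/-- The path traced by a continuous map of the line on the unit interval. -/
def unitPath {X : Type*} [TopologicalSpace X] {f : ℝ → X} (hf : Continuous f) :
    Path (f 0) (f 1) where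
  toFun t := f t
  continuous_toFun := hf.comp continuous_subtype_val
  source' := rfl
  target' := rfl

lemma swap_smul_halfTwist₁_zero :
    Equiv.swap (1 : Fin 3) 2 • halfTwist₁ 0 = halfTwist₂ 1 := by
  rw [halfTwist₁_zero, ← zero_add (1 : ℝ), halfTwist₂_add_one, halfTwist₂_zero]

lemma finRotate_inv_smul_halfTwist₂_zero :
    (finRotate 3)⁻¹ • halfTwist₂ 0 = Equiv.swap (1 : Fin 3) 2 • halfTwist₁ 1 := by
  rw [halfTwist₂_zero, ← zero_add (1 : ℝ), halfTwist₁_add_one, halfTwist₁_zero, smul_smul]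
  congr 1
  decide

lemma finRotate_inv_smul_halfTwist₂_one : (finRotate 3)⁻¹ • halfTwist₂ 1 = rotation 1 := by
  rw [← zero_add (1 : ℝ), halfTwist₂_add_one, halfTwist₂_zero, rotation_add_one, rotation_zero,
    smul_smul]
  congr 1
  decide

/-- The path of configurations which lifts `σ₂ * σ₁ * σ₂` to ordered configurations. -/
def threeHalfTwists : Path basePoint (rotation 1) :=
  (((unitPath continuous_halfTwist₂).cast halfTwist₂_zero.symm rfl).trans
    ((unitPath (continuous_halfTwist₁.const_smul (Equiv.swap (1 : Fin 3) 2))).cast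
      swap_smul_halfTwist₁_zero.symm rfl)).trans
    ((unitPath (continuous_halfTwist₂.const_smul (finRotate 3)⁻¹)).cast
      finRotate_inv_smul_halfTwist₂_zero.symm finRotate_inv_smul_halfTwist₂_one.symm)

/-- The half rotation of the three points about the origin. -/
def halfRotation : Path basePoint (rotation 1) :=
  (unitPath continuous_rotation).cast rotation_zero.symm rfl

lemma homotopic_halfRotation : Path.Homotopic threeHalfTwists halfRotation := by
  refine homotopic_of_inCommonHalfPlane _ _ fun t => ?_
  rcases eq_or_lt_of_le t.2.1 with h0 | h0
  · obtain rfl : t = 0 := Subtype.ext h0.symm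
    rw [Path.source, Path.source]
    exact .refl _
  rcases eq_or_lt_of_le t.2.2 with h1 | h1
  · obtain rfl : t = 1 := Subtype.ext h1
    rw [Path.target, Path.target]
    exact .refl _
  rw [threeHalfTwists, Path.trans_apply]
  split_ifs with hhalf
  · rw [Path.trans_apply]
    split_ifs with hquarter
    · have hquarter' : (2 * t : ℝ) ≤ 1 / 2 := hquarter
      exact inCommonHalfPlane_halfTwist₂ (unitInterval.mul_pos_mem_iff two_pos |>.2
        ⟨by positivity, hquarter'⟩) h0 (by linarith)
    · exact inCommonHalfPlane_swap_smul_halfTwist₁ (unitInterval.two_mul_sub_one_mem_iff.2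
        ⟨(not_le.1 hquarter).le, by linarith⟩) h0 h1
  · exact inCommonHalfPlane_finRotate_inv_smul_halfTwist₂ (unitInterval.two_mul_sub_one_mem_iff.2
      ⟨(not_le.1 hhalf).le, h1.le⟩) (not_le.1 hhalf) h1

lemma toBraid_fullTwist : fullTwist.toBraid = (σ₂ * σ₁ * σ₂) ^ 2 := by
  obtain ⟨q₁, hq₁, hσ₁⟩ : ∃ q : Path (forgetOrder basePoint) (forgetOrder basePoint),
    (∀ t : I, q t = forgetOrder (halfTwist₁ t)) ∧ σ₁ = braidOfLoop q := ⟨_, fun _ => rfl, rfl⟩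
  obtain ⟨q₂, hq₂, hσ₂⟩ : ∃ q : Path (forgetOrder basePoint) (forgetOrder basePoint),
    (∀ t : I, q t = forgetOrder (halfTwist₂ t)) ∧ σ₂ = braidOfLoop q := ⟨_, fun _ => rfl, rfl⟩
  have hopp : forgetOrder basePoint = forgetOrder (rotation 1) := by
    rw [← zero_add (1 : ℝ), rotation_add_one, forgetOrder_smul, rotation_zero]
  have hleft : (threeHalfTwists.map forgetOrder.continuous).cast rfl hopp =
      (q₂.trans q₁).trans q₂ := by
    ext t
    rw [Path.cast_coe, Path.map_coe, Function.comp_apply, threeHalfTwists]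
    simp only [Path.trans_apply]
    split_ifs
    · exact (hq₂ _).symm
    · exact (forgetOrder_smul _ _).trans (hq₁ _).symm
    · exact (forgetOrder_smul _ _).trans (hq₂ _).symm
  have hhom := (homotopic_halfRotation.map forgetOrder).pathCast rfl hopp
  rw [hleft] at hhom
  rw [fullTwist, toBraid_twoTurns _ _ _ _
    (q := (halfRotation.map forgetOrder.continuous).cast rfl hopp) fun _ => rfl,
    ← braidOfLoop_eq hhom, braidOfLoop_trans, braidOfLoop_trans, hσ₁, hσ₂]

/-! ### Motions of the plane that move the holes rigidly -/

/-- A motion of the plane, parametrized by the time interval `[0, 1]` and constant outside of it,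
that starts at the identity, has support in the disk of radius `9`, moves the disks of radius `3/2`
about the centres of the holes rigidly, and brings them back to their places at the end, after
`framing i` full rotations. -/
structure Motion where
  toHomeo : ℝ → ℂ ≃ₜ ℂ
  angle : Fin 3 → ℝ → ℝ
  framing : Fin 3 → ℤ
  continuous_toHomeo : Continuous fun p : ℝ × ℂ => toHomeo p.1 p.2
  continuous_angle : ∀ i, Continuous (angle i)
  start : ∀ t ≤ 0, ∀ z, toHomeo t z = z
  finish : ∀ t, 1 ≤ t → ∀ z, toHomeo t z = toHomeo 1 z
  angle_start : ∀ i, ∀ t ≤ 0, angle i t = 0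
  angle_finish : ∀ i t, 1 ≤ t → angle i t = framing i * (2 * Real.pi)
  outer : ∀ t z, 9 ≤ ‖z‖ → toHomeo t z = z
  rigid : ∀ t i z, ‖z - basePoint.1 i‖ ≤ 3 / 2 → toHomeo t z =
    toHomeo t (basePoint.1 i) + Complex.exp (angle i t * Complex.I) * (z - basePoint.1 i)
  closed : ∀ i, toHomeo 1 (basePoint.1 i) = basePoint.1 i

lemma exp_int_mul_two_pi (n : ℤ) : Complex.exp ((n * (2 * Real.pi) : ℝ) * Complex.I) = 1 := by
  rw [Complex.exp_eq_one_iff]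
  exact ⟨n, by push_cast; ring⟩

namespace Motion

lemma finish_disk (m : Motion) {i : Fin 3} {z : ℂ} (hz : ‖z - basePoint.1 i‖ ≤ 3 / 2) :
    m.toHomeo 1 z = z := by
  rw [m.rigid 1 i z hz, m.closed, m.angle_finish i 1 le_rfl, exp_int_mul_two_pi]
  ring

/-- The pure braid traced by the centres of the holes. -/
def trace (m : Motion) : PureBraid where
  toFun t := ⟨fun i => m.toHomeo t (basePoint.1 i), (m.toHomeo t).injective.comp basePoint.2⟩
  continuous_toFun := Continuous.subtype_mk (continuous_pi fun _ =>
    m.continuous_toHomeo.comp (continuous_subtype_val.prodMk continuous_const)) _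
  source' := Subtype.ext (funext fun _ => m.start _ le_rfl _)
  target' := Subtype.ext (funext fun i => m.closed i)

lemma trace_apply (m : Motion) (t : I) (i : Fin 3) :
    (m.trace t).1 i = m.toHomeo t (basePoint.1 i) := rfl

/-- The motion that does not move. -/
def still : Motion where
  toHomeo _ := Homeomorph.refl ℂ
  angle _ _ := 0
  framing _ := 0
  continuous_toHomeo := continuous_snd
  continuous_angle _ := continuous_const
  start _ _ _ := rfl
  finish _ _ _ := rfl
  angle_start _ _ _ := rfl
  angle_finish _ _ _ := by rw [Int.cast_zero, zero_mul]
  outer _ _ _ := rfl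
  rigid _ _ _ _ := by simp
  closed _ := rfl

/-- First perform the motion `m`, then the motion `m'`. -/
def concat (m m' : Motion) : Motion where
  toHomeo t := (m.toHomeo (2 * t)).trans (m'.toHomeo (2 * t - 1))
  angle i t := m.angle i (2 * t) + m'.angle i (2 * t - 1)
  framing i := m.framing i + m'.framing i
  continuous_toHomeo := by
    have h : Continuous fun p : ℝ × ℂ => m.toHomeo (2 * p.1) p.2 :=
      m.continuous_toHomeo.comp (f := fun p : ℝ × ℂ => (2 * p.1, p.2)) (by fun_prop)
    exact m'.continuous_toHomeo.comp
      ((by fun_prop : Continuous fun p : ℝ × ℂ => 2 * p.1 - 1).prodMk h)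
  continuous_angle i := by
    have h := m.continuous_angle i
    have h' := m'.continuous_angle i
    fun_prop
  start t ht z := by
    rw [Homeomorph.trans_apply, m.start _ (by linarith), m'.start _ (by linarith)]
  finish t ht z := by
    rw [Homeomorph.trans_apply, Homeomorph.trans_apply, m.finish _ (by linarith),
      m'.finish _ (by linarith), m.finish (2 * 1) (by norm_num),
      m'.finish (2 * 1 - 1) (by norm_num)]
  angle_start i t ht := by
    rw [m.angle_start i _ (by linarith), m'.angle_start i _ (by linarith), add_zero]
  angle_finish i t ht := by
    rw [m.angle_finish i _ (by linarith), m'.angle_finish i _ (by linarith)]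
    push_cast
    ring
  outer t z hz := by
    rw [Homeomorph.trans_apply, m.outer _ z hz, m'.outer _ z hz]
  rigid t i z hz := by
    rw [Homeomorph.trans_apply, Homeomorph.trans_apply]
    rcases le_total (2 * t) 1 with h | h
    · rw [m'.start _ (by linarith), m'.start _ (by linarith), m'.angle_start i _ (by linarith),
        add_zero]
      exact m.rigid _ i z hz
    · rw [m.finish _ h z, m.finish _ h, m.closed, m.finish_disk hz, m.angle_finish i _ h,
        Complex.ofReal_add, add_mul, Complex.exp_add, exp_int_mul_two_pi, one_mul]
      exact m'.rigid _ i z hz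
  closed i := by
    rw [Homeomorph.trans_apply, m.finish _ (by norm_num), m.closed, m'.finish _ (by norm_num),
      m'.closed]

lemma trace_concat (m m' : Motion) : (m.concat m').trace = m.trace.trans m'.trace := by
  refine Path.ext (funext fun t => Subtype.ext (funext fun i => ?_))
  rw [trace_apply, Path.trans_apply]
  change m'.toHomeo (2 * t - 1) (m.toHomeo (2 * t) (basePoint.1 i)) = _
  split_ifs with h
  · exact m'.start _ (by linarith) _
  · rw [m.finish _ (by linarith), m.closed]
    rfl

/-- Perform the motion `m` backwards. -/
def reverse (m : Motion) : Motion where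
  toHomeo t := (m.toHomeo 1).symm.trans (m.toHomeo (1 - t))
  angle i t := m.angle i (1 - t) - m.framing i * (2 * Real.pi)
  framing i := -m.framing i
  continuous_toHomeo := by
    exact m.continuous_toHomeo.comp ((by fun_prop : Continuous fun p : ℝ × ℂ => 1 - p.1).prodMk
      ((m.toHomeo 1).symm.continuous.comp continuous_snd))
  continuous_angle i := by
    have h := m.continuous_angle i
    fun_prop
  start t ht z := by
    rw [Homeomorph.trans_apply, m.finish _ (by linarith), Homeomorph.apply_symm_apply]
  finish t ht z := by
    rw [Homeomorph.trans_apply, Homeomorph.trans_apply, m.start _ (by linarith),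
      m.start _ (by linarith)]
  angle_start i t ht := by rw [m.angle_finish i _ (by linarith), sub_self]
  angle_finish i t ht := by
    rw [m.angle_start i _ (by linarith)]
    push_cast
    ring
  outer t z hz := by
    have h : (m.toHomeo 1).symm z = z := (Homeomorph.symm_apply_eq _).2 (m.outer 1 z hz).symm
    rw [Homeomorph.trans_apply, h, m.outer _ z hz]
  rigid t i z hz := by
    have h : (m.toHomeo 1).symm z = z := (Homeomorph.symm_apply_eq _).2 (m.finish_disk hz).symm
    have h' : (m.toHomeo 1).symm (basePoint.1 i) = basePoint.1 i :=
      (Homeomorph.symm_apply_eq _).2 (m.closed i).symm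
    rw [Homeomorph.trans_apply, Homeomorph.trans_apply, h, h', Complex.ofReal_sub, sub_mul,
      Complex.exp_sub, exp_int_mul_two_pi, div_one]
    exact m.rigid _ i z hz
  closed i := by
    rw [Homeomorph.trans_apply, m.start _ (by norm_num), Homeomorph.symm_apply_eq, m.closed]

lemma trace_reverse (m : Motion) : m.reverse.trace = m.trace.symm := by
  refine Path.ext (funext fun t => Subtype.ext (funext fun i => ?_))
  change m.toHomeo (1 - t) ((m.toHomeo 1).symm (basePoint.1 i)) =
    m.toHomeo (unitInterval.symm t) (basePoint.1 i)
  rw [(Homeomorph.symm_apply_eq _).2 (m.closed i).symm]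
  rfl

/-- The final position of the motion restricts to the homeomorphism `φ` of the page. -/
def EndsAt (m : Motion) (φ : RelHomeo fourHoledSphere) : Prop :=
  ∀ x : fourHoledSphere, m.toHomeo 1 x = (φ : fourHoledSphere ≃ₜ fourHoledSphere) x

end Motion

/-- The triples of a homeomorphism of the page, a pure braid and a triple of framings that belong to
a common motion. -/
def realized : Subgroup ((RelHomeo fourHoledSphere)ᵐᵒᵖ × PureBraidGroup ×
    Multiplicative (Fin 3 → ℤ)) where
  carrier := {p | ∃ m : Motion, m.EndsAt p.1.unop ∧ m.trace.toPure = p.2.1 ∧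
    m.framing = p.2.2.toAdd}
  one_mem' := ⟨Motion.still, fun _ => rfl, rfl, rfl⟩
  mul_mem' := by
    rintro ⟨φ, x, n⟩ ⟨φ', x', n'⟩ ⟨m, h1, h2, h3⟩ ⟨m', h1', h2', h3'⟩
    refine ⟨m.concat m', fun z => ?_, ?_, ?_⟩
    · change m'.toHomeo (2 * 1 - 1) (m.toHomeo (2 * 1) z) = _
      rw [m.finish _ (by norm_num), m'.finish _ (by norm_num), h1, h1']
      rfl
    · rw [Motion.trace_concat, toPure_trans, h2, h2']
      rfl
    · change m.framing + m'.framing = _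
      rw [h3, h3']
      rfl
  inv_mem' := by
    rintro ⟨φ, x, n⟩ ⟨m, h1, h2, h3⟩
    refine ⟨m.reverse, fun z => ?_, ?_, ?_⟩
    · change m.toHomeo (1 - 1) ((m.toHomeo 1).symm z) = _
      rw [m.start _ (by norm_num), Homeomorph.symm_apply_eq]
      change (z : ℂ) = m.toHomeo 1 ((φ.unop⁻¹ : RelHomeo fourHoledSphere).1 z)
      rw [h1]
      change (z : ℂ) = (φ.unop.1 (φ.unop.1.symm z) : fourHoledSphere)
      rw [Homeomorph.apply_symm_apply]
    · rw [Motion.trace_reverse, toPure_symm, h2]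
      rfl
    · change -m.framing = _
      rw [h3]
      rfl

/-! ### Motions given by twists -/
lemma twistAngle_of_le {r₁ r₂ r : ℝ} (hr : r₁ < r₂) (h : r ≤ r₁) :
    twistAngle r₁ r₂ r = 2 * Real.pi := by
  have h3 : 1 ≤ (r₂ - r) / (r₂ - r₁) := by
    rw [le_div_iff₀ (sub_pos.2 hr)]
    linarith
  rw [twistAngle, min_eq_left h3, max_eq_right zero_le_one, mul_one]

lemma twistAngle_of_ge {r₁ r₂ r : ℝ} (hr : r₁ < r₂) (h : r₂ ≤ r) : twistAngle r₁ r₂ r = 0 := by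
  have h3 : (r₂ - r) / (r₂ - r₁) ≤ 0 :=
    div_nonpos_of_nonpos_of_nonneg (by linarith) (sub_pos.2 hr).le
  rw [twistAngle, min_eq_right (by linarith), max_eq_left h3, mul_zero]

lemma twistMap_inner {c : ℂ} {r₁ r₂ : ℝ} (s : ℝ) (hr : r₁ < r₂) {z : ℂ} (hz : ‖z - c‖ ≤ r₁) :
    twistMap c r₁ r₂ s z = c + (z - c) * Complex.exp ((s * (2 * Real.pi) : ℝ) * Complex.I) := by
  rw [twistMap, twistAngle_of_le hr hz]

lemma twistMap_outer {c : ℂ} {r₁ r₂ : ℝ} (s : ℝ) (hr : r₁ < r₂) {z : ℂ} (hz : r₂ ≤ ‖z - c‖) :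
    twistMap c r₁ r₂ s z = z := by
  rw [twistMap, twistAngle_of_ge hr hz]
  simp

lemma twistMap_zero (c : ℂ) (r₁ r₂ : ℝ) (z : ℂ) : twistMap c r₁ r₂ 0 z = z := by
  simp [twistMap]

/-- The twist map as a homeomorphism of the plane. -/
def twistHomeo (c : ℂ) (r₁ r₂ s : ℝ) : ℂ ≃ₜ ℂ where
  toFun := twistMap c r₁ r₂ s
  invFun := twistMap c r₁ r₂ (-s)
  left_inv := twistMap_twistMap c r₁ r₂ s
  right_inv z := by simpa using twistMap_twistMap c r₁ r₂ (-s) z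
  continuous_toFun := continuous_twistMap c r₁ r₂ s
  continuous_invFun := continuous_twistMap c r₁ r₂ (-s)

/-- The nearest point of the unit interval. -/
def clamp : ℝ → I := Set.projIcc 0 1 zero_le_one

@[fun_prop]
lemma continuous_clamp : Continuous clamp := continuous_projIcc

lemma clamp_of_nonpos {t : ℝ} (h : t ≤ 0) : clamp t = 0 := Set.projIcc_of_le_left _ h

lemma clamp_of_one_le {t : ℝ} (h : 1 ≤ t) : clamp t = 1 := Set.projIcc_of_right_le _ h

lemma clamp_coe (t : I) : clamp t = t := Set.projIcc_val _ t

/-- The circles about `c` with radii between `r₁` and `r₂` separate the holes with index in `J` from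
the other holes, keeping the distance `1 / 2` from the holes and `1` from the outer boundary. -/
structure Separates (c : ℂ) (r₁ r₂ : ℝ) (J : Finset (Fin 3)) : Prop where
  lt : r₁ < r₂
  norm_add_le : ‖c‖ + r₂ ≤ 9
  inner : ∀ i ∈ J, ‖basePoint.1 i - c‖ + 3 / 2 ≤ r₁
  outer : ∀ i ∉ J, r₂ + 3 / 2 ≤ ‖basePoint.1 i - c‖

namespace Separates

variable {c : ℂ} {r₁ r₂ : ℝ} {J : Finset (Fin 3)} (hJ : Separates c r₁ r₂ J)

include hJ

lemma twistMap_of_le_norm (s : ℝ) {z : ℂ} (hz : 9 ≤ ‖z‖) : twistMap c r₁ r₂ s z = z :=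
  twistMap_outer s hJ.lt (by linarith [norm_sub_norm_le z c, hJ.norm_add_le])

lemma twistMap_of_mem (s : ℝ) {i : Fin 3} (hi : i ∈ J) {z : ℂ}
    (hz : ‖z - basePoint.1 i‖ ≤ 3 / 2) :
    twistMap c r₁ r₂ s z = c + (z - c) * Complex.exp ((s * (2 * Real.pi) : ℝ) * Complex.I) :=
  twistMap_inner s hJ.lt
    (by linarith [norm_sub_le_norm_sub_add_norm_sub z (basePoint.1 i) c, hJ.inner i hi])

lemma twistMap_of_notMem (s : ℝ) {i : Fin 3} (hi : i ∉ J) {z : ℂ}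
    (hz : ‖z - basePoint.1 i‖ ≤ 3 / 2) : twistMap c r₁ r₂ s z = z := by
  rw [← norm_sub_rev] at hz
  exact twistMap_outer s hJ.lt
    (by linarith [norm_sub_le_norm_sub_add_norm_sub (basePoint.1 i) z c, hJ.outer i hi])

lemma twistMap_one_basePoint (i : Fin 3) :
    twistMap c r₁ r₂ 1 (basePoint.1 i) = basePoint.1 i := by
  refine twistMap_eq_self (Or.inl rfl) hJ.lt fun h => ?_
  by_cases hi : i ∈ J
  · linarith [hJ.inner i hi]
  · linarith [hJ.outer i hi]

/-- The motion that rotates the disk bounded by the separating circles by one full turn. -/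
def twistMotion : Motion where
  toHomeo t := twistHomeo c r₁ r₂ (clamp t)
  angle i t := clamp t * ((if i ∈ J then 1 else 0 : ℤ) * (2 * Real.pi))
  framing i := if i ∈ J then 1 else 0
  continuous_toHomeo := by
    change Continuous fun p : ℝ × ℂ => twistMap c r₁ r₂ (clamp p.1) p.2
    unfold twistMap twistAngle
    fun_prop
  continuous_angle i := by fun_prop
  start t ht z := by
    rw [clamp_of_nonpos ht]
    exact twistMap_zero c r₁ r₂ z
  finish t ht z := by rw [clamp_of_one_le ht, clamp_of_one_le le_rfl]
  angle_start i t ht := by rw [clamp_of_nonpos ht, Set.Icc.coe_zero, zero_mul]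
  angle_finish i t ht := by rw [clamp_of_one_le ht, Set.Icc.coe_one, one_mul]
  outer t z hz := hJ.twistMap_of_le_norm _ hz
  rigid t i z hz := by
    have hi0 : ‖basePoint.1 i - basePoint.1 i‖ ≤ 3 / 2 := by
      rw [sub_self, norm_zero]
      norm_num
    change twistMap c r₁ r₂ (clamp t) z = twistMap c r₁ r₂ (clamp t) _ + _
    by_cases hi : i ∈ J
    · rw [hJ.twistMap_of_mem _ hi hz, hJ.twistMap_of_mem _ hi hi0, if_pos hi, Int.cast_one, one_mul]
      ring
    · rw [hJ.twistMap_of_notMem _ hi hz, hJ.twistMap_of_notMem _ hi hi0, if_neg hi, Int.cast_zero,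
        zero_mul, mul_zero, Complex.ofReal_zero, zero_mul, Complex.exp_zero, one_mul,
        add_sub_cancel]
  closed i := by
    rw [clamp_of_one_le le_rfl]
    exact hJ.twistMap_one_basePoint i

lemma trace_twistMotion_apply (t : I) (i : Fin 3) :
    (hJ.twistMotion.trace t).1 i =
      if i ∈ J then
        c + (basePoint.1 i - c) * Complex.exp ((Real.pi * (2 * t) : ℝ) * Complex.I)
      else basePoint.1 i := by
  have hi0 : ‖basePoint.1 i - basePoint.1 i‖ ≤ 3 / 2 := by
    rw [sub_self, norm_zero]
    norm_num
  change twistMap c r₁ r₂ (clamp t) _ = _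
  rw [clamp_coe]
  split_ifs with hi
  · rw [hJ.twistMap_of_mem _ hi hi0, show (t * (2 * Real.pi) : ℝ) = Real.pi * (2 * t) by ring]
  · exact hJ.twistMap_of_notMem _ hi hi0

lemma twistMotion_endsAt
    (hS : ∀ z, r₁ < ‖z - c‖ → ‖z - c‖ < r₂ → z ∈ fourHoledSphere) :
    hJ.twistMotion.EndsAt (dehnTwist fourHoledSphere c r₁ r₂ hJ.lt hS) := fun x => by
  change twistMap c r₁ r₂ (clamp 1) x = twistMap c r₁ r₂ 1 x
  rw [clamp_of_one_le le_rfl, Set.Icc.coe_one]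

end Separates

/-! ### Dehn twists realized by motions -/

lemma mappingClass_eq_iff {S : Set ℂ} {f g : RelHomeo S} :
    mappingClass f = mappingClass g ↔ f⁻¹ * g ∈ IsotopicToId S := by
  rw [mappingClass, mappingClass, MulOpposite.op_inj, QuotientGroup.eq]

lemma mappingClass_eq_of_isotopicRel {S : Set ℂ} {f g : RelHomeo S} (h : IsotopicRel S f g) :
    mappingClass f = mappingClass g := by
  obtain ⟨F, hF, hF0, hF1⟩ := h
  rw [mappingClass_eq_iff]
  refine ⟨fun t => f⁻¹ * F t, ?_, ?_, congrArg (f⁻¹ * ·) hF1⟩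
  on_goal 2 => exact (congrArg (f⁻¹ * ·) hF0).trans (inv_mul_cancel f)
  exact (f⁻¹ : RelHomeo S).1.continuous.comp hF

lemma mappingClass_dehnTwist_eq {S : Set ℂ} {c : ℂ} {r₁ r₂ r₁' r₂' : ℝ} (hr : r₁ < r₂)
    (hr' : r₁' < r₂') (hS : ∀ z, min r₁ r₁' < ‖z - c‖ → ‖z - c‖ < max r₂ r₂' → z ∈ S) :
    mappingClass (dehnTwist S c r₁ r₂ hr fun z h h' =>
      hS z (min_lt_of_left_lt h) (lt_max_of_lt_left h')) =
    mappingClass (dehnTwist S c r₁' r₂' hr' fun z h h' =>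
      hS z (min_lt_of_right_lt h) (lt_max_of_lt_right h')) := by
  have hlt (t : I) : AffineMap.lineMap r₁ r₁' (t : ℝ) < AffineMap.lineMap r₂ r₂' (t : ℝ) :=
    lineMap_strict_mono_endpoints hr hr' t.2.1 t.2.2
  have hmin (t : I) : min r₁ r₁' ≤ AffineMap.lineMap r₁ r₁' (t : ℝ) := by
    simpa only [AffineMap.lineMap_same_apply] using lineMap_mono_endpoints
      (min_le_left r₁ r₁') (min_le_right r₁ r₁') t.2.1 t.2.2
  have hmax (t : I) : AffineMap.lineMap r₂ r₂' (t : ℝ) ≤ max r₂ r₂' := by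
    simpa only [AffineMap.lineMap_same_apply] using lineMap_mono_endpoints
      (le_max_left r₂ r₂') (le_max_right r₂ r₂') t.2.1 t.2.2
  refine mappingClass_eq_of_isotopicRel ⟨fun t => dehnTwist S c _ _ (hlt t) fun z h h' =>
    hS z ((hmin t).trans_lt h) (h'.trans_le (hmax t)), ?_, ?_, ?_⟩
  · refine Continuous.subtype_mk ?_ _
    have hne (p : I × S) : AffineMap.lineMap r₂ r₂' (p.1 : ℝ) - AffineMap.lineMap r₁ r₁' (p.1 : ℝ) ≠
        (0 : ℝ) := (sub_pos.2 (hlt p.1)).ne'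
    change Continuous fun p : I × S => twistMap c (AffineMap.lineMap r₁ r₁' (p.1 : ℝ))
      (AffineMap.lineMap r₂ r₂' (p.1 : ℝ)) 1 p.2
    unfold twistMap twistAngle
    fun_prop (disch := exact hne)
  · refine Subtype.ext (Homeomorph.ext fun x => Subtype.ext ?_)
    change twistMap c (AffineMap.lineMap r₁ r₁' (0 : ℝ)) (AffineMap.lineMap r₂ r₂' (0 : ℝ)) 1 x =
      twistMap c r₁ r₂ 1 x
    rw [AffineMap.lineMap_apply_zero, AffineMap.lineMap_apply_zero]
  · refine Subtype.ext (Homeomorph.ext fun x => Subtype.ext ?_)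
    change twistMap c (AffineMap.lineMap r₁ r₁' (1 : ℝ)) (AffineMap.lineMap r₂ r₂' (1 : ℝ)) 1 x =
      twistMap c r₁' r₂' 1 x
    rw [AffineMap.lineMap_apply_one, AffineMap.lineMap_apply_one]

/-- The triples of a mapping class, a pure braid and a triple of framings that belong to a common
motion. -/
def realizedClasses : Subgroup (MappingClassGroup fourHoledSphere × PureBraidGroup ×
    Multiplicative (Fin 3 → ℤ)) :=
  realized.map (MonoidHom.prodMap (MonoidHom.op (QuotientGroup.mk' (IsotopicToId fourHoledSphere)))
    (MonoidHom.id _))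

/-- The framings of a motion that turns each hole with index in `J` once. -/
def indicator (J : Finset (Fin 3)) : Multiplicative (Fin 3 → ℤ) :=
  Multiplicative.ofAdd fun i => if i ∈ J then 1 else 0

lemma twistClass_mem_realizedClasses {c r₁ r₂ r₁' r₂' : ℝ} (hr : r₁ < r₂) (h : |c| + r₂ ≤ 10)
    (h0 : |c + 4| + 1 ≤ r₁ ∨ r₂ + 1 ≤ |c + 4|) (h1 : |c| + 1 ≤ r₁ ∨ r₂ + 1 ≤ |c|)
    (h2 : |c - 4| + 1 ≤ r₁ ∨ r₂ + 1 ≤ |c - 4|) {J : Finset (Fin 3)}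
    (hJ : Separates c r₁' r₂' J)
    (hS : ∀ z : ℂ, min r₁ r₁' < ‖z - c‖ → ‖z - c‖ < max r₂ r₂' → z ∈ fourHoledSphere)
    {b : PureBraid} (hb : ∀ (t : I) (i : Fin 3), (b t).1 i = if i ∈ J then
        c + (basePoint.1 i - c) * Complex.exp ((Real.pi * (2 * t) : ℝ) * Complex.I)
      else basePoint.1 i) :
    (twistClass c r₁ r₂ hr h h0 h1 h2, b.toPure, indicator J) ∈ realizedClasses := by
  have htrace : hJ.twistMotion.trace = b := Path.ext (funext fun t => Subtype.ext (funext fun i =>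
    (hJ.trace_twistMotion_apply t i).trans (hb t i).symm))
  have hS' : ∀ z : ℂ, r₁' < ‖z - c‖ → ‖z - c‖ < r₂' → z ∈ fourHoledSphere := fun z h h' =>
    hS z (min_lt_of_right_lt h) (lt_max_of_lt_right h')
  rw [twistClass, mappingClass_dehnTwist_eq hr hJ.lt hS]
  exact ⟨⟨MulOpposite.op (dehnTwist fourHoledSphere c r₁' r₂' hJ.lt hS'), b.toPure, indicator J⟩,
    ⟨hJ.twistMotion, hJ.twistMotion_endsAt hS', congrArg PureBraid.toPure htrace, rfl⟩, rfl⟩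

/-- The real coordinates of the base configuration. -/
def center : Fin 3 → ℝ := ![-4, 0, 4]

lemma center_zero : center 0 = -4 := rfl

lemma center_one : center 1 = 0 := rfl

lemma center_two : center 2 = 4 := rfl

lemma abs_center_le (i : Fin 3) : |center i| ≤ 4 := by
  revert i
  refine forall_fin_three ?_ ?_ ?_ <;> norm_num [center_zero, center_one, center_two]

lemma basePoint_eq_center (i : Fin 3) : basePoint.1 i = center i := by
  revert i
  refine forall_fin_three ?_ ?_ ?_ <;> simp [basePoint, center]

lemma Separates.of_real {c r₁ r₂ : ℝ} {J : Finset (Fin 3)} (hr : r₁ < r₂) (hc : |c| + r₂ ≤ 9)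
    (hin : ∀ i ∈ J, |center i - c| + 3 / 2 ≤ r₁) (hout : ∀ i ∉ J, r₂ + 3 / 2 ≤ |center i - c|) :
    Separates c r₁ r₂ J := by
  have hnorm (i : Fin 3) : ‖basePoint.1 i - c‖ = |center i - c| := by
    rw [basePoint_eq_center, ← Complex.ofReal_sub, Complex.norm_real, Real.norm_eq_abs]
  refine ⟨hr, by rwa [Complex.norm_real, Real.norm_eq_abs], fun i hi => ?_, fun i hi => ?_⟩
  · exact hnorm i ▸ hin i hi
  · exact hnorm i ▸ hout i hi

lemma four_le_abs_center_sub (i j : Fin 3) (h : j ≠ i) : 4 ≤ |center j - center i| := by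
  revert i j h
  refine forall_fin_three ?_ ?_ ?_ <;> refine forall_fin_three ?_ ?_ ?_ <;>
    norm_num [center_zero, center_one, center_two]

lemma boundaryTwist_mem_realizedClasses (i : Fin 3) (h h0 h1 h2) :
    (twistClass (center i) 1 2 one_lt_two h h0 h1 h2, 1, indicator {i}) ∈ realizedClasses := by
  refine twistClass_mem_realizedClasses _ h h0 h1 h2 (r₁' := 3 / 2) (r₂' := 2)
    (.of_real (by norm_num) (by linarith [abs_center_le i]) ?_ fun j hj => ?_) ?_
    (b := Path.refl basePoint) fun t j => ?_
  · rintro j hj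
    rw [Finset.mem_singleton.1 hj, sub_self, abs_zero, zero_add]
  · linarith [four_le_abs_center_sub i j (Finset.notMem_singleton.1 hj)]
  · rw [min_eq_left (by norm_num), max_self]
    exact annulus_subset h h0 h1 h2
  · split_ifs with hj
    · rw [Finset.mem_singleton.1 hj, ← basePoint_eq_center, sub_self, zero_mul, add_zero]
      rfl
    · rfl

lemma τd_mem_realizedClasses :
    (τd, fullTwist.toPure, indicator Finset.univ) ∈ realizedClasses := by
  refine twistClass_mem_realizedClasses _ _ _ _ _ (r₁' := 8) (r₂' := 9)
    (.of_real (by norm_num) (by norm_num) ?_ ?_) ?_ fun t i => ?_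
  · refine forall_fin_three ?_ ?_ ?_ <;> norm_num [center_zero, center_one, center_two]
  · exact fun i hi => absurd (Finset.mem_univ i) hi
  · rw [min_eq_right (by norm_num), max_eq_left (by norm_num)]
    exact annulus_subset (by norm_num) (by norm_num) (by norm_num) (by norm_num)
  · change Complex.exp ((Real.pi * (2 * t) : ℝ) * Complex.I) * basePoint.1 i = _
    rw [if_pos (Finset.mem_univ i), Complex.ofReal_zero, sub_zero, zero_add, mul_comm]

lemma τe_mem_realizedClasses :
    (τe, fullTwist₁.toPure, indicator {0, 1}) ∈ realizedClasses := by
  refine twistClass_mem_realizedClasses _ _ _ _ _ (r₁' := 7 / 2) (r₂' := 4)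
    (.of_real (by norm_num) (by norm_num) ?_ ?_) ?_ fun t => ?_
  · refine forall_fin_three ?_ ?_ ?_ <;> norm_num [center_zero, center_one, center_two, Fin.ext_iff]
  · refine forall_fin_three ?_ ?_ ?_ <;> norm_num [center_zero, center_one, center_two, Fin.ext_iff]
  · rw [min_eq_left (by norm_num), max_self]
    exact annulus_subset (by norm_num) (by norm_num) (by norm_num) (by norm_num)
  · change ∀ i, (halfTwist₁ (2 * t)).1 i = _
    refine forall_fin_three ?_ ?_ ?_ <;> simp [halfTwist₁, basePoint]
    ring

lemma τf_mem_realizedClasses :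
    (τf, fullTwist₂.toPure, indicator {1, 2}) ∈ realizedClasses := by
  refine twistClass_mem_realizedClasses _ _ _ _ _ (r₁' := 7 / 2) (r₂' := 4)
    (.of_real (by norm_num) (by norm_num) ?_ ?_) ?_ fun t => ?_
  · refine forall_fin_three ?_ ?_ ?_ <;> norm_num [center_zero, center_one, center_two, Fin.ext_iff]
  · refine forall_fin_three ?_ ?_ ?_ <;> norm_num [center_zero, center_one, center_two, Fin.ext_iff]
  · rw [min_eq_left (by norm_num), max_self]
    exact annulus_subset (by norm_num) (by norm_num) (by norm_num) (by norm_num)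
  · change ∀ i, (halfTwist₂ (2 * t)).1 i = _
    refine forall_fin_three ?_ ?_ ?_ <;> simp [halfTwist₂, basePoint] <;> ring

/-- The pure braid of the monodromy. -/
def monodromyPure (δ : ℤ) {k : ℕ} (ε η : Fin k → ℤ) : PureBraidGroup :=
  fullTwist.toPure ^ δ *
    (List.ofFn fun i => fullTwist₁.toPure ^ ε i * fullTwist₂.toPure ^ η i).prod

lemma pureToBraid_monodromyPure (δ : ℤ) {k : ℕ} (ε η : Fin k → ℤ) :
    pureToBraid (monodromyPure δ ε η) = (σ₂ * σ₁ * σ₂) ^ (2 * δ) *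
      (List.ofFn fun i => σ₁ ^ (2 * ε i) * σ₂ ^ (2 * η i)).prod := by
  simp only [monodromyPure, map_mul, map_list_prod, map_zpow, List.map_ofFn, Function.comp_def,
    pureToBraid_toPure, toBraid_fullTwist, toBraid_fullTwist₁, toBraid_fullTwist₂, zpow_mul,
    zpow_ofNat]

lemma prod_ofFn_prodMk {M N : Type*} [Monoid M] [Monoid N] {k : ℕ} (f : Fin k → M) (g : Fin k → N) :
    (List.ofFn fun i => (f i, g i)).prod = ((List.ofFn f).prod, (List.ofFn g).prod) := by
  refine Prod.ext ?_ ?_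
  · rw [← MonoidHom.coe_fst, map_list_prod, List.map_ofFn]
    rfl
  · rw [← MonoidHom.coe_snd, map_list_prod, List.map_ofFn]
    rfl

lemma indicator_word (α β γ δ : ℤ) {k : ℕ} (ε η : Fin k → ℤ) :
    indicator {0} ^ α * indicator {1} ^ β * indicator {2} ^ γ * indicator Finset.univ ^ δ *
      (List.ofFn fun i => indicator {0, 1} ^ ε i * indicator {1, 2} ^ η i).prod =
    Multiplicative.ofAdd
      ![α + δ + (∑ i, ε i), β + δ + (∑ i, ε i) + (∑ i, η i), γ + δ + (∑ i, η i)] := by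
  apply Multiplicative.toAdd.injective
  rw [List.prod_ofFn]
  simp only [toAdd_mul, toAdd_zpow, toAdd_prod, indicator, toAdd_ofAdd]
  refine funext (forall_fin_three ?_ ?_ ?_) <;>
    simp [Finset.sum_apply, Finset.sum_add_distrib]
  ring

lemma monodromy_mem_realizedClasses (α β γ δ : ℤ) {k : ℕ} (ε η : Fin k → ℤ) :
    (τa ^ α * τb ^ β * τc ^ γ * τd ^ δ * (List.ofFn fun i => τe ^ ε i * τf ^ η i).prod,
      monodromyPure δ ε η, Multiplicative.ofAdd
        ![α + δ + (∑ i, ε i), β + δ + (∑ i, ε i) + (∑ i, η i), γ + δ + (∑ i, η i)]) ∈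
      realizedClasses := by
  have ha : (τa, 1, indicator {0}) ∈ realizedClasses :=
    boundaryTwist_mem_realizedClasses 0 _ _ _ _
  have hb : (τb, 1, indicator {1}) ∈ realizedClasses :=
    boundaryTwist_mem_realizedClasses 1 _ _ _ _
  have hc : (τc, 1, indicator {2}) ∈ realizedClasses :=
    boundaryTwist_mem_realizedClasses 2 _ _ _ _
  have hef : (List.ofFn fun i => (τe, fullTwist₁.toPure, indicator {0, 1}) ^ ε i *
      (τf, fullTwist₂.toPure, indicator {1, 2}) ^ η i).prod ∈ realizedClasses :=
    list_prod_mem (List.forall_mem_ofFn_iff.2 fun i => mul_mem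
      (zpow_mem τe_mem_realizedClasses (ε i)) (zpow_mem τf_mem_realizedClasses (η i)))
  have hword := mul_mem (mul_mem (mul_mem (mul_mem (zpow_mem ha α) (zpow_mem hb β))
    (zpow_mem hc γ)) (zpow_mem τd_mem_realizedClasses δ)) hef
  simpa only [Prod.pow_mk, Prod.mk_mul_mk, prod_ofFn_prodMk, one_zpow, one_mul, indicator_word,
    monodromyPure] using hword

lemma exists_motion_monodromy (α β γ δ : ℤ) {k : ℕ} (ε η : Fin k → ℤ) :
    ∃ ψ : RelHomeo fourHoledSphere, mappingClass ψ =
      τa ^ α * τb ^ β * τc ^ γ * τd ^ δ * (List.ofFn fun i => τe ^ ε i * τf ^ η i).prod ∧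
    ∃ m : Motion, m.EndsAt ψ ∧ m.trace.toPure = monodromyPure δ ε η ∧ m.framing =
      ![α + δ + (∑ i, ε i), β + δ + (∑ i, ε i) + (∑ i, η i), γ + δ + (∑ i, η i)] := by
  obtain ⟨⟨ψ, x⟩, ⟨m, hend, htrace, hframing⟩, hψ⟩ :=
    monodromy_mem_realizedClasses α β γ δ ε η
  obtain ⟨hψ, rfl⟩ := Prod.ext_iff.1 hψ
  exact ⟨ψ.unop, hψ, m, hend, htrace, hframing⟩

/-! ### Loops as functions on the circle -/

/-- The point of the circle at the time `t`. -/
def turn (t : ℝ) : Circle := Circle.exp (2 * Real.pi * t)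

@[fun_prop]
lemma continuous_turn : Continuous turn := by
  unfold turn
  fun_prop

lemma turn_eq_iff {s t : ℝ} : turn s = turn t ↔ ∃ n : ℤ, s = t + n := by
  rw [turn, turn, Circle.exp_eq_exp]
  refine exists_congr fun n => ⟨fun h => ?_, fun h => by rw [h]; ring⟩
  have h' : 2 * Real.pi * s = 2 * Real.pi * (t + n) := by linarith
  exact mul_left_cancel₀ Real.two_pi_pos.ne' h'

lemma turn_add_int (t : ℝ) (n : ℤ) : turn (t + n) = turn t := turn_eq_iff.2 ⟨n, rfl⟩

lemma turn_zero : turn 0 = 1 := by simp [turn]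

lemma turn_one : turn 1 = 1 := by
  rw [← turn_zero]
  exact turn_eq_iff.2 ⟨1, by simp⟩

lemma coe_turn (t : ℝ) : (turn t : ℂ) = Complex.exp ((2 * Real.pi * t : ℝ) * Complex.I) := rfl

lemma turn_eq_cases {s t : I} (h : turn s = turn t) :
    s = t ∨ (s = 0 ∧ t = 1) ∨ (s = 1 ∧ t = 0) := by
  obtain ⟨n, hn⟩ := turn_eq_iff.1 h
  have hs := s.2
  have ht := t.2
  have hle : n ≤ 1 := by exact_mod_cast (by linarith [hs.2, ht.1] : (n : ℝ) ≤ 1)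
  have hge : -1 ≤ n := by exact_mod_cast (by linarith [hs.1, ht.2] : (-1 : ℝ) ≤ n)
  simp only [Subtype.ext_iff, Set.Icc.coe_zero, Set.Icc.coe_one]
  interval_cases n <;> push_cast at hn
  · exact Or.inr (Or.inl ⟨by linarith [hs.1, ht.2], by linarith [hs.1, ht.2]⟩)
  · exact Or.inl (by linarith)
  · exact Or.inr (Or.inr ⟨by linarith [hs.2, ht.1], by linarith [hs.2, ht.1]⟩)

lemma turn_surjective : Function.Surjective fun t : I => turn t := by
  intro u
  let x : ℝ := Complex.arg u / (2 * Real.pi)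
  have hu : turn x = u := by
    rw [turn, mul_div_cancel₀ _ Real.two_pi_pos.ne', Circle.exp_arg]
  refine ⟨⟨Int.fract x, Int.fract_nonneg x, (Int.fract_lt_one x).le⟩, ?_⟩
  change turn (Int.fract x) = u
  rw [← hu, ← turn_add_int (Int.fract x) ⌊x⌋, Int.fract_add_floor]

/-- A time at which the circle passes through a given point. -/
def time (u : Circle) : I := (turn_surjective u).choose

lemma turn_time (u : Circle) : turn (time u) = u := (turn_surjective u).choose_spec

lemma isQuotientMap_turn : Topology.IsQuotientMap fun t : I => turn t :=
  .of_surjective_continuous turn_surjective (continuous_turn.comp continuous_subtype_val)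

lemma apply_time_turn {X : Type*} {f : I → X} (h : f 0 = f 1) (t : I) :
    f (time (turn t)) = f t := by
  rcases turn_eq_cases (turn_time (turn t)) with h1 | ⟨h1, h2⟩ | ⟨h1, h2⟩
  · rw [h1]
  · rw [h1, h2, h]
  · rw [h1, h2, h]

lemma continuous_comp_time {X : Type*} [TopologicalSpace X] {f : I → X} (hf : Continuous f)
    (h : f 0 = f 1) : Continuous fun u => f (time u) := by
  rw [isQuotientMap_turn.continuous_iff]
  exact hf.congr fun t => (apply_time_turn h t).symm

/-! ### Coordinates on the three-sphere -/

lemma isOpenEmbedding_of_inverse {X Y : Type*} [TopologicalSpace X] [TopologicalSpace Y]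
    {f : X → Y} (g : Y → X) {U : Set Y} (hf : Continuous f) (hU : IsOpen U) (hg : ContinuousOn g U)
    (hfU : ∀ x, f x ∈ U) (hgf : ∀ x, g (f x) = x) (hfg : ∀ y ∈ U, f (g y) = y) :
    Topology.IsOpenEmbedding f :=
  OpenPartialHomeomorph.isOpenEmbedding
    { toFun := f
      invFun := g
      source := Set.univ
      target := U
      map_source' := fun x _ => hfU x
      map_target' := fun _ _ => Set.mem_univ _
      left_inv' := fun x _ => hgf x
      right_inv' := hfg
      open_source := isOpen_univ
      open_target := hU
      continuousOn_toFun := hf.continuousOn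
      continuousOn_invFun := hg } rfl

section Sphere

variable {E : Type*} [NormedAddCommGroup E] [NormedSpace ℝ E]

/-- The radial projection of a non-zero vector to the unit sphere. -/
def toSphere (v : E) (hv : v ≠ 0) : Metric.sphere (0 : E) 1 :=
  ⟨‖v‖⁻¹ • v, by
    rw [mem_sphere_zero_iff_norm, norm_smul, norm_inv, norm_norm,
      inv_mul_cancel₀ (norm_ne_zero_iff.2 hv)]⟩

lemma toSphere_eq_iff {v w : E} {hv : v ≠ 0} {hw : w ≠ 0} :
    toSphere v hv = toSphere w hw ↔ ∃ r : ℝ, 0 < r ∧ v = r • w := by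
  rw [toSphere, toSphere, Subtype.mk_eq_mk, ← sameRay_iff_inv_norm_smul_eq_of_ne hv hw,
    SameRay.sameRay_comm, ← exists_pos_left_iff_sameRay hw hv]
  simp only [eq_comm]

lemma toSphere_self (x : Metric.sphere (0 : E) 1) (hx : x.1 ≠ 0) : toSphere x.1 hx = x := by
  refine Subtype.ext ?_
  change ‖x.1‖⁻¹ • x.1 = x.1
  rw [norm_eq_of_mem_sphere, inv_one, one_smul]

end Sphere

lemma pair_ne_zero {z w : ℂ} (h : z ≠ 0 ∨ w ≠ 0) : !₂[z, w] ≠ 0 := by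
  rintro h0
  exact h.elim (fun hz => hz (congrArg (fun v : EuclideanSpace ℂ (Fin 2) => v 0) h0))
    fun hw => hw (congrArg (fun v : EuclideanSpace ℂ (Fin 2) => v 1) h0)

/-- The point of the three-sphere in the direction of a non-zero vector. -/
def proj (z w : ℂ) (h : z ≠ 0 ∨ w ≠ 0) : S3 := toSphere !₂[z, w] (pair_ne_zero h)

lemma proj_one {z w : ℂ} (h : z ≠ 0 ∨ w ≠ 0) :
    (proj z w h).1 1 = (‖!₂[z, w]‖⁻¹ : ℝ) * w := rfl

lemma continuous_s3_apply (i : Fin 2) : Continuous fun x : S3 => x.1 i := by fun_prop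

lemma proj_eq_iff {z w z' w' : ℂ} {h : z ≠ 0 ∨ w ≠ 0} {h' : z' ≠ 0 ∨ w' ≠ 0} :
    proj z w h = proj z' w' h' ↔ ∃ r : ℝ, 0 < r ∧ z = r * z' ∧ w = r * w' := by
  rw [proj, proj, toSphere_eq_iff]
  refine exists_congr fun r => and_congr_right fun _ => ⟨fun e => ?_, fun e => ?_⟩
  · exact ⟨congrArg (fun v : EuclideanSpace ℂ (Fin 2) => v 0) e,
      congrArg (fun v : EuclideanSpace ℂ (Fin 2) => v 1) e⟩
  · rw [e.1, e.2]
    ext i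
    fin_cases i <;> rfl

lemma proj_congr {z w z' w' : ℂ} {h : z ≠ 0 ∨ w ≠ 0} {h' : z' ≠ 0 ∨ w' ≠ 0} (hz : z = z')
    (hw : w = w') : proj z w h = proj z' w' h' := by
  subst hz hw
  rfl

lemma s3_norm (x : S3) : ‖x.1 0‖ ^ 2 + ‖x.1 1‖ ^ 2 = 1 := by
  rw [← Fin.sum_univ_two fun i => ‖x.1 i‖ ^ 2, ← EuclideanSpace.norm_sq_eq, norm_eq_of_mem_sphere,
    one_pow]

lemma s3_ne_zero (x : S3) : x.1 0 ≠ 0 ∨ x.1 1 ≠ 0 := by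
  by_contra! h
  have hx := s3_norm x
  rw [h.1, h.2] at hx
  norm_num at hx

lemma proj_self (x : S3) : proj (x.1 0) (x.1 1) (s3_ne_zero x) = x := by
  have hx : !₂[x.1 0, x.1 1] = x.1 := by
    ext i
    fin_cases i <;> rfl
  refine Eq.trans ?_ (toSphere_self x (ne_zero_of_mem_unit_sphere x))
  simp only [proj, hx]

lemma continuous_proj {X : Type*} [TopologicalSpace X] {f g : X → ℂ} (hf : Continuous f)
    (hg : Continuous g) (h : ∀ x, f x ≠ 0 ∨ g x ≠ 0) :
    Continuous fun x => proj (f x) (g x) (h x) := by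
  have hv : Continuous fun x => !₂[f x, g x] :=
    (PiLp.continuous_toLp 2 _).comp (continuous_pi (Fin.forall_fin_two.2 ⟨hf, hg⟩))
  exact ((hv.norm.inv₀ fun x => norm_ne_zero_iff.2 (pair_ne_zero (h x))).smul hv).subtype_mk _

/-- The point of the three-sphere over the point `z` of the page at the angle `u`. -/
def cyl (p : Circle × ℂ) : S3 := proj p.2 p.1 (Or.inr p.1.coe_ne_zero)

lemma continuous_cyl : Continuous cyl :=
  continuous_proj continuous_snd (continuous_subtype_val.comp continuous_fst) _

lemma cyl_injective : Function.Injective cyl := by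
  rintro ⟨u, z⟩ ⟨u', z'⟩ h
  obtain ⟨r, hr, hz, hu⟩ := proj_eq_iff.1 h
  have hn := congrArg norm hu
  rw [norm_mul, Circle.norm_coe, Circle.norm_coe, Complex.norm_real, Real.norm_of_nonneg hr.le,
    mul_one] at hn
  subst hn
  simp only [Complex.ofReal_one, one_mul] at hz hu
  exact Prod.ext (Circle.ext hu) hz

lemma sphereCoord_eq_cyl (z : ℂ) (θ : ℝ) : sphereCoord (z, θ) = cyl (Circle.exp θ, z) := by
  refine Subtype.ext ?_
  simp only [sphereCoord, cyl, proj, toSphere, Circle.coe_exp, EuclideanSpace.norm_eq,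
    Fin.sum_univ_two, Matrix.cons_val_zero, Matrix.cons_val_one, Complex.norm_exp_ofReal_mul_I,
    one_pow]
  rw [add_comm]

lemma sphereCoord_turn (z : ℂ) (t : ℝ) : sphereCoord (z, 2 * Real.pi * t) = cyl (turn t, z) :=
  sphereCoord_eq_cyl z _

lemma cyl_one_ne_zero (p : Circle × ℂ) : (cyl p).1 1 ≠ 0 := by
  rw [cyl, proj_one]
  exact mul_ne_zero
    (Complex.ofReal_ne_zero.2 (inv_ne_zero (norm_ne_zero_iff.2 (pair_ne_zero (Or.inr
      p.1.coe_ne_zero))))) p.1.coe_ne_zero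

/-- The direction of a complex number, with the junk value `1` at `0`. -/
def direction (w : ℂ) : Circle := Circle.exp (Complex.arg w)

lemma norm_mul_direction (w : ℂ) : (‖w‖ : ℂ) * direction w = w := by
  rw [direction, Circle.coe_exp, Complex.norm_mul_exp_arg_mul_I]

lemma direction_real_mul {r : ℝ} (hr : 0 < r) (v : Circle) : direction (r * (v : ℂ)) = v := by
  rw [direction, Complex.arg_real_mul _ hr, Circle.exp_arg]

lemma coe_direction {w : ℂ} (h : w ≠ 0) : (direction w : ℂ) = w / ‖w‖ := by
  have hn : (‖w‖ : ℂ) ≠ 0 := by exact_mod_cast (norm_pos_iff.2 h).ne'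
  rw [eq_div_iff hn, mul_comm, norm_mul_direction]

lemma continuousOn_direction : ContinuousOn direction {w : ℂ | w ≠ 0} := by
  have hi : Topology.IsInducing fun u : Circle => (u : ℂ) := ⟨rfl⟩
  have h : ContinuousOn (fun w : ℂ => w / ‖w‖) {w : ℂ | w ≠ 0} :=
    continuousOn_id.div (by fun_prop) fun w hw => by exact_mod_cast (norm_pos_iff.2 hw).ne'
  exact hi.continuousOn_iff.2 (h.congr fun w hw => coe_direction hw)

/-- The inverse of `cyl`. -/
def cylInv (x : S3) : Circle × ℂ := (direction (x.1 1), x.1 0 / ‖x.1 1‖)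

lemma continuousOn_cylInv : ContinuousOn cylInv {x : S3 | x.1 1 ≠ 0} := by
  refine ContinuousOn.prodMk ?_ ?_
  · exact continuousOn_direction.comp (continuous_s3_apply 1).continuousOn fun x hx => hx
  · exact (continuous_s3_apply 0).continuousOn.div
      (Complex.continuous_ofReal.comp (continuous_s3_apply 1).norm).continuousOn
      fun x hx => Complex.ofReal_ne_zero.2 (norm_pos_iff.2 hx).ne'

lemma cyl_cylInv {x : S3} (hx : x.1 1 ≠ 0) : cyl (cylInv x) = x := by
  refine Eq.trans (proj_eq_iff.2 ⟨‖x.1 1‖⁻¹, inv_pos.2 (norm_pos_iff.2 hx), ?_, ?_⟩) (proj_self x)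
  · rw [cylInv, Complex.ofReal_inv, div_eq_inv_mul]
  · rw [cylInv, coe_direction hx, Complex.ofReal_inv, div_eq_inv_mul]

lemma isOpen_s3_one_ne_zero : IsOpen {x : S3 | x.1 1 ≠ 0} :=
  isOpen_ne_fun (continuous_s3_apply 1) continuous_const

lemma cylInv_cyl (p : Circle × ℂ) : cylInv (cyl p) = p :=
  cyl_injective (cyl_cylInv (cyl_one_ne_zero p))

lemma isOpenEmbedding_cyl : Topology.IsOpenEmbedding cyl :=
  isOpenEmbedding_of_inverse cylInv continuous_cyl isOpen_s3_one_ne_zero continuousOn_cylInv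
    cyl_one_ne_zero cylInv_cyl fun _ => cyl_cylInv

/-! ### The radial compression of the plane -/

/-- The radial compression of the plane to the disk of radius `3/2`. It carries the unit circle to
the circle of radius `5/4`. -/
def radial (w : ℂ) : ℂ := ((3 / 2) / (1 / 5 + ‖w‖) : ℝ) * w

lemma radial_denom_pos (w : ℂ) : 0 < 1 / 5 + ‖w‖ := by positivity

lemma continuous_radial : Continuous radial := by
  unfold radial
  have h : ∀ w : ℂ, 1 / 5 + ‖w‖ ≠ 0 := fun w => (radial_denom_pos w).ne'
  fun_prop (disch := exact h _)

lemma norm_radial (w : ℂ) : ‖radial w‖ = 3 / 2 * ‖w‖ / (1 / 5 + ‖w‖) := by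
  have := radial_denom_pos w
  rw [radial, norm_mul, Complex.norm_real, Real.norm_of_nonneg (by positivity)]
  ring

lemma norm_radial_lt (w : ℂ) : ‖radial w‖ < 3 / 2 := by
  rw [norm_radial, div_lt_iff₀ (radial_denom_pos w)]
  linarith

lemma radial_zero : radial 0 = 0 := by simp [radial]

lemma norm_radial_lt_iff {w : ℂ} : ‖radial w‖ < 5 / 4 ↔ ‖w‖ < 1 := by
  rw [norm_radial, div_lt_iff₀ (radial_denom_pos w)]
  constructor <;> exact fun h => by linarith

lemma radial_of_norm_one {w : ℂ} (h : ‖w‖ = 1) : radial w = (5 / 4 : ℝ) * w := by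
  rw [radial, h]
  norm_num

/-- The inverse of the radial compression. -/
def radialInv (y : ℂ) : ℂ := ((1 / 5) / (3 / 2 - ‖y‖) : ℝ) * y

lemma radialInv_radial (w : ℂ) : radialInv (radial w) = w := by
  have h : 3 / 2 - ‖radial w‖ = (3 / 10) / (1 / 5 + ‖w‖) := by
    rw [norm_radial]
    field_simp
    ring
  rw [radialInv, h, radial, ← mul_assoc, ← Complex.ofReal_mul]
  have : (1 / 5 / (3 / 10 / (1 / 5 + ‖w‖)) * (3 / 2 / (1 / 5 + ‖w‖)) : ℝ) = 1 := by
    field_simp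
    norm_num
  rw [this, Complex.ofReal_one, one_mul]

lemma radial_radialInv {y : ℂ} (hy : ‖y‖ < 3 / 2) : radial (radialInv y) = y := by
  have hp : 0 < 3 / 2 - ‖y‖ := by linarith
  obtain ⟨d, hd⟩ : ∃ d, d = 3 / 2 - ‖y‖ := ⟨_, rfl⟩
  have hd' : ‖y‖ = 3 / 2 - d := by linarith
  rw [← hd] at hp
  have h : 1 / 5 + ‖radialInv y‖ = (3 / 10) / (3 / 2 - ‖y‖) := by
    rw [radialInv, norm_mul, Complex.norm_real, ← hd, Real.norm_of_nonneg (by positivity), hd']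
    field_simp
    ring
  rw [radial, h, radialInv, ← mul_assoc, ← Complex.ofReal_mul, ← hd]
  have : (3 / 2 / (3 / 10 / d) * (1 / 5 / d) : ℝ) = 1 := by
    field_simp
    norm_num
  rw [this, Complex.ofReal_one, one_mul]

lemma isOpenEmbedding_radial : Topology.IsOpenEmbedding radial := by
  refine isOpenEmbedding_of_inverse radialInv (U := {y | ‖y‖ < 3 / 2}) continuous_radial
    (isOpen_lt continuous_norm continuous_const) ?_ norm_radial_lt radialInv_radial
    fun y hy => radial_radialInv hy
  unfold radialInv
  refine ContinuousOn.mul (Complex.continuous_ofReal.comp_continuousOn ?_) continuousOn_id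
  refine continuousOn_const.div (by fun_prop) fun y hy => ?_
  exact ne_of_gt (sub_pos.2 hy)

/-! ### Loops in the image of a plane -/

section Lattice

variable {E X : Type*} [TopologicalSpace E] [TopologicalSpace X]

/-- The image of a path, with prescribed names of the end points. -/
def pushPath (F : C(E, X)) {x y : E} (P : Path x y) {a b : X} (ha : a = F x) (hb : b = F y) :
    Path a b :=
  (P.map F.continuous).cast ha hb

lemma pushPath_apply (F : C(E, X)) {x y : E} (P : Path x y) {a b : X} (ha : a = F x)
    (hb : b = F y) (t : I) : pushPath F P ha hb t = F (P t) := rfl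

lemma pushPath_homotopic [SimplyConnectedSpace E] (F : C(E, X)) {x y : E} (P Q : Path x y)
    {a b : X} (ha : a = F x) (hb : b = F y) :
    Path.Homotopic (pushPath F P ha hb) (pushPath F Q ha hb) :=
  ((SimplyConnectedSpace.paths_homotopic P Q).map F).pathCast ha hb

lemma pushPath_trans (F : C(E, X)) {x y z : E} (P : Path x y) (Q : Path y z) {a b c : X}
    (ha : a = F x) (hb : b = F y) (hc : c = F z) :
    pushPath F (P.trans Q) ha hc = (pushPath F P ha hb).trans (pushPath F Q hb hc) := by
  ext t
  rw [pushPath_apply, Path.trans_apply, Path.trans_apply]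
  split_ifs <;> rfl

lemma homotopic_refl_of_square (G : C(ℝ × ℝ, X)) (h : ∀ s, G (s, 1) = G (s, 0))
    (h1 : ∀ t, G (1, t) = G (1, 0)) {a : X} (ha : a = G (0, 0)) (p : Path a a)
    (hp : ∀ t : I, p t = G (0, t)) : Path.Homotopic p (Path.refl a) := by
  let P : Path ((0, 0) : ℝ × ℝ) (0, 1) :=
    ⟨⟨fun t => (0, t), by fun_prop⟩, by simp, by simp⟩
  let A : Path ((0, 0) : ℝ × ℝ) (1, 0) :=
    ⟨⟨fun t => (t, 0), by fun_prop⟩, by simp, by simp⟩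
  let C : Path ((1, 0) : ℝ × ℝ) (1, 1) :=
    ⟨⟨fun t => (1, t), by fun_prop⟩, by simp, by simp⟩
  let B : Path ((1, 1) : ℝ × ℝ) (0, 1) :=
    ⟨⟨fun t => (unitInterval.symm t, 1), by fun_prop⟩, by simp, by simp⟩
  have ha' : a = G (0, 1) := ha.trans (h 0).symm
  have hpP : p = pushPath G P ha ha' := by
    ext t
    exact hp t
  have hC : pushPath G C rfl (h 1).symm = Path.refl (G (1, 0)) := by
    ext t
    exact h1 t
  have hB : pushPath G B (h 1).symm ha' = (pushPath G A ha rfl).symm := by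
    ext t
    exact h _
  rw [hpP]
  refine (pushPath_homotopic G P ((A.trans C).trans B) ha ha').trans ?_
  rw [pushPath_trans G _ _ ha (h 1).symm ha', pushPath_trans G _ _ ha rfl (h 1).symm, hC, hB]
  exact (Path.Homotopic.hcomp ⟨Path.Homotopy.transRefl _⟩ (Path.Homotopic.refl _)).trans
    ⟨(Path.Homotopy.reflTransSymm _).symm⟩

variable (F : C(ℝ × ℝ, X)) {a : X} (ha : a = F (0, 0))

include ha in
lemma eq_lattice
    (hF : ∀ (v : ℝ × ℝ) (p q : ℤ), F (v.1 + p, v.2 + q) = F v) (p q : ℤ) :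
    a = F ((p : ℝ), (q : ℝ)) := by
  rw [ha]
  simpa using (hF (0, 0) p q).symm

/-- The image of a path between lattice points under a doubly periodic map. -/
def latticeLoop (hF : ∀ (v : ℝ × ℝ) (p q : ℤ), F (v.1 + p, v.2 + q) = F v) (p q : ℤ) : Path a a :=
  pushPath F (PathConnectedSpace.somePath ((0, 0) : ℝ × ℝ) ((p : ℝ), (q : ℝ))) ha
    (eq_lattice F ha hF p q)

variable (hF : ∀ (v : ℝ × ℝ) (p q : ℤ), F (v.1 + p, v.2 + q) = F v)

lemma homotopic_latticeLoop {p q : ℤ} (P : Path ((0, 0) : ℝ × ℝ) ((p : ℝ), (q : ℝ)))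
    {γ : Path a a} (hγ : ∀ t, γ t = F (P t)) : Path.Homotopic γ (latticeLoop F ha hF p q) := by
  have hP : γ = pushPath F P ha (eq_lattice F ha hF p q) := Path.ext (funext hγ)
  rw [hP]
  exact pushPath_homotopic F _ _ _ _

lemma latticeLoop_zero : Path.Homotopic (Path.refl a) (latticeLoop F ha hF 0 0) :=
  homotopic_latticeLoop F ha hF ((Path.refl (0, 0)).cast rfl (by simp)) fun _ => ha

lemma latticeLoop_add (p q p' q' : ℤ) :
    Path.Homotopic ((latticeLoop F ha hF p q).trans (latticeLoop F ha hF p' q'))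
      (latticeLoop F ha hF (p + p') (q + q')) := by
  let P := PathConnectedSpace.somePath ((0, 0) : ℝ × ℝ) ((p : ℝ), (q : ℝ))
  let Q := PathConnectedSpace.somePath ((0, 0) : ℝ × ℝ) ((p' : ℝ), (q' : ℝ))
  let Q' : Path ((p : ℝ), (q : ℝ)) (((p + p' : ℤ) : ℝ), ((q + q' : ℤ) : ℝ)) :=
    ⟨⟨fun t => ((Q t).1 + p, (Q t).2 + q), by fun_prop⟩, by simp, by simp [add_comm]⟩
  have hQ : latticeLoop F ha hF p' q' =
      pushPath F Q' (eq_lattice F ha hF p q) (eq_lattice F ha hF _ _) :=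
    Path.ext (funext fun t => (hF (Q t) p q).symm)
  rw [hQ, latticeLoop, ← pushPath_trans]
  exact homotopic_latticeLoop F ha hF (P.trans Q') fun t => rfl

/-- The homomorphism from the lattice to the fundamental group that a doubly periodic map induces.
The opposite group accounts for the order of composition in `FundamentalGroup`. -/
def latticeHom : Multiplicative (ℤ × ℤ) →* (FundamentalGroup X a)ᵐᵒᵖ where
  toFun v := MulOpposite.op (FundamentalGroup.fromPath (Path.Homotopic.Quotient.mk
    (latticeLoop F ha hF v.toAdd.1 v.toAdd.2)))
  map_one' := MulOpposite.unop_injective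
    (Path.Homotopic.Quotient.eq.2 (latticeLoop_zero F ha hF).symm)
  map_mul' v _ := MulOpposite.unop_injective
    (Path.Homotopic.Quotient.eq.2 (latticeLoop_add F ha hF v.toAdd.1 v.toAdd.2 _ _).symm)

lemma latticeHom_apply {p q : ℤ} (P : Path ((0, 0) : ℝ × ℝ) ((p : ℝ), (q : ℝ))) {γ : Path a a}
    (hγ : ∀ t, γ t = F (P t)) :
    (latticeHom F ha hF (Multiplicative.ofAdd (p, q))).unop =
      FundamentalGroup.fromPath (Path.Homotopic.Quotient.mk γ) :=
  Path.Homotopic.Quotient.eq.2 (homotopic_latticeLoop F ha hF P hγ).symm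

end Lattice

/-! ### The tubes of a motion -/

namespace Motion

variable (m : Motion) (i : Fin 3)

/-- The centre of the `i`-th hole at the time that belongs to a point of the circle. -/
def center (u : Circle) : ℂ := m.toHomeo (time u) (basePoint.1 i)

/-- The rotation of the `i`-th hole at the time that belongs to a point of the circle. -/
def rot (u : Circle) : ℂ := Complex.exp (m.angle i (time u) * Complex.I)

lemma center_loop : m.toHomeo (0 : I) (basePoint.1 i) = m.toHomeo (1 : I) (basePoint.1 i) := by
  rw [Set.Icc.coe_zero, Set.Icc.coe_one, m.start _ le_rfl, m.closed]

lemma rot_loop : Complex.exp (m.angle i (0 : I) * Complex.I) =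
    Complex.exp (m.angle i (1 : I) * Complex.I) := by
  rw [Set.Icc.coe_zero, Set.Icc.coe_one, m.angle_start _ _ le_rfl, m.angle_finish _ _ le_rfl,
    exp_int_mul_two_pi]
  simp

lemma center_turn (t : I) : m.center i (turn t) = m.toHomeo t (basePoint.1 i) :=
  apply_time_turn (f := fun t : I => m.toHomeo t (basePoint.1 i)) (m.center_loop i) t

lemma rot_turn (t : I) : m.rot i (turn t) = Complex.exp (m.angle i t * Complex.I) :=
  apply_time_turn (f := fun t : I => Complex.exp (m.angle i t * Complex.I)) (m.rot_loop i) t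

@[fun_prop]
lemma continuous_center : Continuous (m.center i) :=
  continuous_comp_time (f := fun t : I => m.toHomeo t (basePoint.1 i))
    (m.continuous_toHomeo.comp (continuous_subtype_val.prodMk continuous_const)) (m.center_loop i)

@[fun_prop]
lemma continuous_rot : Continuous (m.rot i) := by
  have h := m.continuous_angle i
  exact continuous_comp_time (f := fun t : I => Complex.exp (m.angle i t * Complex.I))
    (by fun_prop) (m.rot_loop i)

lemma rot_ne_zero (u : Circle) : m.rot i u ≠ 0 := Complex.exp_ne_zero _

lemma center_add_rot_mul (u : Circle) {y : ℂ} (hy : ‖y‖ ≤ 3 / 2) :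
    m.center i u + m.rot i u * y = m.toHomeo (time u) (basePoint.1 i + y) := by
  rw [m.rigid (time u) i (basePoint.1 i + y) (by simpa using hy), add_sub_cancel_left]
  rfl

/-- The motion of the tubular neighbourhood of the `i`-th strand. -/
def shear : Circle × ℂ ≃ₜ Circle × ℂ where
  toFun p := (p.1, m.center i p.1 + m.rot i p.1 * p.2)
  invFun p := (p.1, (m.rot i p.1)⁻¹ * (p.2 - m.center i p.1))
  left_inv p := by simp [m.rot_ne_zero i p.1]
  right_inv p := by simp [m.rot_ne_zero i p.1]
  continuous_toFun := by fun_prop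
  continuous_invFun := by fun_prop (disch := exact fun p => m.rot_ne_zero i p.1)

/-- The tubular neighbourhood of the closed `i`-th strand. -/
def tubeFun (p : Circle × ℂ) : S3 := cyl (p.1, m.center i p.1 + m.rot i p.1 * radial p.2)

lemma isOpenEmbedding_tubeFun : Topology.IsOpenEmbedding (m.tubeFun i) :=
  isOpenEmbedding_cyl.comp ((m.shear i).isOpenEmbedding.comp
    (Topology.IsOpenEmbedding.id.prodMap isOpenEmbedding_radial))

lemma tubeFun_eq (p : Circle × ℂ) :
    m.tubeFun i p = cyl (p.1, m.toHomeo (time p.1) (basePoint.1 i + radial p.2)) := by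
  rw [tubeFun, m.center_add_rot_mul i p.1 (norm_radial_lt _).le]

lemma range_tubeFun_zero : m.trace.closure i = Set.range fun u => m.tubeFun i (u, 0) := by
  have h : ∀ t : I, sphereCoord ((m.trace t).1 i, 2 * Real.pi * t) = m.tubeFun i (turn t, 0) := by
    intro t
    rw [sphereCoord_turn, tubeFun, radial_zero, mul_zero, add_zero, m.center_turn]
    rfl
  exact (congrArg Set.range (funext h)).trans
    (turn_surjective.range_comp fun u => m.tubeFun i (u, 0))

/-- The motion does not start before the time `1/2`. During the rest the tubes of the motion are
round, which gives their orientation. -/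
def Delayed : Prop :=
  (∀ t ≤ 1 / 2, ∀ z, m.toHomeo t z = z) ∧ ∀ i, ∀ t ≤ 1 / 2, m.angle i t = 0

lemma exists_delayed {φ : RelHomeo fourHoledSphere} (hend : m.EndsAt φ) :
    ∃ m' : Motion, m'.Delayed ∧ m'.EndsAt φ ∧ m'.trace.toPure = m.trace.toPure ∧
      m'.framing = m.framing := by
  refine ⟨still.concat m, ⟨fun t ht z => ?_, fun i t ht => ?_⟩, fun x => ?_, ?_, ?_⟩
  · exact m.start _ (by linarith) z
  · change 0 + m.angle i (2 * t - 1) = 0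
    rw [m.angle_start i _ (by linarith), add_zero]
  · change m.toHomeo (2 * 1 - 1) x = _
    rw [m.finish _ (by norm_num), hend]
  · rw [trace_concat, toPure_trans]
    exact one_mul _
  · exact zero_add _

lemma exists_turn_eq_exp {θ : ℝ} (h0 : 0 < θ) (h1 : θ < Real.pi) :
    ∃ t : I, Circle.exp θ = turn t ∧ (t : ℝ) ≤ 1 / 2 := by
  have h2 : θ / (2 * Real.pi) ≤ 1 / 2 := by
    rw [div_le_iff₀ (by positivity)]
    linarith
  refine ⟨⟨θ / (2 * Real.pi), by positivity, by linarith⟩, ?_, h2⟩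
  rw [turn]
  congr 1
  field_simp

lemma hasLocalDegreeOne_radial (c : ℂ) (θ : ℝ) :
    HasLocalDegreeOne (fun q => (c + radial q.1, q.2)) (0, θ) := by
  let k (s : ℝ) (w : ℂ) : ℝ := AffineMap.lineMap ((3 / 2) / (1 / 5 + ‖w‖)) 1 s
  have hk {s : ℝ} (hs : s ∈ Set.Icc (0 : ℝ) 1) (w : ℂ) : (k s w : ℂ) ≠ 0 :=
    Complex.ofReal_ne_zero.2 (ne_of_gt ((convex_Ioi (0 : ℝ)).lineMap_mem
      (div_pos (by norm_num) (radial_denom_pos w)) (Set.mem_Ioi.2 one_pos) hs))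
  refine ⟨1, one_pos, fun p => (c + k p.1 p.2.1 * p.2.1, p.2.2), ?_, ?_, ?_, ?_⟩
  · have h (p : ℝ × ℂ × ℝ) : 1 / 5 + ‖p.2.1‖ ≠ 0 := (radial_denom_pos p.2.1).ne'
    refine Continuous.continuousOn ?_
    simp only [k, AffineMap.lineMap_apply_ring']
    fun_prop (disch := exact h _)
  · intro q _
    simp only [k, AffineMap.lineMap_apply_zero, radial]
  · intro q _
    simp only [k, AffineMap.lineMap_apply_one, radial_zero, Complex.ofReal_one, one_mul, add_zero]
    ext <;> simp
  · intro s hs q _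
    simp only [radial_zero, add_zero, add_eq_left, mul_eq_zero, hk hs, false_or, Prod.ext_iff]

variable {m}

/-- The tubular neighbourhood of the closed `i`-th strand, framed by the rotation of the hole. -/
def tube (hm : m.Delayed) : Tube (m.trace.closure i) where
  toFun := m.tubeFun i
  isOpenEmbedding := m.isOpenEmbedding_tubeFun i
  core := m.range_tubeFun_zero i
  orientation := by
    refine ⟨(0, Real.pi / 2), fun q => (basePoint.1 i + radial q.1, q.2), ?_,
      hasLocalDegreeOne_radial _ _⟩
    have ho : ∀ᶠ q : ℂ × ℝ in nhds (0, Real.pi / 2), 0 < q.2 ∧ q.2 < Real.pi :=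
      (continuous_snd.tendsto _).eventually
        (Ioo_mem_nhds (by positivity) (half_lt_self Real.pi_pos))
    filter_upwards [ho] with q hq
    refine ⟨_, rfl, ?_⟩
    obtain ⟨t, ht, ht'⟩ := exists_turn_eq_exp hq.1 hq.2
    change m.tubeFun i (Circle.exp q.2, q.1) = sphereCoord _
    rw [sphereCoord_eq_cyl, tubeFun, ht, center_turn, rot_turn, hm.1 _ ht', hm.2 i _ ht']
    simp

/-! ### The framing of the tubes -/

variable (hm : m.Delayed)

lemma cyl_notMem_closure {u : Circle} {z : ℂ} (h : z ≠ m.center i u) :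
    cyl (u, z) ∉ m.trace.closure i := by
  rw [range_tubeFun_zero]
  rintro ⟨v, hv⟩
  have hv' := cyl_injective hv
  simp only [Prod.mk.injEq, radial_zero, mul_zero, add_zero] at hv'
  obtain ⟨rfl, hz⟩ := hv'
  exact h hz.symm

/-- The universal covering of the boundary torus of a tube. -/
def torusMap : C(ℝ × ℝ, {x : S3 // x ∉ m.trace.closure i}) where
  toFun v := ⟨(tube i hm).toFun (turn v.1, (turn v.2 : ℂ)),
    (tube i hm).notMem _ (Circle.coe_ne_zero _)⟩
  continuous_toFun := by
    exact ((tube i hm).isOpenEmbedding.continuous.comp (by fun_prop)).subtype_mk _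

lemma torusMap_periodic (v : ℝ × ℝ) (p q : ℤ) :
    torusMap i hm (v.1 + p, v.2 + q) = torusMap i hm v := by
  apply Subtype.ext
  change (tube i hm).toFun (turn (v.1 + p), (turn (v.2 + q) : ℂ)) = _
  rw [turn_add_int, turn_add_int]
  rfl

lemma torusMap_zero : (tube i hm).base = torusMap i hm (0, 0) := by
  apply Subtype.ext
  change (tube i hm).toFun (1, 1) = (tube i hm).toFun (turn 0, (turn 0 : ℂ))
  rw [turn_zero, Circle.coe_one]

lemma push_ne_zero (r : ℝ) (hr : 0 ≤ r) (u : Circle) :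
    r * m.center i u + (5 / 4 : ℝ) ≠ 0 ∨ r * (u : ℂ) ≠ 0 := by
  rcases eq_or_lt_of_le hr with h | h
  · left
    rw [← h]
    norm_num
  · exact Or.inr (mul_ne_zero (Complex.ofReal_ne_zero.2 h.ne') u.coe_ne_zero)

lemma push_notMem (r : ℝ) (hr : 0 ≤ r) (u : Circle) :
    proj (r * m.center i u + (5 / 4 : ℝ)) (r * (u : ℂ)) (push_ne_zero i r hr u) ∉
      m.trace.closure i := by
  rcases eq_or_lt_of_le hr with rfl | h
  · rw [range_tubeFun_zero]
    rintro ⟨v, hv⟩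
    refine cyl_one_ne_zero (v, m.center i v + m.rot i v * radial 0) ?_
    rw [show cyl _ = _ from hv, proj_one]
    simp
  · have hr' : (r : ℂ) ≠ 0 := Complex.ofReal_ne_zero.2 h.ne'
    have hcyl : proj (r * m.center i u + (5 / 4 : ℝ)) (r * (u : ℂ)) (push_ne_zero i r hr u) =
        cyl (u, m.center i u + (5 / 4 : ℝ) / r) :=
      proj_eq_iff.2 ⟨r, h, by rw [mul_add, mul_div_cancel₀ _ hr'], rfl⟩
    rw [hcyl]
    refine cyl_notMem_closure i fun h0 => ?_
    exact div_ne_zero (Complex.ofReal_ne_zero.2 (by norm_num)) hr' (add_eq_left.1 h0)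

/-- The homotopy that pushes a parallel copy of the strand to the braid axis; it shows that this
copy is null-homotopic in the complement of the strand. -/
def pushMap : C(ℝ × ℝ, {x : S3 // x ∉ m.trace.closure i}) where
  toFun v := ⟨_, push_notMem i (max 0 (1 - v.1)) (le_max_left _ _) (turn v.2)⟩
  continuous_toFun := (continuous_proj (by fun_prop) (by fun_prop) _).subtype_mk _

lemma pushMap_apply (s t : ℝ) : (pushMap (m := m) i (s, t)).1 =
    proj ((max 0 (1 - s) : ℝ) * m.center i (turn t) + (5 / 4 : ℝ))
      ((max 0 (1 - s) : ℝ) * (turn t : ℂ))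
      (push_ne_zero i _ (le_max_left _ _) _) := rfl

lemma pushMap_zero (t : ℝ) :
    (pushMap (m := m) i (0, t)).1 = cyl (turn t, m.center i (turn t) + (5 / 4 : ℝ)) := by
  rw [pushMap_apply]
  refine proj_congr ?_ ?_ <;> simp

lemma torusMap_neg_angle (t : I) :
    torusMap i hm (t, -(m.angle i t / (2 * Real.pi))) = pushMap i (0, t) := by
  apply Subtype.ext
  rw [pushMap_zero]
  change cyl (turn t, m.center i (turn t) + m.rot i (turn t) * radial _) = _
  have hangle : m.angle i t + 2 * Real.pi * -(m.angle i t / (2 * Real.pi)) = 0 := by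
    rw [mul_neg, mul_div_cancel₀ _ Real.two_pi_pos.ne', add_neg_cancel]
  rw [radial_of_norm_one (Circle.norm_coe _), rot_turn, coe_turn, mul_left_comm,
    ← Complex.exp_add, ← add_mul, ← Complex.ofReal_add, hangle, Complex.ofReal_zero, zero_mul,
    Complex.exp_zero, mul_one]

/-- The homomorphism from the fundamental group of the boundary torus of a tube. -/
abbrev torusHom : Multiplicative (ℤ × ℤ) →*
    (FundamentalGroup {x : S3 // x ∉ m.trace.closure i} (tube i hm).base)ᵐᵒᵖ :=
  latticeHom (torusMap i hm) (torusMap_zero i hm) (torusMap_periodic i hm)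

lemma torusHom_longitude : (torusHom i hm (Multiplicative.ofAdd (1, 0))).unop =
    FundamentalGroup.fromPath (Path.Homotopic.Quotient.mk (tube i hm).longitude) := by
  refine latticeHom_apply _ _ _ ⟨⟨fun t => (t, 0), by fun_prop⟩, by simp, by simp⟩ fun t =>
    Subtype.ext ?_
  change _ = (tube i hm).toFun (turn t, (turn 0 : ℂ))
  rw [turn_zero]
  rfl

lemma torusHom_meridian : (torusHom i hm (Multiplicative.ofAdd (0, 1))).unop =
    FundamentalGroup.fromPath (Path.Homotopic.Quotient.mk (tube i hm).meridian) := by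
  refine latticeHom_apply _ _ _ ⟨⟨fun t => (0, t), by fun_prop⟩, by simp, by simp⟩ fun t =>
    Subtype.ext ?_
  change _ = (tube i hm).toFun (turn 0, (turn t : ℂ))
  rw [turn_zero]
  rfl

/-- The path in the universal covering of the boundary torus that compensates the rotation of the
hole, so that its image is a translate of the strand. -/
def unwindingPath (m : Motion) (i : Fin 3) :
    Path ((0, 0) : ℝ × ℝ) (((1 : ℤ) : ℝ), ((-m.framing i : ℤ) : ℝ)) where
  toFun t := (t, -(m.angle i t / (2 * Real.pi)))
  continuous_toFun := by
    have h := m.continuous_angle i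
    fun_prop
  source' := by simp [m.angle_start i 0 le_rfl]
  target' := by simp [m.angle_finish i 1 le_rfl, Real.pi_ne_zero]

lemma torusHom_neg_framing : torusHom i hm (Multiplicative.ofAdd (1, -m.framing i)) = 1 := by
  apply MulOpposite.unop_injective
  rw [torusHom, latticeHom_apply _ _ _ (unwindingPath m i)
    (γ := pushPath _ (unwindingPath m i) (torusMap_zero i hm)
      (eq_lattice _ (torusMap_zero i hm) (torusMap_periodic i hm) _ _)) fun t => rfl]
  refine Path.Homotopic.Quotient.eq.2 (homotopic_refl_of_square (pushMap i) (fun s => ?_)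
    (fun t => ?_) ?_ _ (torusMap_neg_angle i hm))
  · apply Subtype.ext
    rw [pushMap_apply, pushMap_apply]
    refine proj_congr ?_ ?_ <;> simp only [turn_one, turn_zero]
  · apply Subtype.ext
    rw [pushMap_apply, pushMap_apply]
    refine proj_congr ?_ ?_ <;> simp
  · have h := torusMap_neg_angle i hm 0
    rw [Set.Icc.coe_zero, m.angle_start i 0 le_rfl, zero_div, neg_zero] at h
    rw [torusMap_zero i hm, h]

lemma hasFraming_tube : (tube i hm).HasFraming (m.framing i) := by
  have hsplit : Multiplicative.ofAdd ((1, 0) : ℤ × ℤ) = Multiplicative.ofAdd (1, -m.framing i) *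
      Multiplicative.ofAdd (0, 1) ^ m.framing i := by
    apply Multiplicative.toAdd.injective
    simp
  rw [Tube.HasFraming, Tube.homologyClass, Tube.homologyClass, ← torusHom_longitude,
    ← torusHom_meridian, ← map_zpow, ← MulOpposite.unop_zpow, hsplit, map_mul, map_zpow,
    torusHom_neg_framing, one_mul]

end Motion

/-! ### The page -/

lemma mem_fourHoledSphere_iff {z : ℂ} :
    z ∈ fourHoledSphere ↔ ‖z‖ ≤ 10 ∧ ∀ i, 1 ≤ ‖z - basePoint.1 i‖ := by
  have h : (∀ i, 1 ≤ ‖z - basePoint.1 i‖) ↔ 1 ≤ ‖z + 4‖ ∧ 1 ≤ ‖z‖ ∧ 1 ≤ ‖z - 4‖ := by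
    rw [Fin.forall_fin_succ, Fin.forall_fin_two]
    change 1 ≤ ‖z - basePoint.1 0‖ ∧ 1 ≤ ‖z - basePoint.1 1‖ ∧ 1 ≤ ‖z - basePoint.1 2‖ ↔ _
    rw [basePoint_zero, basePoint_one, basePoint_two, sub_neg_eq_add, sub_zero]
  rw [h]
  rfl

lemma norm_basePoint_le (i : Fin 3) : ‖basePoint.1 i‖ ≤ 4 := by
  rw [basePoint_eq_center, Complex.norm_real, Real.norm_eq_abs]
  exact abs_center_le i

lemma norm_basePoint_sub_ge {i j : Fin 3} (h : i ≠ j) : 4 ≤ ‖basePoint.1 i - basePoint.1 j‖ := by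
  rw [basePoint_eq_center, basePoint_eq_center, ← Complex.ofReal_sub, Complex.norm_real,
    Real.norm_eq_abs]
  exact four_le_abs_center_sub j i h

lemma eq_of_near {i j : Fin 3} {z : ℂ} (hi : ‖z - basePoint.1 i‖ ≤ 3 / 2)
    (hj : ‖z - basePoint.1 j‖ ≤ 3 / 2) : i = j := by
  by_contra h
  have h2 := norm_sub_le_norm_sub_add_norm_sub (basePoint.1 i) z (basePoint.1 j)
  rw [norm_sub_rev (basePoint.1 i) z] at h2
  linarith [norm_basePoint_sub_ge h]

lemma norm_lt_of_near {i : Fin 3} {z : ℂ} (hz : ‖z - basePoint.1 i‖ ≤ 3 / 2) : ‖z‖ < 9 := by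
  linarith [norm_basePoint_le i, norm_sub_norm_le z (basePoint.1 i)]

lemma norm_add_radial_sub_lt (i : Fin 3) (w : ℂ) :
    ‖basePoint.1 i + radial w - basePoint.1 i‖ < 3 / 2 := by
  rw [add_sub_cancel_left]
  exact norm_radial_lt w

lemma norm_add_radial_lt (i : Fin 3) (w : ℂ) : ‖basePoint.1 i + radial w‖ < 9 :=
  norm_lt_of_near (norm_add_radial_sub_lt i w).le

/-- The disk that is bounded by the outer boundary of the page. -/
abbrev Disk : Type := Metric.closedBall (0 : ℂ) 10

lemma Disk.norm_le (z : Disk) : ‖(z : ℂ)‖ ≤ 10 := mem_closedBall_zero_iff.1 z.2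

lemma fourHoledSphere_subset : fourHoledSphere ⊆ Metric.closedBall 0 10 := fun _ hz =>
  mem_closedBall_zero_iff.2 (mem_fourHoledSphere_iff.1 hz).1

/-- The inclusion of the page in the disk. -/
def toDisk : fourHoledSphere → Disk := Set.inclusion fourHoledSphere_subset

lemma toDisk_injective : Function.Injective toDisk := Set.inclusion_injective fourHoledSphere_subset

@[fun_prop]
lemma continuous_toDisk : Continuous toDisk := continuous_inclusion fourHoledSphere_subset

lemma isClosed_fourHoledSphere : IsClosed fourHoledSphere := by
  have h : fourHoledSphere = {z | ‖z‖ ≤ 10} ∩ ⋂ i, {z | 1 ≤ ‖z - basePoint.1 i‖} := by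
    ext z
    simp [mem_fourHoledSphere_iff]
  rw [h]
  exact (isClosed_le continuous_norm continuous_const).inter
    (isClosed_iInter fun i => isClosed_le continuous_const (by fun_prop))

instance : CompactSpace fourHoledSphere :=
  isCompact_iff_compactSpace.1 (Metric.isCompact_of_isClosed_isBounded isClosed_fourHoledSphere
    (Metric.isBounded_closedBall.subset fourHoledSphere_subset))

lemma mem_interior_fourHoledSphere {z : ℂ} (h : ‖z‖ < 10) (h' : ∀ i, 1 < ‖z - basePoint.1 i‖) :
    z ∈ interior fourHoledSphere := by
  have ho : IsOpen ({z : ℂ | ‖z‖ < 10} ∩ ⋂ i, {z | 1 < ‖z - basePoint.1 i‖}) :=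
    (isOpen_lt continuous_norm continuous_const).inter
      (isOpen_iInter_of_finite fun i => isOpen_lt continuous_const (by fun_prop))
  refine mem_interior.2 ⟨_, fun w hw => ?_, ho, ⟨h, Set.mem_iInter.2 h'⟩⟩
  exact mem_fourHoledSphere_iff.2 ⟨le_of_lt hw.1, fun i => le_of_lt (Set.mem_iInter.1 hw.2 i)⟩

lemma frontier_cases {z : ℂ} (h : z ∈ fourHoledSphere) (hf : z ∈ frontier fourHoledSphere) :
    ‖z‖ = 10 ∨ ∃ i, ‖z - basePoint.1 i‖ = 1 := by
  by_contra! hn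
  obtain ⟨h1, h2⟩ := mem_fourHoledSphere_iff.1 h
  exact hf.2 (mem_interior_fourHoledSphere (lt_of_le_of_ne h1 hn.1)
    fun i => lt_of_le_of_ne (h2 i) (hn.2 i).symm)

lemma mem_frontier_of_norm {z : ℂ} (h : z ∈ fourHoledSphere) (hz : ‖z‖ = 10) :
    z ∈ frontier fourHoledSphere := by
  refine ⟨subset_closure h, fun hi => ?_⟩
  have hball := interior_mono fourHoledSphere_subset hi
  rw [interior_closedBall _ (by norm_num), mem_ball_zero_iff] at hball
  exact hball.ne hz

lemma mem_frontier_of_hole {z : ℂ} (h : z ∈ fourHoledSphere) {i : Fin 3}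
    (hz : ‖z - basePoint.1 i‖ = 1) : z ∈ frontier fourHoledSphere := by
  refine ⟨subset_closure h, fun hi => ?_⟩
  have hsub : fourHoledSphere ⊆ (Metric.ball (basePoint.1 i) 1)ᶜ := fun w hw hw' =>
    ((mem_fourHoledSphere_iff.1 hw).2 i).not_gt (mem_ball_iff_norm.1 hw')
  have hball := interior_mono hsub hi
  rw [interior_compl, closure_ball _ one_ne_zero, Set.mem_compl_iff, mem_closedBall_iff_norm]
    at hball
  exact hball hz.le

/-! ### Open books of isotopic homeomorphisms -/

/-- The homeomorphism of quotients that is induced by a homeomorphism compatible with the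
relations. -/
def quotHomeo {A B : Type*} [TopologicalSpace A] [TopologicalSpace B] {r : A → A → Prop}
    {s : B → B → Prop} (k : A ≃ₜ B) (h : ∀ a a', r a a' → Quot.mk s (k a) = Quot.mk s (k a'))
    (h' : ∀ b b', s b b' → Quot.mk r (k.symm b) = Quot.mk r (k.symm b')) : Quot r ≃ₜ Quot s where
  toFun := Quot.lift (fun a => Quot.mk s (k a)) h
  invFun := Quot.lift (fun b => Quot.mk r (k.symm b)) h'
  left_inv := by
    rintro ⟨a⟩
    exact congrArg (Quot.mk r) (k.symm_apply_apply a)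
  right_inv := by
    rintro ⟨b⟩
    exact congrArg (Quot.mk s) (k.apply_symm_apply b)
  continuous_toFun := continuous_quot_lift _ (continuous_quot_mk.comp k.continuous)
  continuous_invFun := continuous_quot_lift _ (continuous_quot_mk.comp k.symm.continuous)

lemma openBook_glue {S : Set ℂ} (φ : RelHomeo S) (x : S) :
    (Quot.mk (OpenBookRel φ) (x, 1) : OpenBook φ) = Quot.mk _ ((φ : S ≃ₜ S) x, 0) :=
  Quot.sound (.glue x)

lemma openBook_collapse {S : Set ℂ} (φ : RelHomeo S) (x : S) (hx : (x : ℂ) ∈ frontier S)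
    (s t : I) : (Quot.mk (OpenBookRel φ) (x, s) : OpenBook φ) = Quot.mk _ (x, t) :=
  Quot.sound (.collapse x hx s t)

lemma openBook_eq_of_rel {S : Set ℂ} {φ ψ : RelHomeo S} {G : I → RelHomeo S} (h0 : G 0 = 1)
    (h1 : ψ * G 1 = φ) {p q : S × I} (h : OpenBookRel φ p q) :
    (Quot.mk _ ((G p.2 : S ≃ₜ S) p.1, p.2) : OpenBook ψ) =
      Quot.mk _ ((G q.2 : S ≃ₜ S) q.1, q.2) := by
  obtain x | ⟨x, hx, s, t⟩ := h
  · rw [openBook_glue, h0, ← h1]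
    rfl
  · rw [(G s).2 x hx, (G t).2 x hx]
    exact openBook_collapse ψ x hx s t

/-- The homeomorphism of open books that is induced by an isotopy `G` from the identity to
`ψ⁻¹ * φ`. -/
def openBookHomeo {S : Set ℂ} [CompactSpace S] {φ ψ : RelHomeo S} {G : I → RelHomeo S}
    (hG : Continuous fun p : I × S => (G p.1 : S ≃ₜ S) p.2) (h0 : G 0 = 1) (h1 : ψ * G 1 = φ) :
    OpenBook φ ≃ₜ OpenBook ψ :=
  quotHomeo
    (Continuous.homeoOfEquivCompactToT2
      (f := { toFun := fun p : S × I => ((G p.2 : S ≃ₜ S) p.1, p.2)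
              invFun := fun p => ((G p.2 : S ≃ₜ S).symm p.1, p.2)
              left_inv := fun p => by simp
              right_inv := fun p => by simp })
      ((hG.comp continuous_swap).prodMk continuous_snd))
    (fun _ _ h => openBook_eq_of_rel h0 h1 h)
    (fun _ _ h => openBook_eq_of_rel (G := fun t => (G t)⁻¹) (inv_eq_one.2 h0)
      (mul_inv_eq_of_eq_mul h1.symm) h)

lemma exists_openBook_homeo {S : Set ℂ} [CompactSpace S] {φ ψ : RelHomeo S}
    (h : mappingClass φ = mappingClass ψ) : ∃ k : OpenBook φ ≃ₜ OpenBook ψ,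
      ∀ (x : S) (t : I), (t : ℝ) ≤ 1 / 2 → k (Quot.mk _ (x, t)) = Quot.mk _ (x, t) := by
  obtain ⟨F, hF, hF0, hF1⟩ := mappingClass_eq_iff.1 h.symm
  have hstart {t : I} (ht : (t : ℝ) ≤ 1 / 2) : F (clamp (2 * t - 1)) = 1 := by
    rw [clamp_of_nonpos (by linarith), hF0]
  refine ⟨openBookHomeo (G := fun t => F (clamp (2 * t - 1))) ?_ ?_ ?_, fun x t ht => ?_⟩
  · exact hF.comp (f := fun p : I × S => (clamp (2 * p.1 - 1), p.2)) (by fun_prop)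
  · exact hstart (by norm_num)
  · rw [clamp_of_one_le (by norm_num), hF1, mul_inv_cancel_left]
  · change Quot.mk _ ((F (clamp (2 * t - 1)) : S ≃ₜ S) x, t) = _
    rw [hstart ht]
    rfl

/-! ### The position of the pages in the three-sphere -/

/-- The distance to the outer boundary, cut off at `1`. -/
def height (z : ℂ) : ℝ := min 1 (10 - ‖z‖)

@[fun_prop]
lemma continuous_height : Continuous height := by
  unfold height
  fun_prop

lemma height_of_le {z : ℂ} (h : ‖z‖ ≤ 9) : height z = 1 := min_eq_left (by linarith)

lemma height_of_ge {z : ℂ} (h : 9 ≤ ‖z‖) : height z = 10 - ‖z‖ := min_eq_right (by linarith)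

lemma height_pos {z : ℂ} (h : ‖z‖ < 10) : 0 < height z := lt_min one_pos (by linarith)

lemma height_of_eq {z : ℂ} (h : ‖z‖ = 10) : height z = 0 := by
  rw [height_of_ge (by linarith), h, sub_self]

namespace Motion

variable (m : Motion)

lemma norm_toHomeo_lt (t : ℝ) {z : ℂ} (h : ‖z‖ < 9) : ‖m.toHomeo t z‖ < 9 := by
  by_contra h'
  have h1 := m.outer t _ (not_lt.1 h')
  rw [(m.toHomeo t).injective h1] at h'
  exact h' h

lemma norm_toHomeo_le (t : ℝ) {z : ℂ} (h : ‖z‖ ≤ 9) : ‖m.toHomeo t z‖ ≤ 9 := by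
  rcases lt_or_eq_of_le h with h | h
  · exact (m.norm_toHomeo_lt t h).le
  · rw [m.outer t z h.ge, h]

lemma height_toHomeo (t : ℝ) (z : ℂ) : height (m.toHomeo t z) = height z := by
  rcases le_total ‖z‖ 9 with h | h
  · rw [height_of_le h, height_of_le (m.norm_toHomeo_le t h)]
  · rw [m.outer t _ h]

/-- The position of the point `z` of the page at the time `t`. -/
def position (t : ℝ) (z : ℂ) : ℂ := m.toHomeo t z / height z

lemma position_of_le (t : ℝ) {z : ℂ} (h : ‖z‖ ≤ 9) : m.position t z = m.toHomeo t z := by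
  rw [position, height_of_le h, Complex.ofReal_one, div_one]

lemma position_of_ge (t : ℝ) {z : ℂ} (h : 9 ≤ ‖z‖) :
    m.position t z = z / (10 - ‖z‖ : ℝ) := by
  rw [position, height_of_ge h, m.outer t z h]

lemma norm_position_of_ge (t : ℝ) {z : ℂ} (h : 9 ≤ ‖z‖) (h' : ‖z‖ < 10) :
    ‖m.position t z‖ = ‖z‖ / (10 - ‖z‖) := by
  rw [m.position_of_ge t h, norm_div, Complex.norm_real, Real.norm_of_nonneg (by linarith)]

lemma norm_position_gt (t : ℝ) {z : ℂ} (h : 9 < ‖z‖) (h' : ‖z‖ < 10) :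
    9 < ‖m.position t z‖ := by
  rw [m.norm_position_of_ge t h.le h', lt_div_iff₀ (by linarith)]
  linarith

lemma position_injOn (t : ℝ) {z z' : ℂ} (hz : ‖z‖ < 10) (hz' : ‖z'‖ < 10)
    (h : m.position t z = m.position t z') : z = z' := by
  rcases le_or_gt ‖z‖ 9 with h1 | h1 <;> rcases le_or_gt ‖z'‖ 9 with h2 | h2
  · rw [m.position_of_le t h1, m.position_of_le t h2] at h
    exact (m.toHomeo t).injective h
  · have h3 := m.norm_position_gt t h2 hz'
    rw [← h, m.position_of_le t h1] at h3
    exact absurd (m.norm_toHomeo_le t h1) (not_le.2 h3)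
  · have h3 := m.norm_position_gt t h1 hz
    rw [h, m.position_of_le t h2] at h3
    exact absurd (m.norm_toHomeo_le t h2) (not_le.2 h3)
  · have h3 := congrArg norm h
    rw [m.norm_position_of_ge t h1.le hz, m.norm_position_of_ge t h2.le hz',
      div_eq_div_iff (by linarith) (by linarith)] at h3
    have h4 : ‖z‖ = ‖z'‖ := by linarith
    have h5 : ((10 - ‖z'‖ : ℝ) : ℂ) ≠ 0 := Complex.ofReal_ne_zero.2 (by linarith)
    rw [m.position_of_ge t h1.le, m.position_of_ge t h2.le, h4] at h
    exact (div_left_inj' h5).1 h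

lemma exists_position_eq (t : ℝ) (ζ : ℂ) : ∃ z, ‖z‖ < 10 ∧ m.position t z = ζ := by
  rcases le_or_gt ‖ζ‖ 9 with h | h
  · obtain ⟨z, rfl⟩ := (m.toHomeo t).surjective ζ
    have hz : ‖z‖ ≤ 9 := by
      by_contra! hz
      rw [m.outer t z hz.le] at h
      exact h.not_gt hz
    exact ⟨z, by linarith, m.position_of_le t hz⟩
  · -- `z ↦ z / (10 - ‖z‖)` has the inverse `ζ ↦ 10 / (1 + ‖ζ‖) * ζ`.
    have hp : 0 < 1 + ‖ζ‖ := by linarith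
    have hn : ‖((10 / (1 + ‖ζ‖) : ℝ) : ℂ) * ζ‖ = 10 * ‖ζ‖ / (1 + ‖ζ‖) := by
      rw [norm_mul, Complex.norm_real, Real.norm_of_nonneg (by positivity), div_mul_eq_mul_div]
    have h9 : 9 ≤ 10 * ‖ζ‖ / (1 + ‖ζ‖) := by
      rw [le_div_iff₀ hp]
      linarith
    refine ⟨((10 / (1 + ‖ζ‖) : ℝ) : ℂ) * ζ, ?_, ?_⟩
    · rw [hn, div_lt_iff₀ hp]
      linarith
    · have hinv : 10 - 10 * ‖ζ‖ / (1 + ‖ζ‖) = 10 / (1 + ‖ζ‖) := by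
        field_simp
        ring
      rw [m.position_of_ge t (hn.symm ▸ h9), hn, hinv, mul_div_cancel_left₀]
      exact Complex.ofReal_ne_zero.2 (by positivity)

lemma page_ne_zero (t : ℝ) {z : ℂ} (hz : ‖z‖ ≤ 10) :
    m.toHomeo t z ≠ 0 ∨ (height z : ℂ) * turn t ≠ 0 := by
  rcases lt_or_eq_of_le hz with h | h
  · exact Or.inr (mul_ne_zero (Complex.ofReal_ne_zero.2 (height_pos h).ne') (Circle.coe_ne_zero _))
  · left
    rw [m.outer t z (by linarith), ← norm_pos_iff]
    linarith

/-- The point of the three-sphere that belongs to the point `z` of the disk at the time `t`. The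
disks for the different times are the pages of the open book of the three-sphere with disk pages,
deformed by the motion. -/
def page (z : Disk) (t : I) : S3 :=
  proj (m.toHomeo t z) (height z * turn t) (m.page_ne_zero t z.norm_le)

lemma continuous_page : Continuous fun p : Disk × I => m.page p.1 p.2 := by
  have h : Continuous fun p : Disk × I => m.toHomeo p.2 p.1 :=
    m.continuous_toHomeo.comp (f := fun p : Disk × I => ((p.2 : ℝ), (p.1 : ℂ))) (by fun_prop)
  exact continuous_proj h (by fun_prop) _

lemma page_of_lt {z : Disk} (hz : ‖(z : ℂ)‖ < 10) (t : I) :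
    m.page z t = cyl (turn t, m.position t z) := by
  have h : (height z : ℂ) ≠ 0 := Complex.ofReal_ne_zero.2 (height_pos hz).ne'
  exact proj_eq_iff.2 ⟨height z, height_pos hz, (mul_div_cancel₀ _ h).symm, rfl⟩

lemma page_apply_one_eq_zero_iff {z : Disk} {t : I} : (m.page z t).1 1 = 0 ↔ ‖(z : ℂ)‖ = 10 := by
  refine ⟨fun h => z.norm_le.eq_of_not_lt fun hz => ?_, fun h => ?_⟩
  · rw [m.page_of_lt hz] at h
    exact cyl_one_ne_zero _ h
  · rw [page, proj_one, height_of_eq h, Complex.ofReal_zero, zero_mul, mul_zero]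

lemma page_eq_of_norm {z : Disk} (hz : ‖(z : ℂ)‖ = 10) (s t : I) : m.page z s = m.page z t := by
  refine proj_congr ?_ ?_
  · rw [m.outer _ _ (by linarith), m.outer _ _ (by linarith)]
  · rw [height_of_eq hz, Complex.ofReal_zero, zero_mul, zero_mul]

lemma turn_eq_of_page_eq {z z' : Disk} {t t' : I} (hz : ‖(z : ℂ)‖ < 10)
    (h : m.page z t = m.page z' t') : turn t = turn t' := by
  have hz' : ‖(z' : ℂ)‖ < 10 := z'.norm_le.lt_of_ne fun h' =>
    hz.ne (m.page_apply_one_eq_zero_iff.1 (h.symm ▸ m.page_apply_one_eq_zero_iff.2 h'))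
  rw [m.page_of_lt hz, m.page_of_lt hz'] at h
  exact congrArg Prod.fst (cyl_injective h)

lemma page_injective (t : I) : Function.Injective (m.page · t) := by
  intro z z' (h : m.page z t = m.page z' t)
  have hnorm : ‖(z : ℂ)‖ = 10 ↔ ‖(z' : ℂ)‖ = 10 := by
    rw [← m.page_apply_one_eq_zero_iff (t := t), h, m.page_apply_one_eq_zero_iff]
  refine Subtype.ext ?_
  rcases z.norm_le.eq_or_lt with hz | hz
  · have hz' := hnorm.1 hz
    obtain ⟨r, hr, h, -⟩ := proj_eq_iff.1 h
    rw [m.outer t _ (by linarith), m.outer t _ (by linarith)] at h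
    have hr1 := congrArg norm h
    rw [norm_mul, Complex.norm_real, Real.norm_of_nonneg hr.le, hz, hz'] at hr1
    rwa [show r = 1 by linarith, Complex.ofReal_one, one_mul] at h
  · have hz' := z'.norm_le.lt_of_ne (mt hnorm.2 hz.ne)
    rw [m.page_of_lt hz, m.page_of_lt hz'] at h
    exact m.position_injOn t hz hz' (congrArg Prod.snd (cyl_injective h))

lemma exists_page_eq (y : S3) : ∃ z t, m.page z t = y := by
  by_cases hy : y.1 1 = 0
  · have hnorm : ‖10 * y.1 0‖ = 10 := by
      have h := s3_norm y
      rw [hy, norm_zero, zero_pow two_ne_zero, add_zero,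
        pow_eq_one_iff_of_nonneg (norm_nonneg _) two_ne_zero] at h
      rw [norm_mul, h]
      norm_num
    refine ⟨⟨10 * y.1 0, mem_closedBall_zero_iff.2 hnorm.le⟩, 0,
      Eq.trans (proj_eq_iff.2 ⟨10, by norm_num, ?_, ?_⟩) (proj_self y)⟩
    · rw [m.outer _ _ (by linarith)]
      norm_num
    · rw [height_of_eq hnorm, hy, Complex.ofReal_zero, zero_mul, mul_zero]
  · obtain ⟨z, hz, hp⟩ := m.exists_position_eq (time (cylInv y).1) (cylInv y).2
    refine ⟨⟨z, mem_closedBall_zero_iff.2 hz.le⟩, time (cylInv y).1, ?_⟩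
    rw [m.page_of_lt hz, hp, turn_time]
    exact cyl_cylInv hy

lemma toHomeo_time_turn {i : Fin 3} {z : ℂ} (hz : ‖z - basePoint.1 i‖ ≤ 3 / 2) (t : I) :
    m.toHomeo (time (turn t)) z = m.toHomeo t z := by
  refine apply_time_turn (f := fun t : I => m.toHomeo t z) ?_ t
  rw [Set.Icc.coe_zero, Set.Icc.coe_one, m.start _ le_rfl, m.finish_disk hz]

lemma tubeFun_turn (i : Fin 3) (t : I) (w : ℂ) :
    m.tubeFun i (turn t, w) = cyl (turn t, m.position t (basePoint.1 i + radial w)) := by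
  rw [tubeFun_eq, m.toHomeo_time_turn (norm_add_radial_sub_lt i w).le,
    m.position_of_le t (norm_add_radial_lt i w).le]

lemma page_eq_tubeFun {i : Fin 3} {w : ℂ} {z : Disk} (t : I)
    (h : (z : ℂ) = basePoint.1 i + radial w) : m.page z t = m.tubeFun i (turn t, w) := by
  rw [m.page_of_lt (by rw [h]; linarith [norm_add_radial_lt i w]), tubeFun_turn, h]

lemma eq_of_tubeFun_eq_page {i : Fin 3} {u : Circle} {w : ℂ} {z : Disk} {t : I}
    (h : m.tubeFun i (u, w) = m.page z t) : (z : ℂ) = basePoint.1 i + radial w := by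
  let z' : Disk := ⟨basePoint.1 i + radial w,
    mem_closedBall_zero_iff.2 (by linarith [norm_add_radial_lt i w])⟩
  have hz' : m.page z' (time u) = m.page z t := by rw [← h, m.page_eq_tubeFun _ rfl, turn_time]
  have hu : u = turn t := by
    rw [← m.turn_eq_of_page_eq (by linarith [norm_add_radial_lt i w]) hz', turn_time]
  rw [hu, ← m.page_eq_tubeFun (z := z') t rfl] at h
  exact congrArg Subtype.val (m.page_injective t h).symm

variable {φ : RelHomeo fourHoledSphere} (hφ : m.EndsAt φ)
include hφ

lemma page_monodromy (x : fourHoledSphere) :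
    m.page (toDisk x) 1 = m.page (toDisk ((φ : fourHoledSphere ≃ₜ fourHoledSphere) x)) 0 := by
  refine proj_congr ?_ ?_
  · rw [Set.Icc.coe_one, Set.Icc.coe_zero, m.start _ le_rfl]
    exact hφ x
  · change (height x : ℂ) * _ = height ((φ : fourHoledSphere ≃ₜ fourHoledSphere) x) * _
    rw [Set.Icc.coe_one, Set.Icc.coe_zero, turn_one, turn_zero, ← hφ, m.height_toHomeo]

lemma openBook_eq_of_page_eq {x x' : fourHoledSphere} {t t' : I}
    (h : m.page (toDisk x) t = m.page (toDisk x') t') :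
    (Quot.mk _ (x, t) : OpenBook φ) = Quot.mk _ (x', t') := by
  have same {x x' : fourHoledSphere} {t : I} (h : m.page (toDisk x) t = m.page (toDisk x') t) :
      x = x' := toDisk_injective (m.page_injective t h)
  rcases (toDisk x).norm_le.eq_or_lt with hx | hx
  · rw [m.page_eq_of_norm hx t t'] at h
    rw [openBook_collapse φ x (mem_frontier_of_norm x.2 hx) t t', same h]
  · rcases turn_eq_cases (m.turn_eq_of_page_eq hx h) with rfl | ⟨rfl, rfl⟩ | ⟨rfl, rfl⟩
    · rw [same h]
    · rw [m.page_monodromy hφ] at h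
      rw [openBook_glue, same h]
    · rw [m.page_monodromy hφ] at h
      rw [openBook_glue, same h]

end Motion

/-! ### The open book of a motion is the result of the surgery on its closed braid -/

lemma exists_quotMap {W A B : Type*} [TopologicalSpace W] [TopologicalSpace A]
    [TopologicalSpace B] {p : W → A} {q : W → B} (hp : Topology.IsQuotientMap p)
    (hq : Continuous q) {r : A → A → Prop} {s : B → B → Prop}
    (hpq : ∀ a b, p a = p b → Quot.mk s (q a) = Quot.mk s (q b))
    (hr : ∀ x y, r x y → ∃ a b, p a = x ∧ p b = y ∧ Quot.mk s (q a) = Quot.mk s (q b)) :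
    ∃ f : C(Quot r, Quot s), ∀ w, f (Quot.mk r (p w)) = Quot.mk s (q w) := by
  have hf (w : W) : Quot.mk s (q (Function.surjInv hp.surjective (p w))) = Quot.mk s (q w) :=
    hpq _ _ (Function.surjInv_eq _ _)
  refine ⟨⟨Quot.lift (fun a => Quot.mk s (q (Function.surjInv hp.surjective a))) ?_, ?_⟩, hf⟩
  · intro x y h
    obtain ⟨a, b, rfl, rfl, hab⟩ := hr x y h
    rw [hf, hf, hab]
  · refine continuous_quot_lift _ (hp.continuous_iff.2 ?_)
    exact (continuous_quot_mk.comp hq).congr fun w => (hf w).symm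

lemma exists_quotHomeo {W A B : Type*} [TopologicalSpace W] [TopologicalSpace A]
    [TopologicalSpace B] {p : W → A} {q : W → B} (hp : Topology.IsQuotientMap p)
    (hq : Topology.IsQuotientMap q) {r : A → A → Prop} {s : B → B → Prop}
    (hpq : ∀ a b, p a = p b → Quot.mk s (q a) = Quot.mk s (q b))
    (hqp : ∀ a b, q a = q b → Quot.mk r (p a) = Quot.mk r (p b))
    (hr : ∀ x y, r x y → ∃ a b, p a = x ∧ p b = y ∧ Quot.mk s (q a) = Quot.mk s (q b))
    (hs : ∀ x y, s x y → ∃ a b, q a = x ∧ q b = y ∧ Quot.mk r (p a) = Quot.mk r (p b)) :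
    ∃ h : Quot r ≃ₜ Quot s, ∀ w, h (Quot.mk r (p w)) = Quot.mk s (q w) := by
  obtain ⟨f, hf⟩ := exists_quotMap hp hq.continuous hpq hr
  obtain ⟨g, hg⟩ := exists_quotMap hq hp.continuous hqp hs
  refine ⟨⟨⟨f, g, ?_, ?_⟩, f.continuous, g.continuous⟩, hf⟩
  · rintro ⟨x⟩
    obtain ⟨w, rfl⟩ := hp.surjective x
    rw [hf, hg]
  · rintro ⟨x⟩
    obtain ⟨w, rfl⟩ := hq.surjective x
    rw [hg, hf]

instance {n : ℕ} {K : Fin n → Set S3} (e : ∀ i, Tube (K i)) : T2Space (Exterior e) :=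
  inferInstanceAs (T2Space {x : S3 // ∀ i u w, ‖w‖ < 1 → (e i).toFun (u, w) ≠ x})

/-- The point `z` does not lie in the collars of the holes. -/
def IsFar (z : ℂ) : Prop := ∀ i, 5 / 4 ≤ ‖z - basePoint.1 i‖

/-- The part of the product of the page and the interval that is far from the holes. -/
abbrev FarPart : Type := {p : fourHoledSphere × I // IsFar p.1}

instance : CompactSpace FarPart := by
  have h : IsClosed {p : fourHoledSphere × I | IsFar p.1} := by
    simp only [IsFar, Set.ofPred_forall]
    exact isClosed_iInter fun i => isClosed_le continuous_const (by fun_prop)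
  exact isCompact_iff_compactSpace.1 h.isCompact

/-- The collar of the boundary of a hole, in coordinates centred at the hole. -/
abbrev Collar : Type := {w : ℂ // 1 ≤ ‖w‖ ∧ ‖w‖ ≤ 5 / 4}

instance : CompactSpace Collar := by
  refine isCompact_iff_compactSpace.1 (Metric.isCompact_of_isClosed_isBounded ?_ ?_)
  · exact (isClosed_le continuous_const continuous_norm).inter
      (isClosed_le continuous_norm continuous_const)
  · exact (Metric.isBounded_closedBall (x := (0 : ℂ)) (r := 5 / 4)).subset fun z hz =>
      mem_closedBall_zero_iff.2 hz.2

namespace Collar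

lemma ne_zero (w : Collar) : w.1 ≠ 0 := norm_pos_iff.1 (by linarith [w.2.1])

lemma add_mem (i : Fin 3) (w : Collar) : basePoint.1 i + w.1 ∈ fourHoledSphere := by
  have h1 := w.2.1
  have h2 := w.2.2
  refine mem_fourHoledSphere_iff.2 ⟨?_, fun j => ?_⟩
  · linarith [norm_add_le (basePoint.1 i) w.1, norm_basePoint_le i]
  · rcases eq_or_ne i j with rfl | h
    · rwa [add_sub_cancel_left]
    · have h3 := norm_sub_le (basePoint.1 i + w.1 - basePoint.1 j) w.1
      rw [sub_right_comm, add_sub_cancel_right] at h3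
      linarith [norm_basePoint_sub_ge h]

/-- The point of the page with coordinate `w` in the collar of the hole `i`. -/
def point (i : Fin 3) (w : Collar) : fourHoledSphere := ⟨basePoint.1 i + w.1, w.add_mem i⟩

lemma point_sub (i : Fin 3) (w : Collar) : (w.point i : ℂ) - basePoint.1 i = w.1 :=
  add_sub_cancel_left _ _

lemma norm_point_sub_le (i : Fin 3) (w : Collar) : ‖(w.point i : ℂ) - basePoint.1 i‖ ≤ 3 / 2 := by
  rw [point_sub]
  linarith [w.2.2]

lemma isFar_point {w : Collar} (hw : ‖w.1‖ = 5 / 4) (i : Fin 3) : IsFar (w.point i) := by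
  intro j
  by_contra! h
  obtain rfl : j = i := eq_of_near (h.le.trans (by norm_num)) (w.norm_point_sub_le i)
  rw [point_sub] at h
  exact h.ne hw

lemma norm_of_isFar {w : Collar} {i : Fin 3} (h : IsFar (w.point i)) : ‖w.1‖ = 5 / 4 := by
  have hi := h i
  rw [point_sub] at hi
  exact le_antisymm w.2.2 hi

lemma eq_of_point_eq {i j : Fin 3} {w w' : Collar} (h : w.point i = w'.point j) :
    i = j ∧ w = w' := by
  obtain rfl : i = j := eq_of_near (w.norm_point_sub_le i) (h ▸ w'.norm_point_sub_le j)
  exact ⟨rfl, Subtype.ext (add_left_cancel (congrArg Subtype.val h))⟩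

lemma exists_point_eq {x : fourHoledSphere} {i : Fin 3} (h : ‖(x : ℂ) - basePoint.1 i‖ ≤ 5 / 4) :
    ∃ w : Collar, w.point i = x :=
  ⟨⟨x - basePoint.1 i, (mem_fourHoledSphere_iff.1 x.2).2 i, h⟩,
    Subtype.ext (add_sub_cancel _ _)⟩

lemma isFar_or_exists_point_eq (x : fourHoledSphere) :
    IsFar x ∨ ∃ (i : Fin 3) (w : Collar), w.point i = x := by
  by_cases h : IsFar x
  · exact Or.inl h
  · obtain ⟨i, hi⟩ := not_forall.1 h
    exact Or.inr ⟨i, exists_point_eq (not_le.1 hi).le⟩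

/-- The point of the solid torus that belongs to a point of the collar at the time `t`: the
distance to the hole is the radius in the meridian disk, and the time is the angle. -/
def toTorus (w : Collar) (t : I) : Metric.closedBall (0 : ℂ) 1 × Circle :=
  (⟨(4 * (‖w.1‖ - 1) : ℝ) * turn t, by
    have h1 := w.2.1
    have h2 := w.2.2
    rw [mem_closedBall_zero_iff, norm_mul, Circle.norm_coe, mul_one, Complex.norm_real,
      Real.norm_of_nonneg (by linarith)]
    linarith⟩, direction w.1)

lemma coe_toTorus_fst (w : Collar) (t : I) :
    ((w.toTorus t).1 : ℂ) = (4 * (‖w.1‖ - 1) : ℝ) * turn t := rfl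

lemma continuous_toTorus : Continuous fun p : Collar × I => p.1.toTorus p.2 := by
  refine Continuous.prodMk (Continuous.subtype_mk (by fun_prop) _) ?_
  exact continuousOn_direction.comp_continuous (by fun_prop) fun p => p.1.ne_zero

lemma toTorus_one (w : Collar) : w.toTorus 1 = w.toTorus 0 := by
  refine Prod.ext (Subtype.ext ?_) rfl
  rw [coe_toTorus_fst, coe_toTorus_fst, Set.Icc.coe_one, Set.Icc.coe_zero, turn_one, turn_zero]

lemma toTorus_eq_of_norm {w : Collar} (hw : ‖w.1‖ = 1) (s t : I) :
    w.toTorus s = w.toTorus t := by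
  refine Prod.ext (Subtype.ext ?_) rfl
  rw [coe_toTorus_fst, coe_toTorus_fst, hw, sub_self, mul_zero, Complex.ofReal_zero, zero_mul,
    zero_mul]

lemma eq_of_toTorus_eq {w w' : Collar} {t t' : I} (h : w.toTorus t = w'.toTorus t') :
    w = w' ∧ (‖w.1‖ = 1 ∨ turn t = turn t') := by
  have h1 : ((4 * (‖w.1‖ - 1) : ℝ) : ℂ) * turn t = (4 * (‖w'.1‖ - 1) : ℝ) * turn t' :=
    congrArg (fun p => (p.1 : ℂ)) h
  have h2 : direction w.1 = direction w'.1 := congrArg Prod.snd h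
  have hn := congrArg norm h1
  rw [norm_mul, norm_mul, Circle.norm_coe, Circle.norm_coe, Complex.norm_real, Complex.norm_real,
    Real.norm_of_nonneg (by linarith [w.2.1]), Real.norm_of_nonneg (by linarith [w'.2.1])] at hn
  replace hn : ‖w.1‖ = ‖w'.1‖ := by linarith
  refine ⟨Subtype.ext ?_, or_iff_not_imp_left.2 fun hne => ?_⟩
  · rw [← norm_mul_direction w.1, ← norm_mul_direction w'.1, hn, h2]
  · rw [hn] at h1 hne
    have h0 : ((4 * (‖w'.1‖ - 1) : ℝ) : ℂ) ≠ 0 :=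
      Complex.ofReal_ne_zero.2 (mul_ne_zero four_ne_zero (sub_ne_zero.2 hne))
    exact Subtype.ext (mul_left_cancel₀ h0 h1)

lemma exists_toTorus_eq (d : Metric.closedBall (0 : ℂ) 1) {u : Circle}
    (hu : (‖(d : ℂ)‖ : ℂ) * u = d) (v : Circle) :
    ∃ w : Collar, w.1 = (1 + ‖(d : ℂ)‖ / 4 : ℝ) * v ∧ w.toTorus (time u) = (d, v) := by
  have hd := mem_closedBall_zero_iff.1 d.2
  have hpos : 0 < 1 + ‖(d : ℂ)‖ / 4 := by positivity
  have hn : ‖((1 + ‖(d : ℂ)‖ / 4 : ℝ) : ℂ) * v‖ = 1 + ‖(d : ℂ)‖ / 4 := by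
    rw [norm_mul, Circle.norm_coe, mul_one, Complex.norm_real, Real.norm_of_nonneg hpos.le]
  refine ⟨⟨_, hn.symm ▸ ⟨by linarith [norm_nonneg (d : ℂ)], by linarith⟩⟩, rfl,
    Prod.ext (Subtype.ext ?_) (direction_real_mul hpos v)⟩
  rw [coe_toTorus_fst, hn, turn_time, show 4 * (1 + ‖(d : ℂ)‖ / 4 - 1) = ‖(d : ℂ)‖ by ring, hu]

end Collar

/-- The disjoint union of the part far from the holes and the parts near the holes. -/
abbrev Pieces : Type := FarPart ⊕ (Fin 3 × Collar × I)

/-- The pieces cover the product of the page and the interval. -/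
def piecesToProduct : Pieces → fourHoledSphere × I :=
  Sum.elim Subtype.val fun p => (p.2.1.point p.1, p.2.2)

lemma isQuotientMap_piecesToProduct : Topology.IsQuotientMap piecesToProduct := by
  refine Topology.IsQuotientMap.of_surjective_continuous ?_ ?_
  · rintro ⟨x, t⟩
    rcases Collar.isFar_or_exists_point_eq x with hx | ⟨i, w, rfl⟩
    · exact ⟨Sum.inl ⟨(x, t), hx⟩, rfl⟩
    · exact ⟨Sum.inr (i, w, t), rfl⟩
  · refine Continuous.sumElim continuous_subtype_val ?_
    have h : Continuous fun p : Fin 3 × Collar × I => basePoint.1 p.1 :=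
      (continuous_of_discreteTopology (f := basePoint.1)).comp continuous_fst
    exact Continuous.prodMk (Continuous.subtype_mk (by fun_prop) _) (by fun_prop)

namespace Motion

variable {m : Motion} (hm : m.Delayed)

lemma disjoint_range_tube {i j : Fin 3} (hij : i ≠ j) :
    Disjoint (Set.range (tube i hm).toFun) (Set.range (tube j hm).toFun) := by
  rw [Set.disjoint_left]
  rintro _ ⟨⟨u, w⟩, rfl⟩ ⟨⟨u', w'⟩, h⟩
  change m.tubeFun j (u', w') = m.tubeFun i (u, w) at h
  rw [tubeFun_eq, tubeFun_eq] at h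
  obtain ⟨rfl, h⟩ := Prod.ext_iff.1 (cyl_injective h)
  have hz : basePoint.1 j + radial w' = basePoint.1 i + radial w := (m.toHomeo _).injective h
  exact hij (eq_of_near (norm_add_radial_sub_lt i w).le
    (hz ▸ (norm_add_radial_sub_lt j w').le))

lemma tube_ne_page {x : fourHoledSphere} (hx : IsFar x) (t : I) (i : Fin 3) (u : Circle) (w : ℂ)
    (hw : ‖w‖ < 1) : (tube i hm).toFun (u, w) ≠ m.page (toDisk x) t := by
  intro he
  have hx' : (x : ℂ) = basePoint.1 i + radial w := m.eq_of_tubeFun_eq_page he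
  have hi := hx i
  rw [hx', add_sub_cancel_left] at hi
  exact hi.not_gt (norm_radial_lt_iff.2 hw)

/-- The point of the exterior of the closed braid that belongs to a point of the far part. -/
def toExterior (p : FarPart) : Exterior (tube · hm) :=
  ⟨m.page (toDisk p.1.1) p.1.2, tube_ne_page hm p.2 _⟩

lemma toExterior_surjective : Function.Surjective (toExterior hm) := by
  rintro ⟨y, hy⟩
  obtain ⟨z, t, rfl⟩ := m.exists_page_eq y
  have hfar : IsFar z := by
    intro i
    by_contra! h
    have hz := radial_radialInv (y := z - basePoint.1 i) (by linarith)
    refine hy i (turn t) (radialInv (z - basePoint.1 i)) ?_ (m.page_eq_tubeFun t ?_).symm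
    · rwa [← norm_radial_lt_iff, hz]
    · rw [hz, add_sub_cancel]
  have hmem : (z : ℂ) ∈ fourHoledSphere :=
    mem_fourHoledSphere_iff.2 ⟨z.norm_le, fun i => by linarith [hfar i]⟩
  exact ⟨⟨(⟨z, hmem⟩, t), hfar⟩, rfl⟩

/-- The pieces cover the pieces of the surgered manifold. -/
def piecesToSurgery : Pieces →
    Exterior (tube · hm) ⊕ (Fin 3 × Metric.closedBall (0 : ℂ) 1 × Circle) :=
  Sum.map (toExterior hm) fun p => (p.1, p.2.1.toTorus p.2.2)

lemma isQuotientMap_piecesToSurgery : Topology.IsQuotientMap (piecesToSurgery hm) := by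
  refine Topology.IsQuotientMap.of_surjective_continuous ?_ ?_
  · refine (toExterior_surjective hm).sumMap ?_
    rintro ⟨i, d, v⟩
    obtain ⟨w, -, hw⟩ := Collar.exists_toTorus_eq d (norm_mul_direction d) v
    exact ⟨(i, w, _), Prod.ext rfl hw⟩
  · refine Continuous.sumMap ?_ ?_
    · exact (m.continuous_page.comp (f := fun p : FarPart => (toDisk p.1.1, p.1.2))
        (by fun_prop)).subtype_mk _
    · exact continuous_fst.prodMk (Collar.continuous_toTorus.comp continuous_snd)

lemma surgery_glue {w : Collar} {i : Fin 3} (hw : IsFar (w.point i)) (t : I) :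
    (Quot.mk _ (Sum.inr (i, w.toTorus t)) : Surgery (tube · hm)) =
      Quot.mk _ (Sum.inl (toExterior hm ⟨(w.point i, t), hw⟩)) := by
  have hn := Collar.norm_of_isFar hw
  refine Quot.sound (SurgeryRel.glue i _ (turn t) _ _ ?_ (m.page_eq_tubeFun t ?_))
  · change ((4 * (‖w.1‖ - 1) : ℝ) : ℂ) * _ = _
    rw [hn]
    norm_num
  · have hd := norm_mul_direction w.1
    rw [hn] at hd
    rw [radial_of_norm_one (Circle.norm_coe _)]
    exact congrArg (basePoint.1 i + ·) hd.symm

lemma surgery_eq_of_piecesToProduct_eq (a b : Pieces)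
    (h : piecesToProduct a = piecesToProduct b) :
    (Quot.mk _ (piecesToSurgery hm a) : Surgery (tube · hm)) =
      Quot.mk _ (piecesToSurgery hm b) := by
  rcases a with ⟨⟨x, t⟩, hx⟩ | ⟨i, w, t⟩ <;> rcases b with ⟨⟨x', t'⟩, hx'⟩ | ⟨j, w', t'⟩ <;>
    obtain ⟨hxx, rfl⟩ := Prod.ext_iff.1 h
  · obtain rfl : x = x' := hxx
    rfl
  · obtain rfl : x = w'.point j := hxx
    exact (surgery_glue hm hx t).symm
  · obtain rfl : w.point i = x' := hxx
    exact surgery_glue hm hx' t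
  · obtain ⟨rfl, rfl⟩ := Collar.eq_of_point_eq hxx
    rfl

variable {φ : RelHomeo fourHoledSphere} (hφ : m.EndsAt φ)

section

include hφ

lemma monodromy_of_near {x : fourHoledSphere} {i : Fin 3}
    (h : ‖(x : ℂ) - basePoint.1 i‖ ≤ 3 / 2) :
    (φ : fourHoledSphere ≃ₜ fourHoledSphere) x = x :=
  Subtype.ext (by rw [← hφ, m.finish_disk h])

lemma monodromy_point (i : Fin 3) (w : Collar) :
    (φ : fourHoledSphere ≃ₜ fourHoledSphere) (w.point i) = w.point i :=
  monodromy_of_near hφ (w.norm_point_sub_le i)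

lemma isFar_monodromy {x : fourHoledSphere} (hx : IsFar x) :
    IsFar ((φ : fourHoledSphere ≃ₜ fourHoledSphere) x) := by
  intro i
  by_contra! h
  have hxx := (φ : fourHoledSphere ≃ₜ fourHoledSphere).injective
    (monodromy_of_near hφ (h.le.trans (by norm_num)))
  rw [hxx] at h
  exact (hx i).not_gt h

lemma openBook_eq_of_toTorus_eq (i : Fin 3) {w w' : Collar} {t t' : I}
    (h : w.toTorus t = w'.toTorus t') :
    (Quot.mk _ (w.point i, t) : OpenBook φ) = Quot.mk _ (w'.point i, t') := by
  obtain ⟨rfl, hw | hu⟩ := Collar.eq_of_toTorus_eq h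
  · refine openBook_collapse φ _ (mem_frontier_of_hole (w.point i).2 (i := i) ?_) _ _
    rwa [Collar.point_sub]
  · rcases turn_eq_cases hu with rfl | ⟨rfl, rfl⟩ | ⟨rfl, rfl⟩
    · rfl
    · rw [openBook_glue, monodromy_point hφ]
    · rw [openBook_glue, monodromy_point hφ]

lemma openBook_eq_of_piecesToSurgery_eq (a b : Pieces)
    (h : piecesToSurgery hm a = piecesToSurgery hm b) :
    (Quot.mk _ (piecesToProduct a) : OpenBook φ) = Quot.mk _ (piecesToProduct b) := by
  rcases a with ⟨⟨x, t⟩, hx⟩ | ⟨i, w, t⟩ <;> rcases b with ⟨⟨x', t'⟩, hx'⟩ | ⟨j, w', t'⟩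
  · exact m.openBook_eq_of_page_eq hφ (congrArg Subtype.val (Sum.inl.inj h))
  · cases h
  · cases h
  · obtain ⟨rfl, htorus⟩ := Prod.ext_iff.1 (Sum.inr.inj h)
    exact openBook_eq_of_toTorus_eq hφ _ htorus

lemma exists_pieces_of_openBookRel (p q : fourHoledSphere × I) (h : OpenBookRel φ p q) :
    ∃ a b, piecesToProduct a = p ∧ piecesToProduct b = q ∧
      (Quot.mk _ (piecesToSurgery hm a) : Surgery (tube · hm)) =
        Quot.mk _ (piecesToSurgery hm b) := by
  obtain x | ⟨x, hx, s, t⟩ := h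
  · rcases Collar.isFar_or_exists_point_eq x with hfar | ⟨i, w, rfl⟩
    · exact ⟨Sum.inl ⟨_, hfar⟩, Sum.inl ⟨(_, 0), isFar_monodromy hφ hfar⟩, rfl, rfl,
        congrArg (fun y => Quot.mk _ (Sum.inl y)) (Subtype.ext (m.page_monodromy hφ x))⟩
    · rw [monodromy_point hφ]
      exact ⟨Sum.inr (i, w, 1), Sum.inr (i, w, 0), rfl, rfl,
        congrArg (fun y => Quot.mk _ (Sum.inr (i, y))) w.toTorus_one⟩
  · rcases frontier_cases x.2 hx with hout | ⟨i, hi⟩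
    · have hfar : IsFar x := fun i => by
        linarith [norm_sub_norm_le (x : ℂ) (basePoint.1 i), norm_basePoint_le i]
      exact ⟨Sum.inl ⟨(x, s), hfar⟩, Sum.inl ⟨(x, t), hfar⟩, rfl, rfl,
        congrArg (fun y => Quot.mk _ (Sum.inl y)) (Subtype.ext (m.page_eq_of_norm hout s t))⟩
    · obtain ⟨w, rfl⟩ := Collar.exists_point_eq (hi.le.trans (by norm_num))
      rw [Collar.point_sub] at hi
      exact ⟨Sum.inr (i, w, s), Sum.inr (i, w, t), rfl, rfl,
        congrArg (fun y => Quot.mk _ (Sum.inr (i, y))) (Collar.toTorus_eq_of_norm hi s t)⟩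

end

lemma exists_pieces_of_surgeryRel
    (x y : Exterior (tube · hm) ⊕ (Fin 3 × Metric.closedBall (0 : ℂ) 1 × Circle))
    (h : SurgeryRel (tube · hm) x y) :
    ∃ a b, piecesToSurgery hm a = x ∧ piecesToSurgery hm b = y ∧
      (Quot.mk _ (piecesToProduct a) : OpenBook φ) = Quot.mk _ (piecesToProduct b) := by
  obtain ⟨i, d, u, v, x, hd, hx⟩ := h
  have hnorm : ‖(d : ℂ)‖ = 1 := by rw [hd, Circle.norm_coe]
  obtain ⟨w, hwv, hw⟩ := Collar.exists_toTorus_eq d (u := u)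
    (by rw [hnorm, Complex.ofReal_one, one_mul, hd]) v
  have hwn : w.1 = (5 / 4 : ℝ) * v := by
    rw [hwv, hnorm]
    norm_num
  have hfar : IsFar (w.point i) := Collar.isFar_point (by
    rw [hwn, norm_mul, Circle.norm_coe, mul_one, Complex.norm_real]
    norm_num) i
  refine ⟨Sum.inr (i, w, time u), Sum.inl ⟨(w.point i, time u), hfar⟩,
    congrArg Sum.inr (Prod.ext rfl hw), congrArg Sum.inl (Subtype.ext ?_), rfl⟩
  rw [hx]
  refine (m.page_eq_tubeFun (i := i) (w := v) (time u) ?_).trans ?_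
  · rw [radial_of_norm_one (Circle.norm_coe _), ← hwn]
    rfl
  · rw [turn_time]
    rfl

include hφ in
/-- The product of a page and an interval is cut into the far part, which becomes the exterior of
the closed braid, and the collars of the holes, which become the solid tori. -/
lemma exists_surgery_homeo : ∃ h : OpenBook φ ≃ₜ Surgery (tube · hm), ∀ a,
    h (Quot.mk _ (piecesToProduct a)) = Quot.mk _ (piecesToSurgery hm a) :=
  exists_quotHomeo isQuotientMap_piecesToProduct (isQuotientMap_piecesToSurgery hm)
    (surgery_eq_of_piecesToProduct_eq hm) (openBook_eq_of_piecesToSurgery_eq hm hφ)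
    (exists_pieces_of_openBookRel hm hφ) (exists_pieces_of_surgeryRel hm)

end Motion

lemma hasLocalDegreeOne_scale {c : ℝ} (hc : 0 < c) (p : ℂ × ℝ) :
    HasLocalDegreeOne (fun q => (q.1, c * q.2)) p := by
  refine ⟨1, one_pos, fun x => (x.2.1, c * p.2 + AffineMap.lineMap c 1 x.1 * (x.2.2 - p.2)),
    ?_, ?_, ?_, ?_⟩
  · simp only [AffineMap.lineMap_apply_ring']
    exact Continuous.continuousOn (by fun_prop)
  · intro q _
    refine Prod.ext rfl ?_
    change c * p.2 + AffineMap.lineMap c 1 (0 : ℝ) * (q.2 - p.2) = c * q.2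
    rw [AffineMap.lineMap_apply_zero, mul_sub, add_sub_cancel]
  · intro q _
    simp only [AffineMap.lineMap_apply_one]
    ext <;> simp
  · intro s hs q _
    have hk : AffineMap.lineMap c 1 s ≠ 0 :=
      ne_of_gt ((convex_Ioi (0 : ℝ)).lineMap_mem hc (Set.mem_Ioi.2 one_pos) hs)
    simp only [Prod.ext_iff, add_eq_left, mul_eq_zero, hk, false_or, sub_eq_zero]

lemma norm_lt_and_far_of_near_five_I {z : ℂ} (hz : ‖z - 5 * Complex.I‖ < 1) :
    ‖z‖ < 6 ∧ ∀ i, 4 < ‖z - basePoint.1 i‖ := by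
  have h5 : ‖5 * Complex.I‖ = 5 := by simp
  refine ⟨by linarith [norm_sub_norm_le z (5 * Complex.I)], fun i => ?_⟩
  have him : |(5 * Complex.I - basePoint.1 i).im| = 5 := by simp [basePoint_eq_center]
  have hi := him.symm.trans_le (Complex.abs_im_le_norm _)
  have htri := norm_sub_le_norm_sub_add_norm_sub (5 * Complex.I) z (basePoint.1 i)
  rw [norm_sub_rev _ z] at htri
  linarith

namespace Motion

variable {m : Motion} (hm : m.Delayed) {φ : RelHomeo fourHoledSphere}

lemma preservesOrientation_of_eq {h : OpenBook φ → Surgery (tube · hm)}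
    (hh : ∀ p : FarPart, (p.1.2 : ℝ) ≤ 1 / 2 →
      h (Quot.mk _ p.1) = Quot.mk _ (Sum.inl (toExterior hm p))) :
    PreservesOrientation (openBookCoord φ) (surgeryCoord (tube · hm)) h := by
  refine ⟨(5 * Complex.I, 1 / 4), fun q => (q.1, 2 * Real.pi * q.2), ?_,
    hasLocalDegreeOne_scale Real.two_pi_pos _⟩
  have hspace : ∀ᶠ q : ℂ × ℝ in nhds (5 * Complex.I, 1 / 4), ‖q.1 - 5 * Complex.I‖ < 1 := by
    have hcont : Continuous fun q : ℂ × ℝ => ‖q.1 - 5 * Complex.I‖ := by fun_prop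
    exact (hcont.tendsto _).eventually (gt_mem_nhds (by simp))
  have htime : ∀ᶠ q : ℂ × ℝ in nhds (5 * Complex.I, 1 / 4), 0 < q.2 ∧ q.2 < 1 / 2 :=
    (continuous_snd.tendsto _).eventually (Ioo_mem_nhds (by norm_num) (by norm_num))
  filter_upwards [hspace, htime] with ⟨z, t⟩ hz ht
  obtain ⟨hz6, hz4⟩ := norm_lt_and_far_of_near_five_I hz
  have hmem : z ∈ fourHoledSphere :=
    mem_fourHoledSphere_iff.2 ⟨by linarith, fun i => by linarith [hz4 i]⟩
  let p : FarPart := ⟨(⟨z, hmem⟩, ⟨t, ht.1.le, by linarith⟩), fun i => by linarith [hz4 i]⟩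
  refine ⟨Quot.mk _ p.1, ⟨p.1.1, p.1.2, ?_, ht.1, show t < 1 by linarith, rfl, rfl⟩,
    toExterior hm p, fun i u w _ he => ?_, ?_, hh p ht.2.le⟩
  · exact mem_interior_fourHoledSphere (by linarith) fun i => by linarith [hz4 i]
  · have hzw : z = basePoint.1 i + radial w := m.eq_of_tubeFun_eq_page he
    linarith [hzw ▸ hz4 i, norm_add_radial_sub_lt i w]
  · change m.page (toDisk p.1.1) p.1.2 = sphereCoord (z, 2 * Real.pi * t)
    rw [m.page_of_lt (show ‖z‖ < 10 by linarith), sphereCoord_turn]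
    change cyl (_, m.position t z) = _
    rw [m.position_of_le t (by linarith), hm.1 _ ht.2.le]

include hm in
lemma isDehnSurgery_trace {ψ : RelHomeo fourHoledSphere} (hψ : m.EndsAt ψ)
    (h : mappingClass φ = mappingClass ψ) :
    IsDehnSurgery (OpenBook φ) (openBookCoord φ) m.trace.closure m.framing := by
  obtain ⟨k, hk⟩ := exists_openBook_homeo h
  obtain ⟨g, hg⟩ := exists_surgery_homeo hm hψ
  refine ⟨(tube · hm), fun i j hij => disjoint_range_tube hm hij, fun i => hasFraming_tube i hm,
    k.trans g, preservesOrientation_of_eq hm fun p hp => ?_⟩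
  exact (congrArg g (hk p.1.1 p.1.2 hp)).trans (hg (Sum.inl p))

end Motion

/-! ### Homeomorphisms of the three-sphere that move the fibres of the solid torus -/

lemma bijective_add_of_lipschitzWith {E : Type*} [NormedAddCommGroup E] [CompleteSpace E]
    {K : NNReal} (hK : K < 1) {f : E → E} (hf : LipschitzWith K f) :
    Function.Bijective fun z => z + f z := by
  refine ⟨((AntilipschitzWith.id (α := E)).add_lipschitzWith hf (by rwa [inv_one])).injective,
    fun y => ?_⟩
  have hc : ContractingWith K fun z => y - f z :=
    ⟨hK, LipschitzWith.of_dist_le_mul fun z w => by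
      rw [dist_sub_left]
      exact hf.dist_le_mul z w⟩
  exact ⟨hc.fixedPoint, (sub_eq_iff_eq_add.1 hc.fixedPoint_isFixedPt).symm⟩

lemma one_eq_zero_or_exists_cyl_eq (x : S3) : x.1 1 = 0 ∨ ∃ u z, cyl (u, z) = x :=
  or_iff_not_imp_left.2 fun hx => ⟨_, _, cyl_cylInv hx⟩

section Displacement

variable {h : Circle → ℂ → ℂ}

lemma displace_ne_zero (h : Circle → ℂ → ℂ) (x : S3) :
    x.1 0 + ‖x.1 1‖ * h (direction (x.1 1)) (x.1 0 / ‖x.1 1‖) ≠ 0 ∨ x.1 1 ≠ 0 := by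
  refine or_iff_not_imp_right.2 fun hx => ?_
  rw [not_not.1 hx, norm_zero, Complex.ofReal_zero, zero_mul, add_zero]
  exact (s3_ne_zero x).resolve_right hx

/-- The map of the three-sphere that adds `h u z` to the coordinate `z` in the fibre over `u`,
and fixes the circle at infinity. -/
def displace (h : Circle → ℂ → ℂ) (x : S3) : S3 := proj _ _ (displace_ne_zero h x)

lemma displace_cyl (u : Circle) (z : ℂ) : displace h (cyl (u, z)) = cyl (u, z + h u z) := by
  have hn : 0 < ‖(cyl (u, z)).1 1‖ := norm_pos_iff.2 (cyl_one_ne_zero (u, z))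
  have hu : direction ((cyl (u, z)).1 1) = u := congrArg Prod.fst (cylInv_cyl (u, z))
  have hz : (cyl (u, z)).1 0 / ‖(cyl (u, z)).1 1‖ = z := congrArg Prod.snd (cylInv_cyl (u, z))
  refine proj_eq_iff.2 ⟨‖(cyl (u, z)).1 1‖, hn, ?_, ?_⟩
  · rw [hu, hz, mul_add, (div_eq_iff (Complex.ofReal_ne_zero.2 hn.ne')).1 hz, mul_comm z]
  · exact (hu ▸ norm_mul_direction _).symm

lemma displace_of_one_eq_zero {x : S3} (hx : x.1 1 = 0) : displace h x = x := by
  refine (proj_congr ?_ rfl).trans (proj_self x)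
  rw [hx, norm_zero, Complex.ofReal_zero, zero_mul, add_zero]

lemma displace_bijective (hb : ∀ u, Function.Bijective fun z => z + h u z) :
    Function.Bijective (displace h) := by
  refine ⟨fun x y hxy => ?_, fun y => ?_⟩
  · rcases one_eq_zero_or_exists_cyl_eq x with hx | ⟨u, z, rfl⟩ <;>
      rcases one_eq_zero_or_exists_cyl_eq y with hy | ⟨u', z', rfl⟩
    · rwa [displace_of_one_eq_zero hx, displace_of_one_eq_zero hy] at hxy
    · rw [displace_of_one_eq_zero hx, displace_cyl] at hxy
      exact absurd (hxy ▸ hx) (cyl_one_ne_zero _)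
    · rw [displace_of_one_eq_zero hy, displace_cyl] at hxy
      exact absurd (hxy ▸ hy) (cyl_one_ne_zero _)
    · rw [displace_cyl, displace_cyl] at hxy
      obtain ⟨rfl, hz⟩ := Prod.ext_iff.1 (cyl_injective hxy)
      rw [(hb u).1 hz]
  · rcases one_eq_zero_or_exists_cyl_eq y with hy | ⟨u, z, rfl⟩
    · exact ⟨y, displace_of_one_eq_zero hy⟩
    · obtain ⟨z', rfl⟩ := (hb u).2 z
      exact ⟨cyl (u, z'), displace_cyl u z'⟩

lemma continuous_displace (hc : Continuous fun p : Circle × ℂ => h p.1 p.2) {B : ℝ}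
    (hB : ∀ u z, ‖h u z‖ ≤ B) : Continuous (displace h) := by
  have h1 := continuous_s3_apply 1
  refine continuous_proj
    ((continuous_s3_apply 0).add (continuous_iff_continuousAt.2 fun x => ?_)) h1 _
  by_cases hx : x.1 1 = 0
  · have hlim : Filter.Tendsto (fun y : S3 => ‖y.1 1‖ * B) (nhds x) (nhds 0) := by
      have hcont : Continuous fun y : S3 => ‖y.1 1‖ * B := h1.norm.mul continuous_const
      simpa only [hx, norm_zero, zero_mul] using hcont.tendsto x
    rw [ContinuousAt, hx, norm_zero, Complex.ofReal_zero, zero_mul]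
    refine squeeze_zero_norm (fun y => ?_) hlim
    rw [norm_mul, Complex.norm_real, norm_norm]
    exact mul_le_mul_of_nonneg_left (hB _ _) (norm_nonneg _)
  · have hcyl : ContinuousOn (fun y : S3 => h (cylInv y).1 (cylInv y).2) {y : S3 | y.1 1 ≠ 0} :=
      hc.comp_continuousOn continuousOn_cylInv
    exact (Complex.continuous_ofReal.comp h1.norm).continuousAt.mul
      (hcyl.continuousAt (isOpen_s3_one_ne_zero.mem_nhds hx))

/-- The homeomorphism `displace h` of the three-sphere. -/
def displaceHomeo (hc : Continuous fun p : Circle × ℂ => h p.1 p.2) {B : ℝ}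
    (hB : ∀ u z, ‖h u z‖ ≤ B) (hb : ∀ u, Function.Bijective fun z => z + h u z) : S3 ≃ₜ S3 :=
  (continuous_displace hc hB).homeoOfEquivCompactToT2
    (f := Equiv.ofBijective _ (displace_bijective hb))

end Displacement

/-! ### Transport of a surgery by a homeomorphism of the three-sphere -/

/-- A homeomorphism of the three-sphere that preserves the orientation in a strong sense: in the
coordinates, it is the end of an isotopy that starts at the identity. -/
structure CoordIsotopy (g : S3 ≃ₜ S3) where
  toFun : ℝ → ℂ × ℝ → ℂ × ℝ
  continuous_toFun : Continuous fun p : ℝ × (ℂ × ℝ) => toFun p.1 p.2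
  injective : ∀ s ∈ Set.Icc (0 : ℝ) 1, Function.Injective (toFun s)
  start : ∀ q, toFun 0 q = q
  finish : ∀ q, g (sphereCoord q) = sphereCoord (toFun 1 q)

namespace CoordIsotopy

/-- The displacement along the fibres as an isotopy: the displacement is multiplied by the time. -/
def displacement {h : Circle → ℂ → ℂ} (hc : Continuous fun p : Circle × ℂ => h p.1 p.2) {B : ℝ}
    (hB : ∀ u z, ‖h u z‖ ≤ B) {K : NNReal} (hK : K < 1) (hlip : ∀ u, LipschitzWith K (h u)) :
    CoordIsotopy (displaceHomeo hc hB fun u => bijective_add_of_lipschitzWith hK (hlip u)) where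
  toFun s q := (q.1 + s * h (Circle.exp q.2) q.1, q.2)
  continuous_toFun := by
    have hexp : Continuous fun p : ℝ × (ℂ × ℝ) => h (Circle.exp p.2.2) p.2.1 :=
      hc.comp (f := fun p : ℝ × (ℂ × ℝ) => (Circle.exp p.2.2, p.2.1)) (by fun_prop)
    exact Continuous.prodMk
      (Continuous.add (by fun_prop) (Continuous.mul (by fun_prop) hexp)) (by fun_prop)
  injective := by
    rintro s hs ⟨z, θ⟩ ⟨z', θ'⟩ hq
    obtain ⟨hz, rfl⟩ := Prod.ext_iff.1 hq
    have hscale : LipschitzWith K fun z => (s : ℂ) * h (Circle.exp θ) z := by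
      refine LipschitzWith.of_dist_le_mul fun z w => ?_
      rw [dist_eq_norm, ← mul_sub, norm_mul, Complex.norm_real, Real.norm_of_nonneg hs.1,
        ← dist_eq_norm]
      exact (mul_le_of_le_one_left dist_nonneg hs.2).trans ((hlip _).dist_le_mul z w)
    exact Prod.ext ((bijective_add_of_lipschitzWith hK hscale).1 hz) rfl
  start q := by rw [Complex.ofReal_zero, zero_mul, add_zero]
  finish := by
    rintro ⟨z, θ⟩
    rw [sphereCoord_eq_cyl, sphereCoord_eq_cyl, Complex.ofReal_one, one_mul]
    exact displace_cyl _ z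

variable {g : S3 ≃ₜ S3} (G : CoordIsotopy g)

lemma hasLocalDegreeOne {f : ℂ × ℝ → ℂ × ℝ} {p : ℂ × ℝ} (hf : HasLocalDegreeOne f p) :
    HasLocalDegreeOne (fun q => G.toFun 1 (f q)) p := by
  obtain ⟨r, hr, H, hH, hH0, hH1, hHp⟩ := hf
  -- The isotopy `G` runs backwards on `f`, and then the homotopy `H` of `f` follows.
  refine ⟨r, hr, fun x => G.toFun 1 (f p) + (G.toFun (clamp (1 - 2 * x.1))
    (H (clamp (2 * x.1 - 1), x.2)) - G.toFun (clamp (1 - 2 * x.1)) (f p)), ?_, ?_, ?_, ?_⟩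
  · have hHc : ContinuousOn (fun x : ℝ × (ℂ × ℝ) => H (clamp (2 * x.1 - 1), x.2))
        (Set.Icc 0 1 ×ˢ Metric.ball p r) :=
      hH.comp (Continuous.continuousOn (by fun_prop)) fun x hx => ⟨(clamp _).2, hx.2⟩
    have hGc : ContinuousOn (fun x : ℝ × (ℂ × ℝ) => (clamp (1 - 2 * x.1) : ℝ))
        (Set.Icc 0 1 ×ˢ Metric.ball p r) := Continuous.continuousOn (by fun_prop)
    exact continuousOn_const.add ((G.continuous_toFun.comp_continuousOn (hGc.prodMk hHc)).sub
      (G.continuous_toFun.comp_continuousOn (hGc.prodMk continuousOn_const)))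
  · intro q hq
    dsimp only
    rw [clamp_of_one_le (by norm_num), clamp_of_nonpos (by norm_num), Set.Icc.coe_zero,
      Set.Icc.coe_one, hH0 q hq, add_sub_cancel]
  · intro q hq
    dsimp only
    rw [clamp_of_nonpos (by norm_num), clamp_of_one_le (by norm_num), Set.Icc.coe_zero,
      Set.Icc.coe_one, hH1 q hq, G.start, G.start, add_sub_cancel_left]
  · intro s _ q hq
    rw [add_eq_left, sub_eq_zero, (G.injective _ (clamp _).2).eq_iff]
    exact hHp _ (clamp _).2 q hq

variable {K K' : Set S3}

/-- The image of a tube. -/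
def mapTube (hK : g '' K = K') (e : Tube K) : Tube K' where
  toFun p := g (e.toFun p)
  isOpenEmbedding := g.isOpenEmbedding.comp e.isOpenEmbedding
  core := by
    rw [← hK]
    conv_lhs => rw [e.core]
    rw [← Set.range_comp]
    rfl
  orientation := by
    obtain ⟨p, f, h, hf⟩ := e.orientation
    refine ⟨p, _, ?_, G.hasLocalDegreeOne hf⟩
    filter_upwards [h] with q ⟨x, hx, hx'⟩
    exact ⟨x, hx, (congrArg g hx').trans (G.finish _)⟩

lemma hasFraming_mapTube (hK : g '' K = K') {e : Tube K} {n : ℤ} (he : e.HasFraming n) :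
    (G.mapTube hK e).HasFraming n := by
  have hcompl (x : S3) (hx : x ∉ K) : g x ∉ K' := by
    rw [← hK]
    rintro ⟨y, hy, hyx⟩
    exact hx (g.injective hyx ▸ hy)
  let c : C({x : S3 // x ∉ K}, {x : S3 // x ∉ K'}) :=
    ⟨fun x => ⟨g x, hcompl x x.2⟩, by fun_prop⟩
  have h := congrArg (Abelianization.map (FundamentalGroup.map c e.base)) he
  rwa [map_zpow] at h

variable {n : ℕ} {L L' : Fin n → Set S3}

/-- The homeomorphism of the exteriors. -/
def exteriorHomeo (hL : ∀ i, g '' L i = L' i) (e : ∀ i, Tube (L i)) :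
    Exterior e ≃ₜ Exterior fun i => G.mapTube (hL i) (e i) :=
  g.subtype fun _ => forall₄_congr fun _ _ _ _ => g.injective.ne_iff.symm

/-- The homeomorphism of the surgered manifolds. -/
def surgeryHomeo (hL : ∀ i, g '' L i = L' i) (e : ∀ i, Tube (L i)) :
    Surgery e ≃ₜ Surgery fun i => G.mapTube (hL i) (e i) :=
  quotHomeo ((G.exteriorHomeo hL e).sumCongr (Homeomorph.refl _)) (by
    rintro _ _ ⟨i, d, u, v, x, hd, hx⟩
    exact Quot.sound (SurgeryRel.glue i d u v _ hd (congrArg g hx))) (by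
    rintro _ _ ⟨i, d, u, v, x, hd, hx⟩
    refine Quot.sound (SurgeryRel.glue i d u v _ hd (g.injective (Eq.trans ?_ hx)))
    exact congrArg Subtype.val ((G.exteriorHomeo hL e).apply_symm_apply x))

include G in
lemma isDehnSurgery {Y : Type} [TopologicalSpace Y] {R : ℂ × ℝ → Y → Prop} {c : Fin n → ℤ}
    (hL : ∀ i, g '' L i = L' i) (h : IsDehnSurgery Y R L c) : IsDehnSurgery Y R L' c := by
  obtain ⟨e, he, hc, k, p, f, hk, hf⟩ := h
  refine ⟨fun i => G.mapTube (hL i) (e i), fun i j hij => ?_,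
    fun i => G.hasFraming_mapTube (hL i) (hc i), k.trans (G.surgeryHomeo hL e), p, _, ?_,
    G.hasLocalDegreeOne hf⟩
  · change Disjoint (Set.range (g ∘ (e i).toFun)) (Set.range (g ∘ (e j).toFun))
    rw [Set.range_comp, Set.range_comp]
    exact (Set.disjoint_image_iff g.injective).2 (he i j hij)
  · filter_upwards [hk] with q ⟨y, hy, x, hx, hqx, hyx⟩
    exact ⟨y, hy, G.exteriorHomeo hL e x, fun i u w hw h => hx i u w hw (g.injective h),
      (congrArg g hqx).trans (G.finish _), congrArg (G.surgeryHomeo hL e) hyx⟩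

end CoordIsotopy

/-! ### Isotopy invariance of the surgery -/

section Bump

variable {X E ι : Type*} [PseudoMetricSpace X] [SeminormedAddCommGroup E] [NormedSpace ℝ E]

/-- The function with the graph of a tent: it is `1` at `x` and `0` outside the ball of radius `ρ`
about `x`. -/
def tent (ρ : ℝ) (x z : X) : ℝ := max (1 - dist z x / ρ) 0

lemma tent_self (ρ : ℝ) (x : X) : tent ρ x x = 1 := by
  rw [tent, dist_self, zero_div, sub_zero, max_eq_left zero_le_one]

variable {ρ : ℝ} (hρ : 0 < ρ)

include hρ

lemma tent_eq_zero {x z : X} (h : ρ ≤ dist z x) : tent ρ x z = 0 :=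
  max_eq_right (sub_nonpos.2 ((one_le_div hρ).2 h))

lemma norm_tent_le_one (x z : X) : ‖tent ρ x z‖ ≤ 1 := by
  rw [tent, Real.norm_of_nonneg (le_max_right _ _)]
  exact max_le (sub_le_self _ (by positivity)) zero_le_one

lemma abs_tent_sub_tent_le (x z w : X) : |tent ρ x z - tent ρ x w| ≤ dist z w / ρ := by
  calc |tent ρ x z - tent ρ x w|
      ≤ |1 - dist z x / ρ - (1 - dist w x / ρ)| := abs_max_sub_max_le_abs _ _ _
    _ = |dist z x - dist w x| / ρ := by
        rw [sub_sub_sub_cancel_left, ← sub_div, abs_div, abs_of_pos hρ, abs_sub_comm]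
    _ ≤ dist z w / ρ := by
        gcongr
        exact abs_dist_sub_le z w x

omit hρ

variable [Fintype ι]

/-- The displacement that carries the points `x i` along the vectors `v i`, and has support in the
balls of radius `ρ` about these points. -/
def bump (x : ι → X) (v : ι → E) (ρ : ℝ) (z : X) : E := ∑ i, tent ρ (x i) z • v i

include hρ

lemma bump_apply_self {x : ι → X} (hx : ∀ i j, i ≠ j → ρ ≤ dist (x i) (x j)) (v : ι → E) (i : ι) :
    bump x v ρ (x i) = v i := by
  rw [bump, Finset.sum_eq_single i]
  · rw [tent_self, one_smul]
  · intro j _ hj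
    rw [tent_eq_zero hρ (hx i j hj.symm), zero_smul]
  · exact fun hi => absurd (Finset.mem_univ i) hi

lemma norm_bump_le (x : ι → X) (v : ι → E) (z : X) : ‖bump x v ρ z‖ ≤ ∑ i, ‖v i‖ := by
  refine norm_sum_le_of_le _ fun i _ => ?_
  rw [norm_smul]
  exact mul_le_of_le_one_left (norm_nonneg _) (norm_tent_le_one hρ _ _)

lemma lipschitzWith_bump (x : ι → X) {v : ι → E} {K : NNReal} (hv : ∑ i, ‖v i‖ ≤ K * ρ) :
    LipschitzWith K (bump x v ρ) := by
  refine LipschitzWith.of_dist_le_mul fun z w => ?_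
  calc dist (bump x v ρ z) (bump x v ρ w)
      = ‖∑ i, (tent ρ (x i) z - tent ρ (x i) w) • v i‖ := by
        simp only [dist_eq_norm, bump, ← Finset.sum_sub_distrib, sub_smul]
    _ ≤ ∑ i, dist z w / ρ * ‖v i‖ := norm_sum_le_of_le _ fun i _ => by
        rw [norm_smul, Real.norm_eq_abs]
        gcongr
        exact abs_tent_sub_tent_le hρ _ _ _
    _ = dist z w / ρ * ∑ i, ‖v i‖ := (Finset.mul_sum _ _ _).symm
    _ ≤ dist z w / ρ * (K * ρ) := by gcongr
    _ = K * dist z w := by field_simp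

end Bump

namespace PureBraid

/-- The position of the `i`-th strand over a point of the circle. -/
def strand (b : PureBraid) (i : Fin 3) (u : Circle) : ℂ := (b (time u)).1 i

lemma strand_turn (b : PureBraid) (i : Fin 3) (t : I) : b.strand i (turn t) = (b t).1 i := by
  refine apply_time_turn (f := fun t : I => (b t).1 i) ?_ t
  rw [b.source, b.target]

@[fun_prop]
lemma continuous_strand (b : PureBraid) (i : Fin 3) : Continuous (b.strand i) := by
  refine continuous_comp_time (f := fun t : I => (b t).1 i) ?_ ?_
  · exact (continuous_conf_apply i).comp b.continuous
  · rw [b.source, b.target]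

lemma closure_eq_range (b : PureBraid) (i : Fin 3) :
    b.closure i = Set.range fun t : I => cyl (turn t, (b t).1 i) := by
  simp only [closure, sphereCoord_turn]

/-- The displacement of the fibres that carries the strands of `b` to the strands of `b'`. -/
def carry (b b' : PureBraid) (ρ : ℝ) (u : Circle) : ℂ → ℂ :=
  bump (b.strand · u) (fun i => b'.strand i u - b.strand i u) ρ

lemma continuous_carry (b b' : PureBraid) (ρ : ℝ) :
    Continuous fun p : Circle × ℂ => carry b b' ρ p.1 p.2 := by
  unfold carry bump tent
  fun_prop

variable {b b' : PureBraid} {ρ : ℝ} (hρ : 0 < ρ)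

include hρ

lemma carry_turn (hb : ∀ t i j, i ≠ j → ρ ≤ ‖(b t).1 i - (b t).1 j‖) (t : I) (i : Fin 3) :
    carry b b' ρ (turn t) ((b t).1 i) = (b' t).1 i - (b t).1 i := by
  rw [← b.strand_turn, ← b'.strand_turn]
  refine bump_apply_self hρ (fun i j hij => ?_) _ i
  rw [dist_eq_norm]
  exact hb _ i j hij

/-- Moving each of three `ρ`-separated strands by at most `ρ / 6` takes a displacement of the fibres
with Lipschitz constant `3 * (ρ / 6) / ρ = 1 / 2`. -/
lemma exists_isotopy_of_near (hb : ∀ t i j, i ≠ j → ρ ≤ ‖(b t).1 i - (b t).1 j‖)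
    (hb' : ∀ t i, ‖(b' t).1 i - (b t).1 i‖ ≤ ρ / 6) :
    ∃ (g : S3 ≃ₜ S3) (_ : CoordIsotopy g), ∀ i, g '' b.closure i = b'.closure i := by
  have hsum (u : Circle) : ∑ i, ‖b'.strand i u - b.strand i u‖ ≤ (1 / 2 : NNReal) * ρ := by
    have hi (i : Fin 3) : ‖b'.strand i u - b.strand i u‖ ≤ ρ / 6 := hb' (time u) i
    rw [Fin.sum_univ_three]
    push_cast
    linarith [hi 0, hi 1, hi 2]
  let G := CoordIsotopy.displacement (continuous_carry b b' ρ)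
    (fun u z => (norm_bump_le hρ _ _ z).trans (hsum u)) one_half_lt_one
    fun u => lipschitzWith_bump hρ _ (hsum u)
  refine ⟨_, G, fun i => ?_⟩
  rw [b.closure_eq_range, b'.closure_eq_range, ← Set.range_comp]
  congr 1
  funext t
  refine (displace_cyl _ _).trans ?_
  rw [carry_turn hρ hb, add_sub_cancel]

end PureBraid

/-- The least distance between two points of a configuration. -/
def gap (x : Conf) : ℝ := min ‖x.1 0 - x.1 1‖ (min ‖x.1 0 - x.1 2‖ ‖x.1 1 - x.1 2‖)

lemma continuous_gap : Continuous gap := by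
  have h (i j : Fin 3) : Continuous fun x : Conf => ‖x.1 i - x.1 j‖ :=
    ((continuous_conf_apply i).sub (continuous_conf_apply j)).norm
  exact (h 0 1).min ((h 0 2).min (h 1 2))

lemma gap_pos (x : Conf) : 0 < gap x := by
  have h {i j : Fin 3} (hij : i ≠ j) : 0 < ‖x.1 i - x.1 j‖ :=
    norm_pos_iff.2 (sub_ne_zero.2 (x.2.ne hij))
  exact lt_min (h (by decide)) (lt_min (h (by decide)) (h (by decide)))

lemma gap_le (x : Conf) {i j : Fin 3} (hij : i ≠ j) : gap x ≤ ‖x.1 i - x.1 j‖ := by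
  wlog h : i < j generalizing i j
  · rw [norm_sub_rev]
    exact this hij.symm (hij.lt_or_gt.resolve_left h)
  rcases lt_cases_fin_three h with ⟨rfl, rfl⟩ | ⟨rfl, rfl⟩ | ⟨rfl, rfl⟩
  · exact min_le_left _ _
  · exact (min_le_right _ _).trans (min_le_left _ _)
  · exact (min_le_right _ _).trans (min_le_right _ _)

namespace IsDehnSurgery

variable {Y : Type} [TopologicalSpace Y] {R : ℂ × ℝ → Y → Prop} {c : Fin 3 → ℤ}
  {b b' : PureBraid}

lemma of_near {ρ : ℝ} (hρ : 0 < ρ) (hb : ∀ t i j, i ≠ j → ρ ≤ ‖(b t).1 i - (b t).1 j‖)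
    (hb' : ∀ t i, ‖(b' t).1 i - (b t).1 i‖ ≤ ρ / 6) (h : IsDehnSurgery Y R b.closure c) :
    IsDehnSurgery Y R b'.closure c := by
  obtain ⟨g, G, hg⟩ := PureBraid.exists_isotopy_of_near hρ hb hb'
  exact G.isDehnSurgery hg h

lemma isLocallyConstant (F : Path.Homotopy b b') :
    IsLocallyConstant fun s : I => IsDehnSurgery Y R (PureBraid.closure (F.eval s)) c := by
  obtain ⟨p, -, hp⟩ := isCompact_univ.exists_isMinOn (Set.univ_nonempty (α := I × I))
    (continuous_gap.comp F.continuous).continuousOn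
  have hpos : 0 < gap (F p) := gap_pos _
  have hsep (s t : I) (i j : Fin 3) (hij : i ≠ j) :
      gap (F p) ≤ ‖(F.eval s t).1 i - (F.eval s t).1 j‖ :=
    (hp (Set.mem_univ (s, t))).trans (gap_le _ hij)
  refine (IsLocallyConstant.iff_eventually_eq _).2 fun s => ?_
  have hcurry : Continuous fun s : I => F.toHomotopy.curry s := F.toHomotopy.curry.continuous
  filter_upwards [(hcurry.tendsto s).eventually (Metric.ball_mem_nhds _
    (div_pos hpos (by norm_num : (0 : ℝ) < 6)))] with s' hs'
  have hclose (t : I) (i : Fin 3) : ‖(F.eval s' t).1 i - (F.eval s t).1 i‖ ≤ gap (F p) / 6 := by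
    rw [← dist_eq_norm]
    exact (dist_le_pi_dist (F.eval s' t).1 (F.eval s t).1 i).trans
      ((ContinuousMap.dist_apply_le_dist t).trans (Metric.mem_ball.1 hs').le)
  refine propext ⟨of_near hpos (hsep s') fun t i => ?_, of_near hpos (hsep s) hclose⟩
  rw [norm_sub_rev]
  exact hclose t i

lemma of_homotopic (hbb' : Path.Homotopic b b') (h : IsDehnSurgery Y R b.closure c) :
    IsDehnSurgery Y R b'.closure c := by
  obtain ⟨F⟩ := hbb'
  have hends := (isLocallyConstant (Y := Y) (R := R) (c := c) F).apply_eq_of_preconnectedSpace 0 1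
  rw [F.eval_zero, F.eval_one] at hends
  exact hends ▸ h

end IsDehnSurgery

end OpenBookSurgery

end

open OpenBookSurgery

theorem proposition2p2 (α β γ δ : ℤ) (k : ℕ) (ε η : Fin k → ℤ)
    (φ : OpenBookSurgery.RelHomeo OpenBookSurgery.fourHoledSphere)
    (hφ : OpenBookSurgery.mappingClass φ =
      OpenBookSurgery.τa ^ α * OpenBookSurgery.τb ^ β * OpenBookSurgery.τc ^ γ *
        OpenBookSurgery.τd ^ δ *
        (List.ofFn fun i => OpenBookSurgery.τe ^ ε i * OpenBookSurgery.τf ^ η i).prod)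
    (word : OpenBookSurgery.BraidGroup)
    (hword : word =
      (OpenBookSurgery.σ₂ * OpenBookSurgery.σ₁ * OpenBookSurgery.σ₂) ^ (2 * δ) *
        (List.ofFn fun i =>
          OpenBookSurgery.σ₁ ^ (2 * ε i) * OpenBookSurgery.σ₂ ^ (2 * η i)).prod) :
    (∃ b : OpenBookSurgery.PureBraid, b.toBraid = word) ∧
    ∀ b : OpenBookSurgery.PureBraid, b.toBraid = word →
      OpenBookSurgery.IsDehnSurgery (OpenBookSurgery.OpenBook φ)
        (OpenBookSurgery.openBookCoord φ) b.closure
        ![α + δ + (∑ i, ε i), β + δ + (∑ i, ε i) + (∑ i, η i), γ + δ + (∑ i, η i)] := by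
  obtain ⟨ψ, hψ, m, hend, htrace, hframing⟩ := exists_motion_monodromy α β γ δ ε η
  obtain ⟨m', hdelayed, hend', htrace', hframing'⟩ := m.exists_delayed hend
  have hm' : m'.trace.toBraid = word := by
    rw [← pureToBraid_toPure, htrace', htrace, pureToBraid_monodromyPure, hword]
  have hsurgery := Motion.isDehnSurgery_trace hdelayed hend' (hφ.trans hψ.symm)
  rw [hframing', hframing] at hsurgery
  exact ⟨⟨m'.trace, hm'⟩, fun b hb =>
    hsurgery.of_homotopic (toBraid_eq_iff.1 (hm'.trans hb.symm))⟩
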